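/- Let $\gamma\ge 0$ and $V(x)=x^2$ on $\mathbb R$. For $N\in\mathbb N$ and $\beta>0$, the Gaussian $\beta$-ensemble is the probability measure on $\mathbb R^N$ $$\mathbb P_{N}(d\mathbf x)=\frac{1}{Z_N}\exp\Big(-\beta\sum_{1\le i<j\le N}\log|x_i-x_j|^{-1}-\sum_{j=1}^N x_j^2\Big)\,dx_1\cdots dx_N ,$$ where $Z_N\in(0,\infty)$ is the normalization constant. Put $\vartheta(x)=\log(1+|x|)$, let $\nu_\gamma$ be the probability measure proportional to $e^{-x^2+\gamma\vartheta(x)}\,dx$, and for a probability measure $\mu$ on $\mathbb R$ define the free energy $$\mathscr F_\gamma(\mu)=\frac{\gamma}{2}\iint\big(\log|x-z|^{-1}+\vartheta(x)+\vartheta(z)\big)\,\mu(dz)\,\mu(dx)+\mathrm H(\mu|\nu_\gamma)\in[0,+\infty],$$ where $\log 0^{-1}=+\infty$, $0\cdot\infty=0$ and $\mathrm H(\mu|\nu_\gamma)$ is the relative entropy, i.e. $\int\log\frac{d\mu}{d\nu_\gamma}\,d\mu$ if $\mu\ll\nu_\gamma$ and $+\infty$ otherwise. Then $\mathscr F_\gamma$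 has a unique minimizer $\mu_\gamma$ among the probability measures on $\mathbb R$ (the equilibrium measure), and there is a constant $\mathrm L_\gamma>0$ such that $$\mu_\gamma(dx)=\mathrm L_\gamma^{-1}e^{-\gamma\,\mathscr U^{\mu_\gamma}(x)-x^2}\,dx,\qquad \mathscr U^{\mu_\gamma}(x)=\int\log|x-z|^{-1}\mu_\gamma(dz),$$ where the last integral converges absolutely for every $x\in\mathbb R$. Moreover, let $(\beta_N)_{N}$ be any sequence of positive numbers with $\beta_N N\to\gamma$ as $N\to\infty$, and for $\mathbf x=(x_1,\dots,x_N)$ distributed according to the Gaussian $\beta$-ensemble with $\beta=\beta_N$ let $$\xi_N=2\Big(\sqrt{\log N}\,\max_{1\le j\le N}x_j-\log N\Big)-\frac{\beta_N N-1}{2}\log\log N+\log(2\mathrm L_\gamma).$$ Then, as $N\to\infty$, $\xi_N$ converges in distribution to a standard Gumbel random variable, that is, to the law on $\mathbb R$ with distribution function $t\mapsto\exp(-e^{-t})$. -/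

import Mathlib

open MeasureTheory Filter Topology
open scoped ENNReal

noncomputable section

namespace LogGas

/-! ### The β-ensemble on the real line -/

/-- The logarithmic kernel `g(x, z) = log |x - z|⁻¹`. Its value on the diagonal, where it should be
`+∞`, is irrelevant here: it is only used up to null sets of Lebesgue measure and inside integrals
against atomless measures. See `weightedKernel` for the kernel used in the energy functional. -/
def logKernel (x z : ℝ) : ℝ := Real.log (|x - z|⁻¹)

/-- The energy `β ∑_{i<j} log |x_i - x_j|⁻¹ + ∑_j V(x_j)` of a configuration. -/
def hamiltonian (V : ℝ → ℝ) (N : ℕ) (β : ℝ) (x : Fin N → ℝ) : ℝ :=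
  β * (∑ i, ∑ j ∈ Finset.Ioi i, logKernel (x i) (x j)) + ∑ j, V (x j)

/-- The partition function `Z_N = ∫ e^{-H_N(x)} dx`, as an extended non-negative number. -/
def partitionFunction (V : ℝ → ℝ) (N : ℕ) (β : ℝ) : ℝ≥0∞ :=
  ∫⁻ x : Fin N → ℝ, ENNReal.ofReal (Real.exp (-hamiltonian V N β x))

/-- The β-ensemble: the measure `Z_N⁻¹ e^{-H_N(x)} dx` on `ℝ^N`. -/
def gibbsMeasure (V : ℝ → ℝ) (N : ℕ) (β : ℝ) : Measure (Fin N → ℝ) :=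
  (partitionFunction V N β)⁻¹ •
    (volume : Measure (Fin N → ℝ)).withDensity
      fun x => ENNReal.ofReal (Real.exp (-hamiltonian V N β x))

/-! ### The free energy and the equilibrium measure -/

/-- The function `ϑ(x) = log (1 + |x|)`, for which `-g(x, z) ≤ ϑ(x) + ϑ(z)`. -/
def theta (x : ℝ) : ℝ := Real.log (1 + |x|)

open Classical in
/-- The weighted kernel `g(x, z) + ϑ(x) + ϑ(z)`, which is non-negative, and `+∞` on the
diagonal. -/
def weightedKernel (x z : ℝ) : ℝ≥0∞ :=
  if x = z then ⊤ else ENNReal.ofReal (logKernel x z + theta x + theta z)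

/-- The weighted energy `∬ (g(x, z) + ϑ(x) + ϑ(z)) μ(dz) μ(dx)`. -/
def weightedEnergy (μ : Measure ℝ) : ℝ≥0∞ := ∫⁻ x, ∫⁻ z, weightedKernel x z ∂μ ∂μ

/-- The density `e^{-(V(x) - γ ϑ(x))}`. -/
def referenceWeight (V : ℝ → ℝ) (γ : ℝ) (x : ℝ) : ℝ≥0∞ :=
  ENNReal.ofReal (Real.exp (-(V x - γ * theta x)))

/-- The reference measure `ν_γ(dx) = C_γ⁻¹ e^{-(V(x) - γ ϑ(x))} dx`, with `C_γ` the total mass of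
`e^{-(V(x) - γ ϑ(x))} dx`. -/
def referenceMeasure (V : ℝ → ℝ) (γ : ℝ) : Measure ℝ :=
  (∫⁻ x, referenceWeight V γ x)⁻¹ • (volume : Measure ℝ).withDensity (referenceWeight V γ)

/-- The free energy: `γ/2` times the weighted energy plus the relative entropy with respect to the
reference measure. -/
def freeEnergy (V : ℝ → ℝ) (γ : ℝ) (μ : Measure ℝ) : ℝ≥0∞ :=
  ENNReal.ofReal (γ / 2) * weightedEnergy μ +
    InformationTheory.klDiv μ (referenceMeasure V γ)

/-- `μ` is the equilibrium measure: the unique minimizer of the free energy among the probability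
measures on `ℝ`. -/
structure IsEquilibriumMeasure (V : ℝ → ℝ) (γ : ℝ) (μ : Measure ℝ) : Prop where
  isProbabilityMeasure : IsProbabilityMeasure μ
  isMinimizer : ∀ μ' : Measure ℝ, IsProbabilityMeasure μ' →
    freeEnergy V γ μ ≤ freeEnergy V γ μ'
  unique : ∀ μ' : Measure ℝ, IsProbabilityMeasure μ' →
    freeEnergy V γ μ' ≤ freeEnergy V γ μ → μ' = μ

/-- The potential `U^μ(x) = ∫ log |x - z|⁻¹ μ(dz)` generated by `μ`. -/
def potential (μ : Measure ℝ) (x : ℝ) : ℝ := ∫ z, logKernel x z ∂μ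

/-- `L` is the constant in the self-consistent equation
`μ(dx) = L⁻¹ e^{-γ U^μ(x) - V(x)} dx`, where `U^μ` is well defined at every point. -/
structure IsEquilibriumConstant (V : ℝ → ℝ) (γ : ℝ) (μ : Measure ℝ) (L : ℝ) : Prop where
  pos : 0 < L
  integrable : ∀ x, Integrable (fun z => logKernel x z) μ
  equation : μ = (volume : Measure ℝ).withDensity
    fun x => ENNReal.ofReal (L⁻¹ * Real.exp (-(γ * potential μ x) - V x))

/-! ### The statistic and the Gumbel law -/

/-- The rescaled maximum
`2 (√(log N) max_j x_j - log N) - (βN - 1)/2 log log N + log (2L)`. -/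
def rescaledMax (L : ℝ) (N : ℕ) (β : ℝ) (x : Fin N → ℝ) : ℝ :=
  2 * (√(Real.log N) * (⨆ j, x j) - Real.log N)
    - (β * N - 1) / 2 * Real.log (Real.log N) + Real.log (2 * L)

/-- The Gumbel distribution function `t ↦ exp (-e^{-t})`. -/
def gumbelCDF : StieltjesFunction ℝ where
  toFun t := Real.exp (-Real.exp (-t))
  mono' := fun s t h => by
    dsimp only
    gcongr
  right_continuous' := fun x => by
    apply Continuous.continuousWithinAt
    fun_prop

/-- The standard Gumbel law: the measure on `ℝ` with distribution function `exp (-e^{-t})`. -/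
def gumbelMeasure : Measure ℝ := gumbelCDF.measure

theorem tendsto_gumbelCDF_atBot : Tendsto gumbelCDF atBot (𝓝 0) :=
  Real.tendsto_exp_neg_atTop_nhds_zero.comp
    (Real.tendsto_exp_atTop.comp tendsto_neg_atBot_atTop)

theorem tendsto_gumbelCDF_atTop : Tendsto gumbelCDF atTop (𝓝 1) := by
  have h := (Real.continuous_exp.tendsto (-0)).comp Real.tendsto_exp_neg_atTop_nhds_zero.neg
  rw [neg_zero, Real.exp_zero] at h
  exact h

instance : IsProbabilityMeasure gumbelMeasure :=
  gumbelCDF.isProbabilityMeasure tendsto_gumbelCDF_atBot tendsto_gumbelCDF_atTop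

theorem gumbelMeasure_Iic (t : ℝ) :
    gumbelMeasure (Set.Iic t) = ENNReal.ofReal (Real.exp (-Real.exp (-t))) := by
  have h := gumbelCDF.measure_Iic tendsto_gumbelCDF_atBot t
  rw [sub_zero] at h
  exact h

end LogGas

end

open ProbabilityTheory InformationTheory
open scoped NNReal

/-! ### Size estimates for the kernel, uniform over measures with bounded Gaussian density. -/

noncomputable section

namespace LogGas

/-! ### The logarithmic kernel -/

/-! The proof has two halves: a variational one, which produces `μ` and `L`, and a probabilistic
one, in which one particle is compared with all the others.

Variational half. The logarithmic kernel is conditionally positive definite: up to constants it is a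
superposition of the kernels `cos ((x - z) y)`. Hence the weighted energy is convex
(`two_mul_mixedEnergy_le`), while the entropy is strongly convex in Hellinger distance
(`klFun_midpoint`). Square roots of minimizing densities are therefore Cauchy in L², and Fatou gives
a minimizer. Moving it towards the tilt of the reference measure by its own potential shows that it
equals this tilt (`exists_eq_tilted`), which is the self-consistent equation. Conversely, the free
energy at `m` exceeds its value at such a fixed point by the relative entropy of `m` to it plus a
nonnegative energy, so the fixed point is the unique minimizer.

Probabilistic half. The self-consistent equation turns the ensemble into a perturbation of `μ^⊗N`.
Positive definiteness bounds the pair energy below (`exists_pairSum_ge`), Jensen bounds the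
partition function below, and the entropy inequality then controls linear statistics
(`exists_linear_statistic_le`); all errors are of order `β log N`, hence vanish. Consequently the
law of N+1 particles is close in L¹ to `μ` times the law of N particles (`tendsto_partitionRatio`).
Far out, a particle at `v` feels the others only through the factor `v^{βN}`, uniformly in `v`
(`eventually_integral_abs_exp_tailExponent_le`).

Put `G(θ) = E ∏ (1 - θ 1_{x_j > t})`. Differentiating in `θ` singles out one particle beyond `t`, so
`G' ≈ -a G`, with `a` the approximate expected number of exceedances. Thus the probability `G(1)` of
no exceedance is close to `e^{-a}` (`abs_exceedGen_one_sub_le`). At the level where the rescaled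
maximum equals `s`, Laplace asymptotics give `a → e^{-s}`. -/

theorem logKernel_eq (x z : ℝ) : logKernel x z = -Real.log |x - z| := by
  rw [logKernel, Real.log_inv]

theorem logKernel_comm (x z : ℝ) : logKernel x z = logKernel z x := by
  rw [logKernel_eq, logKernel_eq, abs_sub_comm]

theorem logKernel_self (x : ℝ) : logKernel x x = 0 := by simp [logKernel]

@[fun_prop]
theorem measurable_logKernel : Measurable (fun q : ℝ × ℝ => logKernel q.1 q.2) := by
  unfold logKernel
  exact Real.measurable_log.comp ((measurable_fst.sub measurable_snd).abs.inv)

@[fun_prop]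
theorem Measurable.logKernel {α : Type*} [MeasurableSpace α] {f g : α → ℝ} (hf : Measurable f)
    (hg : Measurable g) : Measurable (fun a => logKernel (f a) (g a)) :=
  measurable_logKernel.comp (hf.prodMk hg)

@[fun_prop]
theorem measurable_theta : Measurable theta := by
  unfold theta
  exact Real.measurable_log.comp (measurable_const.add measurable_id.abs)

theorem theta_nonneg (x : ℝ) : 0 ≤ theta x :=
  Real.log_nonneg (by linarith [abs_nonneg x])

theorem theta_le_abs (x : ℝ) : theta x ≤ |x| := by
  have := Real.log_le_sub_one_of_pos (show 0 < 1 + |x| by positivity)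
  unfold theta; linarith

theorem exp_theta (x : ℝ) : Real.exp (theta x) = 1 + |x| :=
  Real.exp_log (by positivity)

theorem log_abs_sub_le (x z : ℝ) : Real.log |x - z| ≤ theta x + theta z := by
  rcases eq_or_ne x z with rfl | h
  · simpa using add_nonneg (theta_nonneg x) (theta_nonneg x)
  · rw [theta, theta, ← Real.log_mul (by positivity) (by positivity)]
    apply Real.log_le_log (abs_pos.2 (sub_ne_zero.2 h))
    have := abs_sub x z
    nlinarith [abs_nonneg x, abs_nonneg z]

theorem neg_logKernel_le (x z : ℝ) : -logKernel x z ≤ theta x + theta z := by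
  rw [logKernel_eq, neg_neg]; exact log_abs_sub_le x z

/-- This is `log u ≤ u - 1` at `u = r^{-1/2}`. The inverse square root replaces the logarithmic
singularity throughout because it is still locally integrable. At `r = 0` both sides are zero by
convention. -/
theorem neg_log_le_inv_sqrt {r : ℝ} (hr : 0 ≤ r) : -Real.log r ≤ 2 * (√r)⁻¹ := by
  rcases hr.eq_or_lt with rfl | h
  · simp
  · have := Real.log_le_sub_one_of_pos (show 0 < (√r)⁻¹ by positivity)
    rw [Real.log_inv, Real.log_sqrt hr] at this
    linarith

theorem logKernel_le (x z : ℝ) : logKernel x z ≤ 2 * (√|x - z|)⁻¹ := by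
  rw [logKernel_eq]; exact neg_log_le_inv_sqrt (abs_nonneg _)

theorem abs_logKernel_le (x z : ℝ) :
    |logKernel x z| ≤ 2 * (√|x - z|)⁻¹ + (theta x + theta z) := by
  have h1 := neg_logKernel_le x z
  have h2 := logKernel_le x z
  have h3 : 0 ≤ (√|x - z|)⁻¹ := by positivity
  have h4 := theta_nonneg x
  have h5 := theta_nonneg z
  rw [abs_le]; constructor <;> linarith

/-! ### Integrals of the inverse square root against bounded densities -/

/-- Within distance 1 of `x` the measure is replaced by Lebesgue measure, where translation
invariance removes the dependence on `x`; farther away the integrand is at most 1. The uniformity in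
`x` is the point. -/
theorem integrable_inv_sqrt_abs_sub {m : Measure ℝ} [IsFiniteMeasure m] (hm : m ≤ volume) (x : ℝ) :
    Integrable (fun z => (√|x - z|)⁻¹) m ∧
      ∫ z, (√|x - z|)⁻¹ ∂m ≤ (∫ z in Set.Ioo (-1 : ℝ) 1, (√|z|)⁻¹) + m.real Set.univ := by
  have hI : IntegrableOn (fun z : ℝ => (√|z|)⁻¹) (Set.Ioo (-1) 1) volume := by
    have h1 : IntegrableOn (fun z : ℝ => (√|z|)⁻¹) (Set.Ioo 0 1) volume := by
      have := (intervalIntegral.integrableOn_Ioo_rpow_iff (s := -(1/2)) (zero_lt_one)).2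
        (by norm_num)
      refine this.congr_fun (fun z hz => ?_) measurableSet_Ioo
      simp only
      rw [abs_of_pos hz.1, Real.rpow_neg hz.1.le, Real.sqrt_eq_rpow]
    have h2 : IntegrableOn (fun z : ℝ => (√|z|)⁻¹) (Set.Ioo (-1) 0) volume := by
      have := (Measure.measurePreserving_neg (volume : Measure ℝ)).integrableOn_comp_preimage
        (Homeomorph.neg ℝ).measurableEmbedding (f := fun z : ℝ => (√|z|)⁻¹) (s := Set.Ioo 0 1)
      have h3 := this.2 h1
      simpa [Function.comp_def] using h3
    have h3 : Set.Ioo (-1 : ℝ) 1 ⊆ Set.Ioo (-1) 0 ∪ ({0} ∪ Set.Ioo 0 1) := by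
      intro z hz
      rcases lt_trichotomy z 0 with h | h | h
      · exact Or.inl ⟨hz.1, h⟩
      · exact Or.inr (Or.inl h)
      · exact Or.inr (Or.inr ⟨h, hz.2⟩)
    refine IntegrableOn.mono_set ?_ h3
    refine h2.union (IntegrableOn.union ?_ h1)
    simp
  set F : ℝ → ℝ := fun z => (Set.Ioo (-1 : ℝ) 1).indicator (fun z => (√|z|)⁻¹) z with hF
  have hFi : Integrable F volume := (integrable_indicator_iff measurableSet_Ioo).2 hI
  have hFx : Integrable (fun z => F (x - z)) volume := hFi.comp_sub_left x
  have hFm : Integrable (fun z => F (x - z)) m := hFx.mono_measure hm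
  have hF0 : ∀ z, 0 ≤ F z := fun z => Set.indicator_nonneg (fun _ _ => by positivity) _
  have hle : ∀ z, (√|x - z|)⁻¹ ≤ F (x - z) + 1 := by
    intro z
    by_cases h : x - z ∈ Set.Ioo (-1 : ℝ) 1
    · simp [hF, Set.indicator_of_mem h]
    · have h1 : 1 ≤ √|x - z| := by
        rw [Real.one_le_sqrt]
        by_contra! h2
        exact h ⟨(abs_lt.1 h2).1, (abs_lt.1 h2).2⟩
      have := inv_le_one_of_one_le₀ h1
      linarith [hF0 (x - z)]
  have hb : Integrable (fun z => F (x - z) + 1) m := hFm.add (integrable_const _)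
  have hint : Integrable (fun z => (√|x - z|)⁻¹) m := by
    refine hb.mono' (by fun_prop) (Eventually.of_forall fun z => ?_)
    rw [Real.norm_of_nonneg (by positivity)]
    exact hle z
  refine ⟨hint, (integral_mono hint hb hle).trans ?_⟩
  rw [integral_add hFm (integrable_const _)]
  simp only [integral_const, smul_eq_mul, mul_one, add_le_add_iff_right]
  calc ∫ z, F (x - z) ∂m ≤ ∫ z, F (x - z) :=
        integral_mono_measure hm (Eventually.of_forall fun z => hF0 _) hFx
    _ = ∫ z, F z := integral_sub_left_eq_self F volume x
    _ = _ := integral_indicator measurableSet_Ioo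

/-! ### Measures dominated by the standard Gaussian -/

/-- The standard Gaussian measure on the line. -/
abbrev stdGauss : Measure ℝ := gaussianReal 0 1

/-- `m` has a bounded density with respect to the standard Gaussian measure. -/
def GaussDominated (m : Measure ℝ) : Prop := ∃ C : ℝ≥0, m ≤ C • stdGauss

theorem gaussianPDFReal_zero_one (x : ℝ) :
    gaussianPDFReal 0 1 x = (√(2 * Real.pi))⁻¹ * Real.exp (-x ^ 2 / 2) := by
  simp [gaussianPDFReal]

theorem stdGauss_eq : stdGauss =
    volume.withDensity (fun x => ENNReal.ofReal ((√(2 * Real.pi))⁻¹ * Real.exp (-x ^ 2 / 2))) := by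
  rw [stdGauss, gaussianReal_of_var_ne_zero _ one_ne_zero]
  congr 1
  ext x
  rw [gaussianPDF, gaussianPDFReal_zero_one]

theorem inv_sqrt_two_pi_le_one : (√(2 * Real.pi))⁻¹ ≤ 1 := by
  apply inv_le_one_of_one_le₀
  rw [Real.one_le_sqrt]
  linarith [Real.pi_gt_three]

theorem stdGauss_le_volume : stdGauss ≤ volume := by
  rw [stdGauss_eq]
  calc _ ≤ volume.withDensity (1 : ℝ → ℝ≥0∞) := by
        refine withDensity_mono (Eventually.of_forall fun x => ?_)
        simp only [Pi.one_apply]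
        rw [← ENNReal.ofReal_one]
        apply ENNReal.ofReal_le_ofReal
        have h1 : Real.exp (-x ^ 2 / 2) ≤ 1 := by
          rw [Real.exp_le_one_iff]; nlinarith [sq_nonneg x]
        exact mul_le_one₀ inv_sqrt_two_pi_le_one (Real.exp_pos _).le h1
    _ = volume := withDensity_one

/-- Since `|x| e^{-x²/2} ≤ 1`, the uniform singular-integral bound tolerates an extra factor `|z|`.
That factor later supplies the decay in the position of a distant particle. -/
theorem stdGauss_withDensity_abs_le_volume :
    stdGauss.withDensity (fun z => ENNReal.ofReal |z|) ≤ volume := by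
  rw [stdGauss_eq, ← withDensity_mul _ (by fun_prop) (by fun_prop)]
  calc _ ≤ volume.withDensity (1 : ℝ → ℝ≥0∞) := by
        refine withDensity_mono (Eventually.of_forall fun x => ?_)
        simp only [Pi.one_apply, Pi.mul_apply]
        rw [← ENNReal.ofReal_one, ← ENNReal.ofReal_mul (by positivity)]
        apply ENNReal.ofReal_le_ofReal
        have h1 : |x| * Real.exp (-x ^ 2 / 2) ≤ 1 := by
          have h2 := Real.add_one_le_exp (x ^ 2 / 2)
          have h3 : |x| ≤ Real.exp (x ^ 2 / 2) := by
            have := sq_abs x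
            nlinarith [sq_nonneg (|x| - 1)]
          have h4 : Real.exp (-x ^ 2 / 2) = (Real.exp (x ^ 2 / 2))⁻¹ := by
            rw [← Real.exp_neg]; ring_nf
          rw [h4]
          exact mul_inv_le_one_of_le₀ h3 (Real.exp_pos _).le
        have h5 : 0 ≤ |x| * Real.exp (-x ^ 2 / 2) := by positivity
        calc (√(2 * Real.pi))⁻¹ * Real.exp (-x ^ 2 / 2) * |x|
            = (√(2 * Real.pi))⁻¹ * (|x| * Real.exp (-x ^ 2 / 2)) := by ring
          _ ≤ 1 := mul_le_one₀ inv_sqrt_two_pi_le_one h5 h1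
    _ = volume := withDensity_one

theorem integrable_exp_mul_abs_stdGauss (b : ℝ) :
    Integrable (fun x => Real.exp (b * |x|)) stdGauss := by
  refine ((integrable_exp_mul_gaussianReal b).add
    (integrable_exp_mul_gaussianReal (-b))).mono' (by fun_prop) (Eventually.of_forall fun x => ?_)
  rw [Real.norm_of_nonneg (Real.exp_pos _).le]
  simp only [Pi.add_apply]
  rcases abs_choice x with h | h
  · rw [h]; linarith [Real.exp_pos (-b * x)]
  · rw [h, mul_neg, ← neg_mul]; linarith [Real.exp_pos (b * x)]

theorem integrable_abs_stdGauss : Integrable (fun x => |x|) stdGauss := by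
  refine (integrable_exp_mul_abs_stdGauss 1).mono' (by fun_prop) (Eventually.of_forall fun x => ?_)
  rw [Real.norm_of_nonneg (abs_nonneg _), one_mul]
  linarith [Real.add_one_le_exp |x|]

theorem exists_integral_inv_sqrt_le : ∃ C : ℝ, ∀ x : ℝ,
    Integrable (fun z => (√|x - z|)⁻¹) stdGauss ∧ ∫ z, (√|x - z|)⁻¹ ∂stdGauss ≤ C :=
  ⟨_, fun x => integrable_inv_sqrt_abs_sub stdGauss_le_volume x⟩

theorem exists_integral_abs_mul_inv_sqrt_le : ∃ C : ℝ, ∀ x : ℝ,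
    Integrable (fun z => |z| * (√|x - z|)⁻¹) stdGauss ∧
      ∫ z, |z| * (√|x - z|)⁻¹ ∂stdGauss ≤ C := by
  have hfin : IsFiniteMeasure (stdGauss.withDensity (fun z => ENNReal.ofReal |z|)) :=
    isFiniteMeasure_withDensity_ofReal integrable_abs_stdGauss.2
  refine ⟨(∫ z in Set.Ioo (-1 : ℝ) 1, (√|z|)⁻¹) +
    (stdGauss.withDensity (fun z => ENNReal.ofReal |z|)).real Set.univ, fun x => ?_⟩
  have h := integrable_inv_sqrt_abs_sub stdGauss_withDensity_abs_le_volume x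
  have h1 : Integrable (fun z => |z| * (√|x - z|)⁻¹) stdGauss := by
    have := (integrable_withDensity_iff_integrable_smul' (by fun_prop)
      (Eventually.of_forall fun z => ENNReal.ofReal_lt_top)).1 h.1
    refine this.congr (Eventually.of_forall fun z => ?_)
    simp [ENNReal.toReal_ofReal (abs_nonneg z)]
  refine ⟨h1, ?_⟩
  have h2 := h.2
  rw [integral_withDensity_eq_integral_toReal_smul (by fun_prop)
    (Eventually.of_forall fun z => ENNReal.ofReal_lt_top)] at h2
  simpa only [ENNReal.toReal_ofReal (abs_nonneg _), smul_eq_mul] using h2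

namespace GaussDominated

variable {m m' : Measure ℝ}

theorem stdGauss : GaussDominated stdGauss := ⟨1, by simp⟩

theorem isFiniteMeasure (h : GaussDominated m) : IsFiniteMeasure m := by
  obtain ⟨C, hC⟩ := h
  exact isFiniteMeasure_of_le _ hC

theorem absolutelyContinuous (h : GaussDominated m) : m ≪ volume := by
  obtain ⟨C, hC⟩ := h
  exact (Measure.absolutelyContinuous_of_le hC).trans
    ((Measure.smul_absolutelyContinuous).trans
      (Measure.absolutelyContinuous_of_le stdGauss_le_volume))

theorem integrable {f : ℝ → ℝ} (h : GaussDominated m) (hf : Integrable f LogGas.stdGauss) :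
    Integrable f m := by
  obtain ⟨C, hC⟩ := h
  exact (hf.smul_measure_nnreal).mono_measure hC

theorem exists_integral_le (h : GaussDominated m) : ∃ C : ℝ, 0 ≤ C ∧ ∀ f : ℝ → ℝ, (∀ x, 0 ≤ f x) →
    Integrable f LogGas.stdGauss → ∫ x, f x ∂m ≤ C * ∫ x, f x ∂LogGas.stdGauss := by
  obtain ⟨C, hC⟩ := h
  refine ⟨C, C.2, fun f hf hfi => ?_⟩
  refine (integral_mono_measure hC (Eventually.of_forall hf) hfi.smul_measure_nnreal).trans ?_
  rw [integral_smul_nnreal_measure]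
  rfl

theorem integrable_prod {F : ℝ × ℝ → ℝ} (h : GaussDominated m) (h' : GaussDominated m')
    (hF : Integrable F (LogGas.stdGauss.prod LogGas.stdGauss)) : Integrable F (m.prod m') := by
  have := h'.isFiniteMeasure
  obtain ⟨C, hC⟩ := h
  obtain ⟨C', hC'⟩ := h'
  have h1 : m.prod m' ≤ (C • LogGas.stdGauss).prod (C' • LogGas.stdGauss) :=
    Measure.prod_mono hC hC'
  refine Integrable.mono_measure ?_ h1
  have : (C • LogGas.stdGauss).prod (C' • LogGas.stdGauss)
      = (C * C') • (LogGas.stdGauss.prod LogGas.stdGauss) := by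
    ext s hs
    simp only [Measure.prod_smul_left, Measure.prod_smul_right, smul_smul, mul_comm]
  rw [this]
  exact hF.smul_measure_nnreal

end GaussDominated

theorem integrable_theta_stdGauss : Integrable theta stdGauss :=
  integrable_abs_stdGauss.mono' (by fun_prop) (Eventually.of_forall fun x => by
    rw [Real.norm_of_nonneg (theta_nonneg x)]; exact theta_le_abs x)

theorem integrable_logKernel_stdGauss (x : ℝ) : Integrable (logKernel x) stdGauss := by
  obtain ⟨C, hC⟩ := exists_integral_inv_sqrt_le
  refine (((hC x).1.const_mul 2).add ((integrable_const (theta x)).add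
    integrable_theta_stdGauss)).mono' (by fun_prop) (Eventually.of_forall fun z => ?_)
  exact abs_logKernel_le x z

theorem integrable_inv_sqrt_prod_stdGauss :
    Integrable (fun q : ℝ × ℝ => (√|q.1 - q.2|)⁻¹) (stdGauss.prod stdGauss) := by
  obtain ⟨C, hC⟩ := exists_integral_inv_sqrt_le
  rw [integrable_prod_iff (by fun_prop)]
  refine ⟨Eventually.of_forall fun x => (hC x).1, ?_⟩
  refine Integrable.mono' (integrable_const C) ?_ (Eventually.of_forall fun x => ?_)
  · have h : AEStronglyMeasurable (fun q : ℝ × ℝ => ‖(√|q.1 - q.2|)⁻¹‖)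
        (stdGauss.prod stdGauss) := by fun_prop
    exact h.integral_prod_right'
  · simp only [Real.norm_eq_abs]
    rw [abs_of_nonneg (integral_nonneg fun z => abs_nonneg _)]
    simp_rw [abs_of_nonneg (inv_nonneg.2 (Real.sqrt_nonneg _))]
    exact (hC x).2

theorem integrable_logKernel_prod_stdGauss :
    Integrable (fun q : ℝ × ℝ => logKernel q.1 q.2) (stdGauss.prod stdGauss) := by
  refine ((integrable_inv_sqrt_prod_stdGauss.const_mul 2).add
    ((integrable_theta_stdGauss.comp_fst _).add
    (integrable_theta_stdGauss.comp_snd _))).mono' (by fun_prop) (Eventually.of_forall fun q => ?_)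
  exact abs_logKernel_le q.1 q.2

end LogGas

end

/-! ### From characteristic functions to convexity of the logarithmic energy. -/

noncomputable section

namespace LogGas

/-! ### Positive definiteness of the logarithmic kernel -/

/-- The quadratic form `∬ k(x - z) (m - m')(dx) (m - m')(dz)`. -/
def differenceForm (m m' : Measure ℝ) (k : ℝ → ℝ) : ℝ :=
  ∫ q, k (q.1 - q.2) ∂(m.prod m) + ∫ q, k (q.1 - q.2) ∂(m'.prod m')
    - 2 * ∫ q, k (q.1 - q.2) ∂(m.prod m')

theorem differenceForm_congr {m m' : Measure ℝ} {k k' : ℝ → ℝ} (h : ∀ r, k r = k' r) :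
    differenceForm m m' k = differenceForm m m' k' := by
  rw [funext h]

section

variable {m m' : Measure ℝ} [IsProbabilityMeasure m] [IsProbabilityMeasure m']

theorem integral_cos_prod (m m' : Measure ℝ) [IsProbabilityMeasure m] [IsProbabilityMeasure m']
    (y : ℝ) :
    ∫ q, Real.cos ((q.1 - q.2) * y) ∂(m.prod m')
      = (∫ x, Real.cos (x * y) ∂m) * (∫ x, Real.cos (x * y) ∂m')
        + (∫ x, Real.sin (x * y) ∂m) * ∫ x, Real.sin (x * y) ∂m' := by
  have hc : ∀ (n : Measure ℝ) [IsProbabilityMeasure n], Integrable (fun x => Real.cos (x * y)) n :=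
    fun n _ => Integrable.of_bound (by fun_prop) 1
      (Eventually.of_forall fun x => Real.abs_cos_le_one _)
  have hs : ∀ (n : Measure ℝ) [IsProbabilityMeasure n], Integrable (fun x => Real.sin (x * y)) n :=
    fun n _ => Integrable.of_bound (by fun_prop) 1
      (Eventually.of_forall fun x => Real.abs_sin_le_one _)
  rw [← integral_prod_mul, ← integral_prod_mul, ← integral_add ((hc m).mul_prod (hc m'))
    ((hs m).mul_prod (hs m'))]
  congr 1 with q
  rw [sub_mul, Real.cos_sub]

/-- The form is the squared modulus of the difference of the two characteristic functions at `y`. -/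
theorem differenceForm_cos_nonneg (y : ℝ) :
    0 ≤ differenceForm m m' (fun r => Real.cos (r * y)) := by
  simp only [differenceForm, integral_cos_prod]
  nlinarith [sq_nonneg ((∫ x, Real.cos (x * y) ∂m) - ∫ x, Real.cos (x * y) ∂m'),
    sq_nonneg ((∫ x, Real.sin (x * y) ∂m) - ∫ x, Real.sin (x * y) ∂m')]

/-- By Fubini, mixtures of kernels inherit nonnegativity. It is used twice: from cosines to Cauchy
kernels, and from Cauchy kernels to logarithms. -/
theorem differenceForm_integral_nonneg {Ω : Type*} [MeasurableSpace Ω] {ρ : Measure Ω}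
    [IsFiniteMeasure ρ] {φ : Ω → ℝ → ℝ} (hφ : Measurable (Function.uncurry φ)) {B : ℝ}
    (hB : ∀ᵐ ω ∂ρ, ∀ r, |φ ω r| ≤ B) (h0 : ∀ᵐ ω ∂ρ, 0 ≤ differenceForm m m' (φ ω)) :
    0 ≤ differenceForm m m' (fun r => ∫ ω, φ ω r ∂ρ) := by
  have key : ∀ (n n' : Measure ℝ) [IsProbabilityMeasure n] [IsProbabilityMeasure n'],
      Integrable (fun ω => ∫ q : ℝ × ℝ, φ ω (q.1 - q.2) ∂(n.prod n')) ρ ∧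
      ∫ q : ℝ × ℝ, ∫ ω, φ ω (q.1 - q.2) ∂ρ ∂(n.prod n')
        = ∫ ω, ∫ q : ℝ × ℝ, φ ω (q.1 - q.2) ∂(n.prod n') ∂ρ := by
    intro n n' _ _
    have hi : Integrable (Function.uncurry fun (q : ℝ × ℝ) ω => φ ω (q.1 - q.2))
        ((n.prod n').prod ρ) := by
      refine Integrable.of_bound (C := B) ?_ ?_
      · refine Measurable.aestronglyMeasurable ?_
        exact hφ.comp (f := fun p : (ℝ × ℝ) × Ω => (p.2, p.1.1 - p.1.2)) (by fun_prop)
      · have := Measure.quasiMeasurePreserving_snd (μ := n.prod n') (ν := ρ) |>.ae hB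
        filter_upwards [this] with p hp using hp _
    exact ⟨hi.integral_prod_right, integral_integral_swap hi⟩
  have k1 := key m m
  have k2 := key m' m'
  have k3 := key m m'
  unfold differenceForm
  have k12 : Integrable (fun ω => ∫ q : ℝ × ℝ, φ ω (q.1 - q.2) ∂(m.prod m)
      + ∫ q : ℝ × ℝ, φ ω (q.1 - q.2) ∂(m'.prod m')) ρ := k1.1.add k2.1
  rw [k1.2, k2.2, k3.2, ← integral_const_mul, ← integral_add k1.1 k2.1,
    ← integral_sub k12 (k3.1.const_mul 2)]
  refine integral_nonneg_of_ae ?_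
  filter_upwards [h0] with ω hω using hω

theorem integral_exp_neg_mul_cos {a : ℝ} (ha : 0 < a) (r : ℝ) :
    ∫ y in Set.Ioi (0 : ℝ), Real.exp (-a * y) * Real.cos (r * y) = a / (a ^ 2 + r ^ 2) := by
  have h1 : ((-a : ℝ) + r * Complex.I : ℂ).re < 0 := by simp [ha]
  have h := integral_exp_mul_complex_Ioi h1 0
  have hi : IntegrableOn (fun y : ℝ => Complex.exp (((-a : ℝ) + r * Complex.I : ℂ) * y))
      (Set.Ioi 0) := integrableOn_exp_mul_complex_Ioi h1 0
  have h2 := congrArg Complex.re h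
  rw [← RCLike.re_eq_complex_re, ← integral_re hi] at h2
  have h3 : ∀ y : ℝ, RCLike.re (Complex.exp (((-a : ℝ) + r * Complex.I : ℂ) * y))
      = Real.exp (-a * y) * Real.cos (r * y) := by
    intro y
    rw [RCLike.re_eq_complex_re, Complex.exp_re]
    simp
  simp_rw [h3] at h2
  rw [h2, RCLike.re_eq_complex_re]
  simp [Complex.div_re, Complex.normSq_apply]
  field_simp

/-- The Cauchy kernel is the mixture of the cosines `cos (r y)` with weight `e^{-a y}` on the
half-line. -/
theorem differenceForm_cauchy_nonneg {a : ℝ} (ha : 0 < a) :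
    0 ≤ differenceForm m m' (fun r => a / (a ^ 2 + r ^ 2)) := by
  have hi : IntegrableOn (fun y : ℝ => Real.exp (-a * y)) (Set.Ioi 0) :=
    integrableOn_exp_mul_Ioi (by linarith) 0
  have hfin : IsFiniteMeasure ((volume.restrict (Set.Ioi (0 : ℝ))).withDensity
      fun y => ENNReal.ofReal (Real.exp (-a * y))) := isFiniteMeasure_withDensity_ofReal hi.2
  have h := differenceForm_integral_nonneg (m := m) (m' := m')
    (ρ := (volume.restrict (Set.Ioi (0 : ℝ))).withDensity
      fun y => ENNReal.ofReal (Real.exp (-a * y)))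
    (φ := fun y r => Real.cos (r * y)) (B := 1) (by unfold Function.uncurry; fun_prop)
    (Eventually.of_forall fun y r => Real.abs_cos_le_one _)
    (Eventually.of_forall fun y => differenceForm_cos_nonneg y)
  refine h.trans_eq (differenceForm_congr fun r => ?_)
  rw [integral_withDensity_eq_integral_toReal_smul (by fun_prop)
    (Eventually.of_forall fun z => ENNReal.ofReal_lt_top), ← integral_exp_neg_mul_cos ha]
  simp only [ENNReal.toReal_ofReal (Real.exp_pos _).le, smul_eq_mul]

theorem integral_cauchy {η A : ℝ} (hη : 0 < η) (hA : η ≤ A) (r : ℝ) :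
    ∫ a in Set.Ioc η A, a / (a ^ 2 + r ^ 2)
      = 1 / 2 * Real.log (A ^ 2 + r ^ 2) - 1 / 2 * Real.log (η ^ 2 + r ^ 2) := by
  rw [← intervalIntegral.integral_of_le hA]
  have hpos : ∀ a ∈ Set.uIcc η A, 0 < a ^ 2 + r ^ 2 := by
    intro a ha
    rw [Set.uIcc_of_le hA] at ha
    have : 0 < a := hη.trans_le ha.1
    positivity
  refine intervalIntegral.integral_eq_sub_of_hasDerivAt
    (f := fun a => 1 / 2 * Real.log (a ^ 2 + r ^ 2)) (fun a ha => ?_) ?_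
  · have h1 : HasDerivAt (fun a : ℝ => a ^ 2 + r ^ 2) (2 * a) a := by
      simpa using (hasDerivAt_pow 2 a).add_const (r ^ 2)
    convert! (h1.log (hpos a ha).ne').const_mul (1 / 2) using 1
    field_simp
  · refine ContinuousOn.intervalIntegrable (ContinuousOn.div (by fun_prop) (by fun_prop) ?_)
    intro a ha
    exact (hpos a ha).ne'

/-- Cauchy kernels integrated over the scale `a` from `η` to `A` give this difference of logarithms.
The cutoff `A` is removed later. -/
theorem differenceForm_log_nonneg {η A : ℝ} (hη : 0 < η) (hA : η ≤ A) :
    0 ≤ differenceForm m m' (fun r =>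
      1 / 2 * Real.log (A ^ 2 + r ^ 2) - 1 / 2 * Real.log (η ^ 2 + r ^ 2)) := by
  have h := differenceForm_integral_nonneg (m := m) (m' := m')
    (ρ := volume.restrict (Set.Ioc η A)) (φ := fun a r => a / (a ^ 2 + r ^ 2)) (B := A / η ^ 2)
    (by unfold Function.uncurry; fun_prop) ?_ ?_
  · exact h.trans_eq (differenceForm_congr fun r => integral_cauchy hη hA r)
  · filter_upwards [ae_restrict_mem measurableSet_Ioc] with a ha r
    have ha0 : 0 < a := hη.trans ha.1
    rw [abs_of_nonneg (by positivity)]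
    have : η ^ 2 ≤ a ^ 2 + r ^ 2 := by nlinarith [sq_nonneg r, ha.1]
    exact div_le_div₀ (by linarith) ha.2 (by positivity) this
  · filter_upwards [ae_restrict_mem measurableSet_Ioc] with a ha
    exact differenceForm_cauchy_nonneg (hη.trans ha.1)

end

/-- The regularized logarithmic kernel `-½ log ((x - z)² + η²)`. -/
def regKernel (η x z : ℝ) : ℝ := -(1 / 2) * Real.log (η ^ 2 + (x - z) ^ 2)

@[fun_prop]
theorem measurable_regKernel (η : ℝ) : Measurable (fun q : ℝ × ℝ => regKernel η q.1 q.2) := by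
  unfold regKernel
  fun_prop

theorem one_add_sq_sub_le (x z : ℝ) :
    1 + (x - z) ^ 2 ≤ Real.exp (2 * (theta x + theta z)) := by
  rw [mul_comm, Real.exp_mul, Real.exp_add, exp_theta, exp_theta, Real.rpow_two]
  have h1 := abs_sub x z
  have h2 := sq_abs (x - z)
  nlinarith [abs_nonneg x, abs_nonneg z, abs_nonneg (x - z),
    mul_nonneg (abs_nonneg x) (abs_nonneg z), sq_nonneg (|x| * |z|),
    mul_nonneg (abs_nonneg x) (mul_nonneg (abs_nonneg x) (abs_nonneg z))]

theorem neg_regKernel_le {η : ℝ} (hη : 0 < η) (hη1 : η ≤ 1) (x z : ℝ) :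
    -regKernel η x z ≤ theta x + theta z := by
  have h := one_add_sq_sub_le x z
  have h1 : η ^ 2 + (x - z) ^ 2 ≤ Real.exp (2 * (theta x + theta z)) := by
    nlinarith
  have := Real.log_le_log (by positivity) h1
  rw [Real.log_exp] at this
  unfold regKernel
  linarith

theorem regKernel_le {η : ℝ} (hη : 0 < η) (x z : ℝ) : regKernel η x z ≤ -Real.log η := by
  have h := Real.log_le_log (by positivity) (show η ^ 2 ≤ η ^ 2 + (x - z) ^ 2 by nlinarith [sq_nonneg (x - z)])
  rw [Real.log_pow] at h
  unfold regKernel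
  push_cast at h
  linarith

theorem regKernel_self {η : ℝ} (x : ℝ) : regKernel η x x = -Real.log η := by
  simp [regKernel]

theorem regKernel_le_logKernel {η : ℝ} {x z : ℝ} (h : x ≠ z) :
    regKernel η x z ≤ logKernel x z := by
  have h0 : 0 < |x - z| := abs_pos.2 (sub_ne_zero.2 h)
  have h1 := Real.log_le_log (by positivity) (show |x - z| ^ 2 ≤ η ^ 2 + (x - z) ^ 2 by
    rw [sq_abs]; nlinarith [sq_nonneg η])
  rw [Real.log_pow] at h1
  rw [logKernel_eq, regKernel]
  push_cast at h1
  linarith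

/-- With `w = √(η/r)` the difference is `½ log (1 + w⁴)`, at most `2w` because `1 + w⁴ ≤ (1 + w)⁴ ≤
e^{4w}`. The gain is a power of `η` in front of an integrable singularity. On the diagonal, where
`logKernel` is 0, the left side is `log η ≤ 0`. -/
theorem logKernel_sub_regKernel_le {η : ℝ} (hη : 0 < η) (hη1 : η ≤ 1) (x z : ℝ) :
    logKernel x z - regKernel η x z ≤ 2 * √η * (√|x - z|)⁻¹ := by
  rcases eq_or_ne x z with rfl | h
  · rw [logKernel_self, regKernel_self]
    have := Real.log_nonpos hη.le hη1
    simp [this]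
  · have h0 : 0 < |x - z| := abs_pos.2 (sub_ne_zero.2 h)
    set r := |x - z| with hr
    set w := √η * (√r)⁻¹ with hw
    have hw0 : 0 < w := by positivity
    have hw2 : w ^ 2 = η / r := by
      rw [hw, mul_pow, inv_pow, Real.sq_sqrt hη.le, Real.sq_sqrt h0.le, div_eq_mul_inv]
    have hsq : (x - z) ^ 2 = r ^ 2 := by rw [hr, sq_abs]
    have h1 : η ^ 2 + r ^ 2 = r ^ 2 * (1 + (w ^ 2) ^ 2) := by
      rw [hw2]; field_simp
      ring
    have h2 : Real.log (1 + (w ^ 2) ^ 2) ≤ 4 * w := by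
      have h3 : 1 + (w ^ 2) ^ 2 ≤ Real.exp (4 * w) := by
        have h4 := Real.add_one_le_exp w
        have h5 : Real.exp (4 * w) = Real.exp w ^ 4 := by
          rw [← Real.exp_nat_mul]; norm_num
        rw [h5]
        have h6 : (w + 1) ^ 4 ≤ Real.exp w ^ 4 := by gcongr
        nlinarith [pow_pos hw0 2, pow_pos hw0 3]
      have := Real.log_le_log (by positivity) h3
      rwa [Real.log_exp] at this
    rw [logKernel_eq, regKernel, hsq, h1, Real.log_mul (by positivity) (by positivity),
      Real.log_pow, ← hr, mul_assoc, ← hw]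
    push_cast
    linarith

section

variable {m m' : Measure ℝ} [IsProbabilityMeasure m] [IsProbabilityMeasure m']

theorem integrable_theta_add_theta (hm : Integrable theta m) (hm' : Integrable theta m') :
    Integrable (fun q : ℝ × ℝ => theta q.1 + theta q.2) (m.prod m') :=
  (hm.comp_fst m').add (hm'.comp_snd m)

theorem integrable_regKernel (hm : Integrable theta m) (hm' : Integrable theta m') {η : ℝ}
    (hη : 0 < η) (hη1 : η ≤ 1) :
    Integrable (fun q : ℝ × ℝ => regKernel η q.1 q.2) (m.prod m') := by
  refine ((integrable_theta_add_theta hm hm').add (integrable_const (-Real.log η))).mono'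
    (by fun_prop) (Eventually.of_forall fun q => ?_)
  have h1 := neg_regKernel_le hη hη1 q.1 q.2
  have h2 := regKernel_le hη q.1 q.2
  have h3 := Real.log_nonpos hη.le hη1
  have h4 := theta_nonneg q.1
  have h5 := theta_nonneg q.2
  simp only [Real.norm_eq_abs, Pi.add_apply, abs_le]
  constructor <;> linarith

theorem regKernel_form_nonneg (hm : Integrable theta m) (hm' : Integrable theta m') {η : ℝ}
    (hη : 0 < η) (hη1 : η ≤ 1) :
    2 * ∫ q, regKernel η q.1 q.2 ∂(m.prod m') ≤
      ∫ q, regKernel η q.1 q.2 ∂(m.prod m) + ∫ q, regKernel η q.1 q.2 ∂(m'.prod m') := by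
  -- The cutoff is `A = n + 1`. Subtracting `log A` makes the kernels converge, dominated, to
  -- `regKernel η`; it does not change the quadratic form, since both measures have mass one.
  let f : ℕ → ℝ × ℝ → ℝ := fun n q =>
    (1 / 2 * Real.log (((n : ℝ) + 1) ^ 2 + (q.1 - q.2) ^ 2)
      - 1 / 2 * Real.log (η ^ 2 + (q.1 - q.2) ^ 2)) - Real.log ((n : ℝ) + 1)
  have hf : ∀ n q, f n q = regKernel η q.1 q.2
      + 1 / 2 * Real.log (1 + (q.1 - q.2) ^ 2 / ((n : ℝ) + 1) ^ 2) := by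
    intro n q
    have h1 : ((n : ℝ) + 1) ^ 2 + (q.1 - q.2) ^ 2
        = ((n : ℝ) + 1) ^ 2 * (1 + (q.1 - q.2) ^ 2 / ((n : ℝ) + 1) ^ 2) := by
      field_simp
    simp only [f, regKernel]
    rw [h1, Real.log_mul (by positivity) (by positivity), Real.log_pow]
    push_cast
    ring
  have hfb : ∀ (n : ℕ) (q : ℝ × ℝ), |1 / 2 * Real.log (1 + (q.1 - q.2) ^ 2 / ((n : ℝ) + 1) ^ 2)| ≤
      theta q.1 + theta q.2 := by
    intro n q
    have h1 : (1 : ℝ) ≤ 1 + (q.1 - q.2) ^ 2 / ((n : ℝ) + 1) ^ 2 := by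
      have : 0 ≤ (q.1 - q.2) ^ 2 / ((n : ℝ) + 1) ^ 2 := by positivity
      linarith
    have h2 : 1 + (q.1 - q.2) ^ 2 / ((n : ℝ) + 1) ^ 2 ≤ Real.exp (2 * (theta q.1 + theta q.2)) := by
      refine le_trans ?_ (one_add_sq_sub_le q.1 q.2)
      have : (q.1 - q.2) ^ 2 / ((n : ℝ) + 1) ^ 2 ≤ (q.1 - q.2) ^ 2 := by
        apply div_le_self (sq_nonneg _)
        have : (0 : ℝ) ≤ n := by positivity
        nlinarith
      linarith
    have h3 := Real.log_le_log (by linarith) h2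
    rw [Real.log_exp] at h3
    rw [abs_of_nonneg (mul_nonneg (by norm_num) (Real.log_nonneg h1))]
    linarith
  have key : ∀ (n n' : Measure ℝ) [IsProbabilityMeasure n] [IsProbabilityMeasure n'],
      Integrable theta n → Integrable theta n' →
      Tendsto (fun i => ∫ q, f i q ∂(n.prod n')) atTop
        (𝓝 (∫ q, regKernel η q.1 q.2 ∂(n.prod n'))) := by
    intro n n' _ _ hn hn'
    refine tendsto_integral_of_dominated_convergence
      (fun q => |regKernel η q.1 q.2| + (theta q.1 + theta q.2)) (fun i => ?_) ?_ (fun i => ?_) ?_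
    · refine Measurable.aestronglyMeasurable ?_
      simp only [f]
      fun_prop
    · exact (integrable_regKernel hn hn' hη hη1).abs.add (integrable_theta_add_theta hn hn')
    · refine Eventually.of_forall fun q => ?_
      rw [hf, Real.norm_eq_abs]
      exact (abs_add_le _ _).trans (by linarith [hfb i q])
    · refine Eventually.of_forall fun q => ?_
      simp_rw [hf]
      have h1 : Tendsto (fun n : ℕ => (q.1 - q.2) ^ 2 / ((n : ℝ) + 1) ^ 2) atTop (𝓝 0) := by
        refine Tendsto.div_atTop tendsto_const_nhds ?_
        exact (tendsto_pow_atTop two_ne_zero).comp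
          (tendsto_atTop_add_const_right _ _ tendsto_natCast_atTop_atTop)
      have h2 := (((h1.const_add 1).log (by norm_num)).const_mul (1 / 2)).const_add
        (regKernel η q.1 q.2)
      simpa using h2
  have hint : ∀ (i : ℕ) (n n' : Measure ℝ) [IsProbabilityMeasure n] [IsProbabilityMeasure n'],
      Integrable theta n → Integrable theta n' → Integrable (fun q : ℝ × ℝ =>
      (1 / 2 * Real.log (((i : ℝ) + 1) ^ 2 + (q.1 - q.2) ^ 2)
      - 1 / 2 * Real.log (η ^ 2 + (q.1 - q.2) ^ 2))) (n.prod n') := by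
    intro i n n' _ _ hn hn'
    have h1 : Integrable (f i) (n.prod n') := by
      refine ((integrable_regKernel hn hn' hη hη1).abs.add
        (integrable_theta_add_theta hn hn')).mono' (Measurable.aestronglyMeasurable ?_)
        (Eventually.of_forall fun q => ?_)
      · simp only [f]
        fun_prop
      · rw [hf, Real.norm_eq_abs]
        exact (abs_add_le _ _).trans (by simpa using hfb i q)
    refine (h1.add (integrable_const (Real.log ((i : ℝ) + 1)))).congr
      (Eventually.of_forall fun q => ?_)
    simp [f]
  refine le_of_tendsto_of_tendsto' ((key m m' hm hm').const_mul 2)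
    ((key m m hm hm).add (key m' m' hm' hm')) fun i => ?_
  have hpos := differenceForm_log_nonneg (m := m) (m' := m') hη
    (show η ≤ (i : ℝ) + 1 by have : (0 : ℝ) ≤ i := by positivity
                             linarith)
  unfold differenceForm at hpos
  simp only [f]
  rw [integral_sub (hint i m m' hm hm') (integrable_const _),
    integral_sub (hint i m m hm hm) (integrable_const _),
    integral_sub (hint i m' m' hm' hm') (integrable_const _)]
  simp only [integral_const, probReal_univ, smul_eq_mul, one_mul]
  linarith

/-! ### Convexity of the weighted energy -/

@[fun_prop]
theorem measurable_weightedKernel : Measurable (fun q : ℝ × ℝ => weightedKernel q.1 q.2) := by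
  unfold weightedKernel
  refine Measurable.ite (measurableSet_eq_fun measurable_fst measurable_snd) (by fun_prop) ?_
  fun_prop

theorem weightedKernel_comm (x z : ℝ) : weightedKernel x z = weightedKernel z x := by
  unfold weightedKernel
  rw [logKernel_comm, add_right_comm]
  simp only [eq_comm]

theorem regKernel_le_weightedKernel (η x z : ℝ) :
    ENNReal.ofReal (regKernel η x z + theta x + theta z) ≤ weightedKernel x z := by
  unfold weightedKernel
  split_ifs with h
  · exact le_top
  · apply ENNReal.ofReal_le_ofReal
    linarith [regKernel_le_logKernel (η := η) h]

theorem tendsto_regKernel (x z : ℝ) :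
    Tendsto (fun n : ℕ => ENNReal.ofReal (regKernel (1 / ((n : ℝ) + 1)) x z + theta x + theta z))
      atTop (𝓝 (weightedKernel x z)) := by
  have h0 : Tendsto (fun n : ℕ => 1 / ((n : ℝ) + 1)) atTop (𝓝 0) :=
    tendsto_one_div_add_atTop_nhds_zero_nat
  unfold weightedKernel
  split_ifs with h
  · subst h
    refine ENNReal.tendsto_ofReal_atTop.comp ?_
    simp_rw [regKernel_self]
    refine tendsto_atTop_add_const_right _ _ (tendsto_atTop_add_const_right _ _ ?_)
    simp only [one_div, Real.log_inv, neg_neg]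
    exact Real.tendsto_log_atTop.comp
      (tendsto_atTop_add_const_right _ _ tendsto_natCast_atTop_atTop)
  · have h1 : 0 < (x - z) ^ 2 := by
      have := sub_ne_zero.2 h
      positivity
    refine ENNReal.tendsto_ofReal ?_
    refine Tendsto.add_const _ (Tendsto.add_const _ ?_)
    have h2 := (((h0.pow 2).add_const ((x - z) ^ 2)).log (by
      simpa using h1.ne')).const_mul (-(1 / 2))
    have h3 : -(1 / 2) * Real.log (0 ^ 2 + (x - z) ^ 2) = logKernel x z := by
      rw [logKernel_eq, ← sq_abs (x - z), zero_pow two_ne_zero, zero_add, Real.log_pow]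
      push_cast; ring
    rw [h3] at h2
    exact h2

/-- The mixed energy `∬ K(x, z) m'(dz) m(dx)` of the weighted kernel. -/
def mixedEnergy (m m' : Measure ℝ) : ℝ≥0∞ := ∫⁻ q, weightedKernel q.1 q.2 ∂(m.prod m')

theorem mixedEnergy_self (m : Measure ℝ) [SFinite m] : mixedEnergy m m = weightedEnergy m := by
  rw [mixedEnergy, lintegral_prod _ (by fun_prop)]
  rfl

/-- The `theta` terms are linear in each measure and cancel, so this is the positivity of the
regularized form as `η → 0`. Self-energies dominate their regularizations and the mixed one follows
by Fatou, so infinite energies are allowed. -/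
theorem two_mul_mixedEnergy_le (hm : Integrable theta m) (hm' : Integrable theta m') :
    2 * mixedEnergy m m' ≤ weightedEnergy m + weightedEnergy m' := by
  rw [← mixedEnergy_self, ← mixedEnergy_self m']
  have key : ∀ n : ℕ, 2 * ∫⁻ q, ENNReal.ofReal
      (regKernel (1 / ((n : ℝ) + 1)) q.1 q.2 + theta q.1 + theta q.2) ∂(m.prod m') ≤
      mixedEnergy m m + mixedEnergy m' m' := by
    intro n
    have hη : 0 < 1 / ((n : ℝ) + 1) := by positivity
    have hη1 : 1 / ((n : ℝ) + 1) ≤ 1 := by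
      rw [div_le_one (by positivity)]
      have : (0 : ℝ) ≤ n := by positivity
      linarith
    set η := 1 / ((n : ℝ) + 1)
    have hint : ∀ (n n' : Measure ℝ) [IsProbabilityMeasure n] [IsProbabilityMeasure n'],
        Integrable theta n → Integrable theta n' →
        ∫⁻ q, ENNReal.ofReal (regKernel η q.1 q.2 + theta q.1 + theta q.2) ∂(n.prod n')
          = ENNReal.ofReal (∫ q, regKernel η q.1 q.2 ∂(n.prod n') +
            (∫ x, theta x ∂n + ∫ x, theta x ∂n')) ∧
        0 ≤ ∫ q, regKernel η q.1 q.2 ∂(n.prod n') + (∫ x, theta x ∂n + ∫ x, theta x ∂n') := by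
      intro n n' _ _ hn hn'
      have h1 := integrable_regKernel hn hn' hη hη1
      have h2 : ∫ q : ℝ × ℝ, (regKernel η q.1 q.2 + (theta q.1 + theta q.2)) ∂(n.prod n') =
          ∫ q, regKernel η q.1 q.2 ∂(n.prod n') + (∫ x, theta x ∂n + ∫ x, theta x ∂n') := by
        rw [integral_add h1 (integrable_theta_add_theta hn hn'),
          integral_add (hn.comp_fst n') (hn'.comp_snd n), integral_fun_fst, integral_fun_snd]
        simp
      have h3 : ∀ q : ℝ × ℝ, 0 ≤ regKernel η q.1 q.2 + (theta q.1 + theta q.2) := fun q => by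
        linarith [neg_regKernel_le hη hη1 q.1 q.2]
      rw [← h2]
      refine ⟨?_, integral_nonneg h3⟩
      simp_rw [add_assoc]
      exact (ofReal_integral_eq_lintegral_ofReal
        (h1.add (integrable_theta_add_theta hn hn')) (Eventually.of_forall h3)).symm
    have hle : ∀ n' : Measure ℝ, ∫⁻ q, ENNReal.ofReal
        (regKernel η q.1 q.2 + theta q.1 + theta q.2) ∂(n'.prod n') ≤ mixedEnergy n' n' :=
      fun n' => lintegral_mono fun q => regKernel_le_weightedKernel η q.1 q.2
    refine le_trans ?_ (add_le_add (hle m) (hle m'))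
    obtain ⟨e1, p1⟩ := hint m m hm hm
    obtain ⟨e2, p2⟩ := hint m' m' hm' hm'
    obtain ⟨e3, p3⟩ := hint m m' hm hm'
    rw [e1, e2, e3, ← ENNReal.ofReal_add p1 p2, ← ENNReal.ofReal_ofNat 2,
      ← ENNReal.ofReal_mul (by norm_num)]
    apply ENNReal.ofReal_le_ofReal
    have := regKernel_form_nonneg hm hm' hη hη1
    linarith
  have hF : mixedEnergy m m' ≤ liminf (fun n : ℕ => ∫⁻ q, ENNReal.ofReal
      (regKernel (1 / ((n : ℝ) + 1)) q.1 q.2 + theta q.1 + theta q.2) ∂(m.prod m')) atTop := by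
    refine le_trans ?_ (lintegral_liminf_le fun n => by fun_prop)
    exact lintegral_mono fun q => (tendsto_regKernel q.1 q.2).liminf_eq.ge
  have h2 : ∀ n : ℕ, ∫⁻ q, ENNReal.ofReal
      (regKernel (1 / ((n : ℝ) + 1)) q.1 q.2 + theta q.1 + theta q.2) ∂(m.prod m') ≤
      (mixedEnergy m m + mixedEnergy m' m') / 2 := fun n => by
    rw [ENNReal.le_div_iff_mul_le (by simp) (by simp), mul_comm]
    exact key n
  have h3 := hF.trans (liminf_le_of_le (by isBoundedDefault) fun b hb => by
    obtain ⟨n, hn⟩ := hb.exists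
    exact hn.trans (h2 n))
  rw [ENNReal.le_div_iff_mul_le (by simp) (by simp), mul_comm] at h3
  exact h3

end

end LogGas

end

/-! ### Existence of a minimizing density by strong convexity. -/

noncomputable section

namespace LogGas

/-! ### Elementary inequalities for the relative entropy integrand -/

/-- Young's inequality for the entropy integrand, whose convex conjugate is `e^b - 1`. -/
theorem mul_le_klFun_add_exp {a : ℝ} (ha : 0 ≤ a) (b : ℝ) : a * b ≤ klFun a + Real.exp b := by
  rcases ha.eq_or_lt with rfl | h
  · rw [klFun_zero]; linarith [Real.exp_pos b]
  · have h1 := Real.add_one_le_exp (b - Real.log a)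
    rw [Real.exp_sub, Real.exp_log h, le_div_iff₀ h] at h1
    rw [klFun_apply]
    nlinarith

theorem two_mul_sub_sqrt_le_log {a m : ℝ} (ha : 0 ≤ a) (hm : 0 < m) :
    2 * (a - √a * √m) ≤ a * (Real.log a - Real.log m) := by
  rcases ha.eq_or_lt with rfl | h
  · simp
  · have hsa : 0 < √a := Real.sqrt_pos.2 h
    have hsm : 0 < √m := Real.sqrt_pos.2 hm
    have h1 := Real.log_le_sub_one_of_pos (show 0 < √m / √a by positivity)
    rw [Real.log_div hsm.ne' hsa.ne', Real.log_sqrt hm.le, Real.log_sqrt ha] at h1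
    have h2 : a * (√m / √a) = √a * √m := by
      nth_rewrite 1 [← Real.mul_self_sqrt ha]
      field_simp
    nlinarith

/-- Strong convexity with a Hellinger deficit. It follows from `log u ≤ u - 1` at `u = √(m/a)` and
`u = √(m/b)`, with `m` the midpoint. -/
theorem klFun_midpoint {a b : ℝ} (ha : 0 ≤ a) (hb : 0 ≤ b) :
    2 * klFun ((a + b) / 2) + 1 / 2 * (√a - √b) ^ 2 ≤ klFun a + klFun b := by
  rcases (add_nonneg ha hb).eq_or_lt with h | h
  · have ha0 : a = 0 := by linarith
    have hb0 : b = 0 := by linarith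
    simp [ha0, hb0, two_mul]
  · set m := (a + b) / 2 with hm
    have hm0 : 0 < m := by positivity
    have h1 := two_mul_sub_sqrt_le_log ha hm0
    have h2 := two_mul_sub_sqrt_le_log hb hm0
    have e1 := Real.sq_sqrt ha
    have e2 := Real.sq_sqrt hb
    have e3 := Real.sq_sqrt hm0.le
    -- From `(√a + √b - 2√m)² ≥ 0` and `(√a + √b)² + (√a - √b)² = 4m`.
    have h3 : (√a + √b) * √m ≤ m * 2 - (√a - √b) ^ 2 / 4 := by
      have h4 : (√a + √b) ^ 2 = 4 * m - (√a - √b) ^ 2 := by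
        rw [hm]; nlinarith
      nlinarith [sq_nonneg (√a + √b - 2 * √m)]
    simp only [klFun_apply]
    have h4 : a * Real.log m + b * Real.log m = 2 * m * Real.log m := by rw [hm]; ring
    have h5 : a + b = 2 * m := by rw [hm]; ring
    linarith

theorem GaussDominated.ae_ne {m : Measure ℝ} [SFinite m] (hm : GaussDominated m) (m' : Measure ℝ) :
    ∀ᵐ q ∂(m'.prod m), q.1 ≠ q.2 := by
  have hs : MeasurableSet {q : ℝ × ℝ | q.1 ≠ q.2} :=
    (measurableSet_eq_fun measurable_fst measurable_snd).compl
  rw [Measure.ae_prod_iff_ae_ae hs]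
  refine Eventually.of_forall fun x => ?_
  have h3 : ∀ᵐ z ∂(volume : Measure ℝ), x ≠ z := by
    simp [ae_iff]
  exact hm.absolutelyContinuous.ae_le h3

/-! ### Probability densities and the free energy functional -/

/-- `f` is a probability density with respect to `ν`. -/
structure IsDensity (ν : Measure ℝ) (f : ℝ → ℝ) : Prop where
  measurable : Measurable f
  nonneg : ∀ x, 0 ≤ f x
  lintegral_eq_one : ∫⁻ x, ENNReal.ofReal (f x) ∂ν = 1

/-- The measure with density `f` with respect to `ν`. -/
abbrev densityMeasure (ν : Measure ℝ) (f : ℝ → ℝ) : Measure ℝ :=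
  ν.withDensity fun x => ENNReal.ofReal (f x)

theorem IsDensity.isProbabilityMeasure {ν : Measure ℝ} {f : ℝ → ℝ} (hf : IsDensity ν f) :
    IsProbabilityMeasure (densityMeasure ν f) :=
  ⟨by rw [withDensity_apply _ MeasurableSet.univ, setLIntegral_univ, hf.lintegral_eq_one]⟩

theorem IsDensity.combine {ν : Measure ℝ} {f g : ℝ → ℝ} (hf : IsDensity ν f) (hg : IsDensity ν g)
    {a b : ℝ} (ha : 0 ≤ a) (hb : 0 ≤ b) (hab : a + b = 1) :
    IsDensity ν (fun x => a * f x + b * g x) := by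
  have h1 := hf.measurable
  have h2 := hg.measurable
  refine ⟨by fun_prop, fun x => add_nonneg (mul_nonneg ha (hf.nonneg x))
    (mul_nonneg hb (hg.nonneg x)), ?_⟩
  have : ∀ x, ENNReal.ofReal (a * f x + b * g x)
      = ENNReal.ofReal a * ENNReal.ofReal (f x) + ENNReal.ofReal b * ENNReal.ofReal (g x) := by
    intro x
    rw [ENNReal.ofReal_add (mul_nonneg ha (hf.nonneg x)) (mul_nonneg hb (hg.nonneg x)),
      ENNReal.ofReal_mul ha, ENNReal.ofReal_mul hb]
  simp_rw [this]
  rw [lintegral_add_left (by fun_prop), lintegral_const_mul _ (by fun_prop),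
    lintegral_const_mul _ (by fun_prop), hf.lintegral_eq_one, hg.lintegral_eq_one, mul_one,
    mul_one, ← ENNReal.ofReal_add ha hb, hab, ENNReal.ofReal_one]

theorem densityMeasure_one {ν : Measure ℝ} : densityMeasure ν (fun _ => 1) = ν := by
  simp [densityMeasure, ← Pi.one_def]

theorem eLpNorm_two_sq {ν : Measure ℝ} (h : ℝ → ℝ) :
    eLpNorm h 2 ν ^ 2 = ∫⁻ x, ENNReal.ofReal (h x ^ 2) ∂ν := by
  have := eLpNorm_nnreal_pow_eq_lintegral (μ := ν) (f := h) (p := 2) two_ne_zero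
  simp only [NNReal.coe_ofNat, ENNReal.rpow_ofNat, ENNReal.coe_ofNat] at this
  rw [this]
  refine lintegral_congr fun x => ?_
  rw [← ofReal_norm, ← ENNReal.ofReal_pow (norm_nonneg _), Real.norm_eq_abs, sq_abs]

section

variable {ν : Measure ℝ} [IsProbabilityMeasure ν] {f g : ℝ → ℝ}

theorem klDiv_densityMeasure (hf : IsDensity ν f) :
    klDiv (densityMeasure ν f) ν = ∫⁻ x, ENNReal.ofReal (klFun (f x)) ∂ν := by
  have := hf.isProbabilityMeasure
  have hm := hf.measurable
  rw [klDiv_eq_lintegral_klFun_of_ac (withDensity_absolutelyContinuous _ _)]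
  refine lintegral_congr_ae ?_
  filter_upwards [Measure.rnDeriv_withDensity ν (f := fun x => ENNReal.ofReal (f x))
    (by fun_prop)] with x hx
  rw [hx, ENNReal.toReal_ofReal (hf.nonneg x)]

theorem exists_isDensity_eq {m : Measure ℝ} [IsProbabilityMeasure m] (hm : m ≪ ν) :
    ∃ f, IsDensity ν f ∧ m = densityMeasure ν f := by
  have h1 : (fun x => ENNReal.ofReal (m.rnDeriv ν x).toReal) =ᵐ[ν] m.rnDeriv ν := by
    filter_upwards [Measure.rnDeriv_ne_top m ν] with x hx using ENNReal.ofReal_toReal hx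
  refine ⟨fun x => (m.rnDeriv ν x).toReal, ⟨by fun_prop, fun x => ENNReal.toReal_nonneg, ?_⟩, ?_⟩
  · rw [lintegral_congr_ae h1, Measure.lintegral_rnDeriv hm, measure_univ]
  · rw [densityMeasure, withDensity_congr_ae h1, Measure.withDensity_rnDeriv_eq _ _ hm]

theorem mixedEnergy_densityMeasure (hf : IsDensity ν f) (hg : IsDensity ν g) :
    mixedEnergy (densityMeasure ν f) (densityMeasure ν g) =
      ∫⁻ q, weightedKernel q.1 q.2 * (ENNReal.ofReal (f q.1) * ENNReal.ofReal (g q.2))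
        ∂(ν.prod ν) := by
  have h1 := hf.measurable
  have h2 := hg.measurable
  rw [mixedEnergy, prod_withDensity (by fun_prop) (by fun_prop),
    lintegral_withDensity_eq_lintegral_mul _ (by fun_prop) (by fun_prop)]
  simp only [Pi.mul_apply, mul_comm]

/-- The free energy of a density, written as one integral over the product space. -/
def densityEnergy (ν : Measure ℝ) (c : ℝ≥0∞) (f : ℝ → ℝ) : ℝ≥0∞ :=
  ∫⁻ q, c * (weightedKernel q.1 q.2 * (ENNReal.ofReal (f q.1) * ENNReal.ofReal (f q.2)))
    + ENNReal.ofReal (klFun (f q.1)) ∂(ν.prod ν)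

theorem densityEnergy_eq (c : ℝ≥0∞) (hf : IsDensity ν f) :
    densityEnergy ν c f =
      c * weightedEnergy (densityMeasure ν f) + klDiv (densityMeasure ν f) ν := by
  have h1 := hf.measurable
  have hk := measurable_klFun
  have := hf.isProbabilityMeasure
  rw [densityEnergy, lintegral_add_left (by fun_prop), lintegral_const_mul _ (by fun_prop),
    ← mixedEnergy_densityMeasure hf hf, mixedEnergy_self, klDiv_densityMeasure hf]
  congr 1
  rw [lintegral_prod _ (by fun_prop)]
  simp

theorem mixedEnergy_comm (m m' : Measure ℝ) [SFinite m] [SFinite m'] :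
    mixedEnergy m m' = mixedEnergy m' m := by
  unfold mixedEnergy
  rw [← lintegral_prod_swap]
  exact lintegral_congr fun q => weightedKernel_comm _ _

theorem mixedEnergy_combine (hf : IsDensity ν f) (hg : IsDensity ν g) {a b : ℝ} (ha : 0 ≤ a)
    (hb : 0 ≤ b) (hab : a + b = 1) :
    weightedEnergy (densityMeasure ν fun x => a * f x + b * g x) =
      ENNReal.ofReal (a ^ 2) * weightedEnergy (densityMeasure ν f) +
      ENNReal.ofReal (2 * a * b) * mixedEnergy (densityMeasure ν f) (densityMeasure ν g) +
      ENNReal.ofReal (b ^ 2) * weightedEnergy (densityMeasure ν g) := by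
  have h1 := hf.measurable
  have h2 := hg.measurable
  have i1 := hf.isProbabilityMeasure
  have i2 := hg.isProbabilityMeasure
  have i3 := (hf.combine hg ha hb hab).isProbabilityMeasure
  have h4 : ENNReal.ofReal (2 * a * b) * mixedEnergy (densityMeasure ν f) (densityMeasure ν g) =
      ENNReal.ofReal (a * b) * mixedEnergy (densityMeasure ν f) (densityMeasure ν g) +
      ENNReal.ofReal (a * b) * mixedEnergy (densityMeasure ν g) (densityMeasure ν f) := by
    rw [mixedEnergy_comm (densityMeasure ν g), ← add_mul, ← ENNReal.ofReal_add (by positivity)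
      (by positivity)]
    ring_nf
  rw [h4, ← mixedEnergy_self, ← mixedEnergy_self, ← mixedEnergy_self (densityMeasure ν g),
    mixedEnergy_densityMeasure (hf.combine hg ha hb hab) (hf.combine hg ha hb hab),
    mixedEnergy_densityMeasure hf hf, mixedEnergy_densityMeasure hf hg,
    mixedEnergy_densityMeasure hg hf, mixedEnergy_densityMeasure hg hg,
    ← lintegral_const_mul _ (by fun_prop), ← lintegral_const_mul _ (by fun_prop),
    ← lintegral_const_mul _ (by fun_prop), ← lintegral_const_mul _ (by fun_prop),
    ← lintegral_add_left (by fun_prop), ← lintegral_add_left (by fun_prop),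
    ← lintegral_add_left (by fun_prop)]
  refine lintegral_congr fun q => ?_
  have e : ∀ x, ENNReal.ofReal (a * f x + b * g x)
      = ENNReal.ofReal a * ENNReal.ofReal (f x) + ENNReal.ofReal b * ENNReal.ofReal (g x) := by
    intro x
    rw [ENNReal.ofReal_add (mul_nonneg ha (hf.nonneg x)) (mul_nonneg hb (hg.nonneg x)),
      ENNReal.ofReal_mul ha, ENNReal.ofReal_mul hb]
  rw [e, e, ENNReal.ofReal_mul ha, ENNReal.ofReal_pow ha, ENNReal.ofReal_pow hb]
  ring

theorem klDiv_combine_le (hf : IsDensity ν f) (hg : IsDensity ν g) {a b : ℝ} (ha : 0 ≤ a)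
    (hb : 0 ≤ b) (hab : a + b = 1) :
    klDiv (densityMeasure ν fun x => a * f x + b * g x) ν ≤
      ENNReal.ofReal a * klDiv (densityMeasure ν f) ν +
      ENNReal.ofReal b * klDiv (densityMeasure ν g) ν := by
  have h1 := hf.measurable
  have h2 := hg.measurable
  have hk := measurable_klFun
  rw [klDiv_densityMeasure (hf.combine hg ha hb hab), klDiv_densityMeasure hf,
    klDiv_densityMeasure hg, ← lintegral_const_mul _ (by fun_prop),
    ← lintegral_const_mul _ (by fun_prop), ← lintegral_add_left (by fun_prop)]
  refine lintegral_mono fun x => ?_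
  rw [← ENNReal.ofReal_mul ha, ← ENNReal.ofReal_mul hb, ← ENNReal.ofReal_add
    (mul_nonneg ha (klFun_nonneg (hf.nonneg x))) (mul_nonneg hb (klFun_nonneg (hg.nonneg x)))]
  exact ENNReal.ofReal_le_ofReal (convexOn_klFun.2 (hf.nonneg x) (hg.nonneg x) ha hb hab)

/-- Young's inequality with exponent `theta`: `e^theta = 1 + |x|` is integrable under a
Gaussian-dominated measure. Finite entropy thus supplies the moment required by the convexity of the
energy. -/
theorem integrable_theta_of_klDiv_ne_top (hν : GaussDominated ν) {m : Measure ℝ}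
    [IsProbabilityMeasure m] (h : klDiv m ν ≠ ∞) : Integrable theta m := by
  have hac : m ≪ ν := (klDiv_ne_top_iff.1 h).1
  obtain ⟨f, hf, rfl⟩ := exists_isDensity_eq hac
  have h1 := hf.measurable
  have hk := measurable_klFun
  refine ⟨by fun_prop, ?_⟩
  rw [hasFiniteIntegral_iff_ofReal (Eventually.of_forall theta_nonneg),
    lintegral_withDensity_eq_lintegral_mul _ (by fun_prop) (by fun_prop)]
  have hexp : Integrable (fun x => 1 + |x|) ν :=
    hν.integrable ((integrable_const _).add integrable_abs_stdGauss)
  have hexp' := hexp.2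
  rw [hasFiniteIntegral_iff_ofReal (Eventually.of_forall fun x => by positivity)] at hexp'
  rw [klDiv_densityMeasure hf] at h
  refine lt_of_le_of_lt ?_ (ENNReal.add_lt_top.2 ⟨h.lt_top, hexp'⟩)
  rw [← lintegral_add_left (by fun_prop)]
  refine lintegral_mono fun x => ?_
  rw [Pi.mul_apply, ← ENNReal.ofReal_mul (hf.nonneg x), ← ENNReal.ofReal_add
    (klFun_nonneg (hf.nonneg x)) (by positivity), ← exp_theta]
  exact ENNReal.ofReal_le_ofReal (mul_le_klFun_add_exp (hf.nonneg x) _)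

/-- The energy part is merely convex, so the Hellinger gain comes entirely from the entropy. This
plays the role of the parallelogram identity in the search for a minimizer. -/
theorem densityEnergy_midpoint (hν : GaussDominated ν) (c : ℝ≥0∞) (hf : IsDensity ν f)
    (hg : IsDensity ν g) (hf1 : klDiv (densityMeasure ν f) ν ≠ ∞)
    (hg1 : klDiv (densityMeasure ν g) ν ≠ ∞) :
    2 * densityEnergy ν c (fun x => 1 / 2 * f x + 1 / 2 * g x)
      + ∫⁻ x, ENNReal.ofReal (1 / 2 * (√(f x) - √(g x)) ^ 2) ∂ν
      ≤ densityEnergy ν c f + densityEnergy ν c g := by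
  have h1 := hf.measurable
  have h2 := hg.measurable
  have hk := measurable_klFun
  have i1 := hf.isProbabilityMeasure
  have i2 := hg.isProbabilityMeasure
  have hh : (0 : ℝ) ≤ 1 / 2 := by norm_num
  have hd := hf.combine hg hh hh (by norm_num)
  rw [densityEnergy_eq c hd, densityEnergy_eq c hf, densityEnergy_eq c hg,
    mixedEnergy_combine hf hg hh hh (by norm_num)]
  have hE : 2 * (ENNReal.ofReal ((1 / 2) ^ 2) * weightedEnergy (densityMeasure ν f) +
      ENNReal.ofReal (2 * (1 / 2) * (1 / 2)) *
        mixedEnergy (densityMeasure ν f) (densityMeasure ν g) +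
      ENNReal.ofReal ((1 / 2) ^ 2) * weightedEnergy (densityMeasure ν g)) ≤
      weightedEnergy (densityMeasure ν f) + weightedEnergy (densityMeasure ν g) := by
    have h3 := two_mul_mixedEnergy_le (integrable_theta_of_klDiv_ne_top hν hf1)
      (integrable_theta_of_klDiv_ne_top hν hg1)
    set A := weightedEnergy (densityMeasure ν f)
    set B := weightedEnergy (densityMeasure ν g)
    set D := mixedEnergy (densityMeasure ν f) (densityMeasure ν g)
    have e1 : ENNReal.ofReal (2 * (1 / 2) * (1 / 2)) = ENNReal.ofReal (1 / 4) * 2 := by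
      rw [← ENNReal.ofReal_ofNat 2, ← ENNReal.ofReal_mul (by norm_num)]; norm_num
    have e2 : ENNReal.ofReal ((1 / 2) ^ 2) = ENNReal.ofReal (1 / 4) := by norm_num
    have e3 : (2 : ℝ≥0∞) * ENNReal.ofReal (1 / 4) * 2 = 1 := by
      rw [← ENNReal.ofReal_ofNat 2, ← ENNReal.ofReal_mul (by norm_num),
        ← ENNReal.ofReal_mul (by norm_num)]; norm_num
    rw [e1, e2]
    calc 2 * (ENNReal.ofReal (1 / 4) * A + ENNReal.ofReal (1 / 4) * 2 * D
          + ENNReal.ofReal (1 / 4) * B)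
        = 2 * ENNReal.ofReal (1 / 4) * (A + B + 2 * D) := by ring
      _ ≤ 2 * ENNReal.ofReal (1 / 4) * (A + B + (A + B)) := by gcongr
      _ = 2 * ENNReal.ofReal (1 / 4) * 2 * (A + B) := by ring
      _ = A + B := by rw [e3, one_mul]
  have hK : 2 * klDiv (densityMeasure ν fun x => 1 / 2 * f x + 1 / 2 * g x) ν +
      ∫⁻ x, ENNReal.ofReal (1 / 2 * (√(f x) - √(g x)) ^ 2) ∂ν ≤
      klDiv (densityMeasure ν f) ν + klDiv (densityMeasure ν g) ν := by
    rw [klDiv_densityMeasure hd, klDiv_densityMeasure hf, klDiv_densityMeasure hg,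
      ← lintegral_const_mul _ (by fun_prop), ← lintegral_add_left (by fun_prop),
      ← lintegral_add_left (by fun_prop)]
    refine lintegral_mono fun x => ?_
    rw [← ENNReal.ofReal_ofNat 2, ← ENNReal.ofReal_mul (by norm_num),
      ← ENNReal.ofReal_add (mul_nonneg (by norm_num) (klFun_nonneg (hd.nonneg x)))
      (by positivity), ← ENNReal.ofReal_add (klFun_nonneg (hf.nonneg x))
      (klFun_nonneg (hg.nonneg x))]
    apply ENNReal.ofReal_le_ofReal
    have := klFun_midpoint (hf.nonneg x) (hg.nonneg x)
    rw [show 1 / 2 * f x + 1 / 2 * g x = (f x + g x) / 2 by ring]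
    exact this
  calc _ = c * (2 * (ENNReal.ofReal ((1 / 2) ^ 2) * weightedEnergy (densityMeasure ν f) +
      ENNReal.ofReal (2 * (1 / 2) * (1 / 2)) *
        mixedEnergy (densityMeasure ν f) (densityMeasure ν g) +
      ENNReal.ofReal ((1 / 2) ^ 2) * weightedEnergy (densityMeasure ν g))) +
      (2 * klDiv (densityMeasure ν fun x => 1 / 2 * f x + 1 / 2 * g x) ν +
      ∫⁻ x, ENNReal.ofReal (1 / 2 * (√(f x) - √(g x)) ^ 2) ∂ν) := by ring
    _ ≤ c * (weightedEnergy (densityMeasure ν f) + weightedEnergy (densityMeasure ν g)) +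
      (klDiv (densityMeasure ν f) ν + klDiv (densityMeasure ν g) ν) := by gcongr
    _ = _ := by ring

theorem mixedEnergy_ne_top {m m' : Measure ℝ} [IsFiniteMeasure m] [IsFiniteMeasure m']
    (hm : GaussDominated m) (hm' : GaussDominated m') : mixedEnergy m m' ≠ ∞ := by
  have h1 : Integrable (fun q : ℝ × ℝ => logKernel q.1 q.2 + theta q.1 + theta q.2)
      (m.prod m') := by
    refine hm.integrable_prod hm' ((integrable_logKernel_prod_stdGauss.add
      (integrable_theta_stdGauss.comp_fst _)).add (integrable_theta_stdGauss.comp_snd _))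
  refine ne_top_of_le_ne_top (h1.norm.lintegral_lt_top).ne (lintegral_mono_ae ?_)
  filter_upwards [hm'.ae_ne m] with q hq
  rw [weightedKernel, if_neg hq]
  exact ENNReal.ofReal_le_ofReal (Real.le_norm_self _)

theorem weightedEnergy_ne_top {m : Measure ℝ} [IsFiniteMeasure m] (hm : GaussDominated m) :
    weightedEnergy m ≠ ∞ := by
  rw [← mixedEnergy_self]
  exact mixedEnergy_ne_top hm hm

theorem isDensity_one : IsDensity ν (fun _ => 1) :=
  ⟨measurable_const, fun _ => zero_le_one, by simp⟩

/-- A direct method without compactness. By the midpoint inequality, square roots of almost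
minimizing densities are close in L²(ν). Norm convergence keeps the limit normalized, and Fatou
along an almost everywhere convergent subsequence gives lower semicontinuity. -/
theorem exists_minimizing_density (hν : GaussDominated ν) {c : ℝ≥0∞} (hc : c ≠ ∞) :
    ∃ f, IsDensity ν f ∧ densityEnergy ν c f ≠ ∞ ∧
      ∀ g, IsDensity ν g → densityEnergy ν c f ≤ densityEnergy ν c g := by
  set J : ℝ≥0∞ := ⨅ f : {f // IsDensity ν f}, densityEnergy ν c f.1 with hJ
  have hJle : ∀ f, IsDensity ν f → J ≤ densityEnergy ν c f := fun f hf =>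
    iInf_le (fun f : {f // IsDensity ν f} => densityEnergy ν c f.1) ⟨f, hf⟩
  have h1 : densityEnergy ν c (fun _ => 1) ≠ ∞ := by
    rw [densityEnergy_eq c isDensity_one, densityMeasure_one, klDiv_self, add_zero]
    exact ENNReal.mul_ne_top hc (weightedEnergy_ne_top hν)
  have hJtop : J ≠ ∞ := ne_top_of_le_ne_top h1 (hJle _ isDensity_one)
  -- The rate `4^{-n}` becomes `2^{-n}` for L² distances, which is summable as the completeness
  -- lemma demands.
  have hex : ∀ n : ℕ, ∃ f, IsDensity ν f ∧ densityEnergy ν c f ≤ J + (1 / 4) ^ n := by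
    intro n
    have : J < J + (1 / 4) ^ n :=
      ENNReal.lt_add_right hJtop (pow_ne_zero _ (by simp))
    obtain ⟨f, hf⟩ := iInf_lt_iff.1 this
    exact ⟨f.1, f.2, hf.le⟩
  choose F hF hFJ using hex
  have hpow : ∀ n : ℕ, ((1 / 4 : ℝ≥0∞)) ^ n ≠ ∞ := fun n => ENNReal.pow_ne_top (by simp)
  have hFtop : ∀ n, densityEnergy ν c (F n) ≠ ∞ := fun n =>
    ne_top_of_le_ne_top (ENNReal.add_ne_top.2 ⟨hJtop, hpow n⟩) (hFJ n)
  have hkl : ∀ n, klDiv (densityMeasure ν (F n)) ν ≠ ∞ := fun n => by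
    have := hFtop n
    rw [densityEnergy_eq c (hF n)] at this
    exact (ENNReal.add_ne_top.1 this).2
  have hFm : ∀ n, Measurable (F n) := fun n => (hF n).measurable
  set H : ℕ → ℝ → ℝ := fun n x => √(F n x) with hH
  have hHm : ∀ n, Measurable (H n) := fun n => (hFm n).sqrt
  have hH1 : ∀ n, eLpNorm (H n) 2 ν = 1 := by
    intro n
    have := eLpNorm_two_sq (ν := ν) (H n)
    simp only [hH, Real.sq_sqrt ((hF n).nonneg _)] at this
    rw [(hF n).lintegral_eq_one] at this
    exact by
      exact (ENNReal.pow_right_strictMono two_ne_zero).injective (by simpa using this)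
  have hHL : ∀ n, MemLp (H n) 2 ν := fun n =>
    ⟨(hHm n).aestronglyMeasurable, by rw [hH1]; simp⟩
  have hcau : ∀ N n k : ℕ, N ≤ n → N ≤ k → eLpNorm (H n - H k) 2 ν < 3 * (1 / 2) ^ N := by
    intro N n k hn hk
    have hmono : ∀ n, N ≤ n → densityEnergy ν c (F n) ≤ J + (1 / 4) ^ N := fun n hn =>
      (hFJ n).trans (add_le_add_right (pow_le_pow_right_of_le_one' (by simp) hn) _)
    have hmid := densityEnergy_midpoint hν c (hF n) (hF k) (hkl n) (hkl k)
    have hJm := hJle _ ((hF n).combine (hF k) (a := 1 / 2) (b := 1 / 2) (by norm_num)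
      (by norm_num) (by norm_num))
    have h2 : 2 * J + ∫⁻ x, ENNReal.ofReal (1 / 2 * (√(F n x) - √(F k x)) ^ 2) ∂ν
        ≤ 2 * J + 2 * (1 / 4) ^ N := by
      calc _ ≤ _ := add_le_add_left (mul_le_mul_right hJm 2) _
        _ ≤ _ := hmid
        _ ≤ (J + (1 / 4) ^ N) + (J + (1 / 4) ^ N) := add_le_add (hmono n hn) (hmono k hk)
        _ = _ := by ring
    have h3 := (ENNReal.add_le_add_iff_left (ENNReal.mul_ne_top (by simp) hJtop)).1 h2
    have h4 : eLpNorm (H n - H k) 2 ν ^ 2 ≤ (2 * (1 / 2) ^ N) ^ 2 := by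
      rw [eLpNorm_two_sq]
      simp_rw [ENNReal.ofReal_mul (show (0 : ℝ) ≤ 1 / 2 by norm_num)] at h3
      rw [lintegral_const_mul _ (by fun_prop)] at h3
      have e1 : (2 : ℝ≥0∞) * ENNReal.ofReal (1 / 2) = 1 := by
        rw [← ENNReal.ofReal_ofNat 2, ← ENNReal.ofReal_mul (by norm_num)]; norm_num
      calc ∫⁻ x, ENNReal.ofReal ((H n - H k) x ^ 2) ∂ν
          = 2 * (ENNReal.ofReal (1 / 2) *
            ∫⁻ x, ENNReal.ofReal ((√(F n x) - √(F k x)) ^ 2) ∂ν) := by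
              rw [← mul_assoc, e1, one_mul]; rfl
        _ ≤ 2 * (2 * (1 / 4) ^ N) := by gcongr
        _ = (2 * (1 / 2) ^ N) ^ 2 := by
            rw [mul_pow, ← pow_mul, mul_comm N 2, pow_mul]
            have : ((1 / 2 : ℝ≥0∞)) ^ 2 = 1 / 4 := by
              simp only [one_div]
              rw [← ENNReal.inv_pow]; norm_num
            rw [this]; ring
    have h5 : eLpNorm (H n - H k) 2 ν ≤ 2 * (1 / 2) ^ N :=
      (ENNReal.pow_le_pow_left_iff two_ne_zero).1 h4
    refine h5.trans_lt ?_
    have hp : ((1 / 2 : ℝ≥0∞)) ^ N ≠ 0 := pow_ne_zero _ (by simp)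
    have hp' : ((1 / 2 : ℝ≥0∞)) ^ N ≠ ∞ := ENNReal.pow_ne_top (by simp)
    exact ENNReal.mul_lt_mul_left hp hp' (by norm_num)
  have hsum : ∑' N : ℕ, (3 : ℝ≥0∞) * (1 / 2) ^ N ≠ ∞ := by
    rw [ENNReal.tsum_mul_left, ENNReal.tsum_geometric]
    exact ENNReal.mul_ne_top (by simp) (by simp)
  obtain ⟨h, hL, hlim⟩ := Lp.cauchy_complete_eLpNorm (by norm_num) hHL hsum hcau
  obtain ⟨ns, hns, hae⟩ := (tendstoInMeasure_of_tendsto_eLpNorm_of_ne_top (by norm_num) (by norm_num)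
    (fun n => (hHL n).1) hL.1 hlim).exists_seq_tendsto_ae
  -- `IsDensity` asks for genuine measurability, so the L² limit is replaced by a measurable
  -- version.
  set k : ℝ → ℝ := hL.1.aemeasurable.mk h with hk
  have hkm : Measurable k := hL.1.aemeasurable.measurable_mk
  have hkh : h =ᵐ[ν] k := hL.1.aemeasurable.ae_eq_mk
  have hk1 : eLpNorm k 2 ν = 1 := by
    rw [← eLpNorm_congr_ae hkh]
    refine tendsto_nhds_unique (tendsto_const_nhds (x := eLpNorm h 2 ν) (f := (atTop : Filter ℕ))) ?_
    have hd := fun n => ((hHL n).sub hL).eLpNorm_ne_top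
    refine tendsto_order.2 ⟨fun a ha => ?_, fun a ha => ?_⟩
    · refine Eventually.of_forall fun _ => lt_of_lt_of_le ha ?_
      refine ge_of_tendsto' (f := fun n => eLpNorm (H n - h) 2 ν + eLpNorm h 2 ν)
        (x := (atTop : Filter ℕ)) ?_ fun n => ?_
      · simpa using hlim.add_const (eLpNorm h 2 ν)
      · rw [← hH1 n]
        simpa using eLpNorm_add_le ((hHL n).1.sub hL.1) hL.1 (p := 2) (by norm_num)
    · refine Eventually.of_forall fun _ => lt_of_le_of_lt ?_ ha
      refine ge_of_tendsto' (f := fun n => eLpNorm (H n - h) 2 ν + 1)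
        (x := (atTop : Filter ℕ)) ?_ fun n => ?_
      · simpa using hlim.add_const 1
      · rw [← hH1 n, ← eLpNorm_neg (H n - h)]
        simpa using eLpNorm_add_le ((hHL n).1.sub hL.1).neg (hHL n).1 (p := 2) (by norm_num)
  have hdens : IsDensity ν (fun x => k x ^ 2) :=
    ⟨by fun_prop, fun x => sq_nonneg _, by rw [← eLpNorm_two_sq, hk1, one_pow]⟩
  have hconv : ∀ᵐ x ∂ν, Tendsto (fun i => F (ns i) x) atTop (𝓝 (k x ^ 2)) := by
    filter_upwards [hae, hkh] with x hx hx2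
    rw [← hx2]
    refine (hx.pow 2).congr fun i => ?_
    simp only [hH, Real.sq_sqrt ((hF _).nonneg _)]
  refine ⟨_, hdens, ?_⟩
  have hle : densityEnergy ν c (fun x => k x ^ 2) ≤ J := by
    -- Off the diagonal, which is null, the kernel is finite; this makes multiplication by it
    -- continuous in the extended reals.
    have hconv2 : ∀ᵐ q ∂(ν.prod ν), Tendsto (fun i => c * (weightedKernel q.1 q.2 *
        (ENNReal.ofReal (F (ns i) q.1) * ENNReal.ofReal (F (ns i) q.2)))
        + ENNReal.ofReal (klFun (F (ns i) q.1))) atTop (𝓝 (c * (weightedKernel q.1 q.2 *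
        (ENNReal.ofReal (k q.1 ^ 2) * ENNReal.ofReal (k q.2 ^ 2)))
        + ENNReal.ofReal (klFun (k q.1 ^ 2)))) := by
      filter_upwards [Measure.quasiMeasurePreserving_fst.ae hconv,
        Measure.quasiMeasurePreserving_snd.ae hconv, hν.ae_ne ν] with q hq1 hq2 hq
      have hK : weightedKernel q.1 q.2 ≠ ∞ := by
        rw [weightedKernel, if_neg hq]; exact ENNReal.ofReal_ne_top
      refine Tendsto.add (ENNReal.Tendsto.const_mul (ENNReal.Tendsto.const_mul
        (ENNReal.Tendsto.mul (ENNReal.tendsto_ofReal hq1) (Or.inr ENNReal.ofReal_ne_top)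
        (ENNReal.tendsto_ofReal hq2) (Or.inr ENNReal.ofReal_ne_top)) (Or.inr hK)) (Or.inr hc))
        (ENNReal.tendsto_ofReal ?_)
      exact (continuous_klFun.tendsto _).comp hq1
    have hkf := measurable_klFun
    calc densityEnergy ν c (fun x => k x ^ 2)
        ≤ liminf (fun i => densityEnergy ν c (F (ns i))) atTop := by
          refine le_trans (lintegral_mono_ae ?_) (lintegral_liminf_le fun i => ?_)
          · filter_upwards [hconv2] with q hq using hq.liminf_eq.ge
          · have := hFm (ns i)
            fun_prop
      _ ≤ liminf (fun i => J + (1 / 4) ^ (ns i)) atTop :=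
          liminf_le_liminf (Eventually.of_forall fun i => hFJ _)
      _ = J := by
          refine Tendsto.liminf_eq ?_
          have h2 : Tendsto (fun n : ℕ => (1 / 4 : ℝ≥0∞) ^ n) atTop (𝓝 0) :=
            ENNReal.tendsto_pow_atTop_nhds_zero_of_lt_one (by norm_num)
          simpa using (h2.comp hns.tendsto_atTop).const_add J
  exact ⟨ne_top_of_le_ne_top hJtop hle, fun g hg => hle.trans (hJle g hg)⟩

end

end LogGas

end

/-! ### The self-consistent equation and uniqueness of the minimizer. -/

noncomputable section

namespace LogGas

/-! ### The Euler-Lagrange equation -/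

/-- The weighted potential `∫ K(x, z) p(dz)`. -/
def weightedPotential (p : Measure ℝ) (x : ℝ) : ℝ≥0∞ := ∫⁻ z, weightedKernel x z ∂p

@[fun_prop]
theorem measurable_weightedPotential (p : Measure ℝ) [SFinite p] :
    Measurable (weightedPotential p) :=
  measurable_weightedKernel.lintegral_prod_right'

theorem lintegral_weightedPotential (m p : Measure ℝ) [SFinite p] [SFinite m] :
    ∫⁻ x, weightedPotential p x ∂m = mixedEnergy m p := by
  rw [mixedEnergy, lintegral_prod _ (by fun_prop)]
  rfl

/-- The exponent `-γ ∫ K(x, z) p(dz)`. -/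
def tiltExponent (γ : ℝ) (p : Measure ℝ) (x : ℝ) : ℝ := -γ * (weightedPotential p x).toReal

@[fun_prop]
theorem measurable_tiltExponent (γ : ℝ) (p : Measure ℝ) [SFinite p] :
    Measurable (tiltExponent γ p) := by
  unfold tiltExponent
  fun_prop

theorem exp_tiltExponent_le_one {γ : ℝ} {p : Measure ℝ} (hγ : 0 ≤ γ) (x : ℝ) :
    Real.exp (tiltExponent γ p x) ≤ 1 := by
  rw [Real.exp_le_one_iff, tiltExponent, neg_mul]
  exact neg_nonpos.2 (mul_nonneg hγ ENNReal.toReal_nonneg)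

section

variable {ν m p : Measure ℝ} [IsProbabilityMeasure ν] [IsProbabilityMeasure m]
  [IsProbabilityMeasure p] {γ : ℝ}

theorem integrable_exp_tiltExponent (m : Measure ℝ) [IsProbabilityMeasure m] (hγ : 0 ≤ γ) :
    Integrable (fun x => Real.exp (tiltExponent γ p x)) m := by
  refine Integrable.of_bound (by fun_prop) 1 (Eventually.of_forall fun x => ?_)
  rw [Real.norm_of_nonneg (Real.exp_pos _).le]
  exact exp_tiltExponent_le_one hγ x

theorem integrable_tiltExponent (h : γ = 0 ∨ mixedEnergy m p ≠ ∞) :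
    Integrable (tiltExponent γ p) m ∧
      ∫ x, tiltExponent γ p x ∂m = -(γ * (mixedEnergy m p).toReal) := by
  rcases h with rfl | h
  · have : tiltExponent 0 p = fun _ => 0 := by ext x; simp [tiltExponent]
    simp [this]
  · rw [← lintegral_weightedPotential] at h ⊢
    have h1 := integrable_toReal_of_lintegral_ne_top (by fun_prop) h
    refine ⟨h1.const_mul _, ?_⟩
    unfold tiltExponent
    rw [integral_const_mul, integral_toReal (by fun_prop) (ae_lt_top (by fun_prop) h)]
    ring

/-- Tilting shifts the logarithmic density ratio by the tilt exponent and its normalization. The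
alternative `γ = 0` admits infinite mixed energy, the exponent being then identically zero. -/
theorem klDiv_tilted (hγ : 0 ≤ γ) (hm : klDiv m ν ≠ ∞) (h : γ = 0 ∨ mixedEnergy m p ≠ ∞) :
    klDiv m (ν.tilted (tiltExponent γ p)) ≠ ∞ ∧
      (klDiv m (ν.tilted (tiltExponent γ p))).toReal = (klDiv m ν).toReal
        + γ * (mixedEnergy m p).toReal + Real.log (∫ x, Real.exp (tiltExponent γ p x) ∂ν) := by
  obtain ⟨hac, hllr⟩ := klDiv_ne_top_iff.1 hm
  obtain ⟨h1, h2⟩ := integrable_tiltExponent h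
  have h3 := integrable_exp_tiltExponent (p := p) ν hγ
  have : IsProbabilityMeasure (ν.tilted (tiltExponent γ p)) := isProbabilityMeasure_tilted h3
  have hac' : m ≪ ν.tilted (tiltExponent γ p) := hac.trans (absolutelyContinuous_tilted h3)
  refine ⟨klDiv_ne_top hac' (integrable_llr_tilted_right hac h1 hllr h3), ?_⟩
  rw [toReal_klDiv_of_measure_eq hac' (by simp), toReal_klDiv_of_measure_eq hac (by simp),
    integral_llr_tilted_right hac h1 h3 hllr, h2]
  ring

theorem integral_exp_tiltExponent_pos (hγ : 0 ≤ γ) :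
    0 < ∫ x, Real.exp (tiltExponent γ p x) ∂ν :=
  integral_exp_pos (integrable_exp_tiltExponent ν hγ)

theorem tilted_le (hγ : 0 ≤ γ) : ν.tilted (tiltExponent γ p) ≤
    (∫ x, Real.exp (tiltExponent γ p x) ∂ν).toNNReal⁻¹ • ν := by
  have h0 := integral_exp_tiltExponent_pos (ν := ν) (p := p) hγ
  rw [Measure.tilted]
  refine (withDensity_mono (g := fun _ =>
    ((∫ x, Real.exp (tiltExponent γ p x) ∂ν).toNNReal⁻¹ : ℝ≥0)) ?_).trans ?_
  · refine Eventually.of_forall fun x => ?_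
    simp only
    rw [← ENNReal.ofReal_coe_nnreal]
    apply ENNReal.ofReal_le_ofReal
    rw [NNReal.coe_inv, Real.coe_toNNReal _ h0.le, div_eq_mul_inv]
    exact mul_le_of_le_one_left (inv_nonneg.2 h0.le) (exp_tiltExponent_le_one hγ x)
  · rw [withDensity_const]
    rfl

theorem GaussDominated.of_le {m m' : Measure ℝ} (h : GaussDominated m') (C : ℝ≥0)
    (hC : m ≤ C • m') : GaussDominated m := by
  obtain ⟨D, hD⟩ := h
  refine ⟨C * D, hC.trans ?_⟩
  rw [mul_smul]
  exact Measure.le_iff.2 fun s hs => by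
    simp only [Measure.smul_apply]
    gcongr
    exact hD s

theorem gaussDominated_tilted (hγ : 0 ≤ γ) (hν : GaussDominated ν) :
    GaussDominated (ν.tilted (tiltExponent γ p)) :=
  hν.of_le _ (tilted_le hγ)

theorem isDensity_tilted (hγ : 0 ≤ γ) : IsDensity ν (fun x => Real.exp (tiltExponent γ p x) /
    ∫ x, Real.exp (tiltExponent γ p x) ∂ν) := by
  have h0 := integral_exp_tiltExponent_pos (ν := ν) (p := p) hγ
  have h3 := integrable_exp_tiltExponent (p := p) ν hγ
  refine ⟨by fun_prop, fun x => by positivity, ?_⟩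
  have : IsProbabilityMeasure (ν.tilted (tiltExponent γ p)) := isProbabilityMeasure_tilted h3
  have h := measure_univ (μ := ν.tilted (tiltExponent γ p))
  rwa [Measure.tilted, withDensity_apply _ MeasurableSet.univ, setLIntegral_univ] at h

theorem klDiv_tilted_self_ne_top (hγ : 0 ≤ γ) (h : γ = 0 ∨ mixedEnergy ν p ≠ ∞) :
    klDiv (ν.tilted (tiltExponent γ p)) ν ≠ ∞ := by
  have h3 := integrable_exp_tiltExponent (p := p) ν hγ
  have hac := tilted_absolutelyContinuous ν (tiltExponent γ p)
  have : IsProbabilityMeasure (ν.tilted (tiltExponent γ p)) := isProbabilityMeasure_tilted h3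
  refine klDiv_ne_top hac ?_
  have h4 : llr (ν.tilted (tiltExponent γ p)) ν =ᵐ[ν.tilted (tiltExponent γ p)]
      fun x => tiltExponent γ p x - Real.log (∫ x, Real.exp (tiltExponent γ p x) ∂ν) :=
    hac.ae_le (log_rnDeriv_tilted_left_self h3)
  rw [integrable_congr h4]
  refine Integrable.sub ?_ (integrable_const _)
  exact ((integrable_tiltExponent h).1.smul_measure_nnreal).mono_measure (tilted_le hγ)

end

theorem nonneg_of_forall_add_mul_nonneg {D M : ℝ}
    (h : ∀ ε : ℝ, 0 < ε → ε < 1 → 0 ≤ D + ε * M) : 0 ≤ D := by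
  have h1 : Tendsto (fun ε : ℝ => D + ε * M) (𝓝[>] 0) (𝓝 (D + 0 * M)) :=
    (Continuous.tendsto (by fun_prop) 0).mono_left nhdsWithin_le_nhds
  rw [zero_mul, add_zero] at h1
  refine ge_of_tendsto h1 ?_
  filter_upwards [Ioo_mem_nhdsGT (show (0 : ℝ) < 1 by norm_num)] with ε hε using h ε hε.1 hε.2

/-- Let `p` minimize and let `q` be the tilt of `ν` by the potential of `p`. Along `(1 - ε) p + ε q`
the free energy lies below a quadratic in `ε` with slope `-klDiv p q` at 0: the two instances of
`klDiv_tilted`, at `p` and at `q`, match the linear terms. Minimality forces `klDiv p q = 0`. -/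
theorem exists_eq_tilted {ν : Measure ℝ} [IsProbabilityMeasure ν] (hν : GaussDominated ν) {γ : ℝ}
    (hγ : 0 ≤ γ) : ∃ p, IsProbabilityMeasure p ∧ p = ν.tilted (tiltExponent γ p) := by
  -- For `γ = 0` a finite free energy says nothing about the weighted energy, but the reference
  -- measure itself is the fixed point.
  rcases hγ.eq_or_lt with rfl | hγ0
  · refine ⟨ν, inferInstance, ?_⟩
    have : tiltExponent 0 ν = fun _ => 0 := by ext x; simp [tiltExponent]
    rw [this, tilted_const]
  have hc0 : ENNReal.ofReal (γ / 2) ≠ 0 := by simpa using hγ0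
  obtain ⟨f, hf, hJ, hmin⟩ := exists_minimizing_density hν (ENNReal.ofReal_ne_top (r := γ / 2))
  have hp := hf.isProbabilityMeasure
  rw [densityEnergy_eq _ hf, ENNReal.add_ne_top] at hJ
  set p := densityMeasure ν f with hp_def
  have hEp : weightedEnergy p ≠ ∞ := fun h => hJ.1 (by rw [h, ENNReal.mul_top hc0])
  have hHp := hJ.2
  have hθp := integrable_theta_of_klDiv_ne_top hν hHp
  have hθν : Integrable theta ν := hν.integrable integrable_theta_stdGauss
  have hmix : ∀ (m m' : Measure ℝ) [IsProbabilityMeasure m] [IsProbabilityMeasure m'],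
      Integrable theta m → Integrable theta m' → weightedEnergy m ≠ ∞ → weightedEnergy m' ≠ ∞ →
      mixedEnergy m m' ≠ ∞ := by
    intro m m' _ _ hm hm' hE hE' h
    have := two_mul_mixedEnergy_le hm hm'
    rw [h, ENNReal.mul_top (by simp), top_le_iff] at this
    exact (ENNReal.add_ne_top.2 ⟨hE, hE'⟩) this
  have hEνp := hmix ν p hθν hθp (weightedEnergy_ne_top hν) hEp
  have hg := isDensity_tilted (ν := ν) (p := p) hγ
  set g := fun x => Real.exp (tiltExponent γ p x) / ∫ x, Real.exp (tiltExponent γ p x) ∂ν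
  have hq := hg.isProbabilityMeasure
  have hqt : densityMeasure ν g = ν.tilted (tiltExponent γ p) := rfl
  set q := densityMeasure ν g with hq_def
  have hqd : GaussDominated q := hqt ▸ gaussDominated_tilted hγ hν
  have hEq := weightedEnergy_ne_top hqd
  have hHq : klDiv q ν ≠ ∞ := hqt ▸ klDiv_tilted_self_ne_top hγ (Or.inr hEνp)
  have hEpq := hmix p q hθp (hqd.integrable integrable_theta_stdGauss) hEp hEq
  have hEqp : mixedEnergy q p ≠ ∞ := by rwa [mixedEnergy_comm]
  have hkq := (klDiv_tilted hγ hHq (Or.inr hEqp)).2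
  rw [← hqt, klDiv_self, ENNReal.toReal_zero, mixedEnergy_comm] at hkq
  obtain ⟨hkp1, hkp⟩ := klDiv_tilted hγ hHp (Or.inr (by rwa [mixedEnergy_self]))
  rw [← hqt, mixedEnergy_self] at hkp
  rw [← hqt] at hkp1
  -- Minimality against the mixture, after division by `ε`; the last bracket is the energy form of
  -- `p - q`, of second order.
  have hineq : ∀ ε : ℝ, 0 < ε → ε < 1 →
      0 ≤ -(klDiv p q).toReal + ε * (γ / 2 * ((weightedEnergy p).toReal
        - 2 * (mixedEnergy p q).toReal + (weightedEnergy q).toReal)) := by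
    intro ε h0 h1
    have hε : 0 ≤ 1 - ε := by linarith
    have hd := hf.combine hg hε h0.le (by ring)
    have h2 := hmin _ hd
    rw [densityEnergy_eq _ hf, densityEnergy_eq _ hd, mixedEnergy_combine hf hg hε h0.le (by ring)]
      at h2
    have h3 := h2.trans (add_le_add_right (klDiv_combine_le hf hg hε h0.le (by ring)) _)
    rw [← hp_def, ← hq_def, ← ENNReal.ofReal_toReal hEp, ← ENNReal.ofReal_toReal hEq,
      ← ENNReal.ofReal_toReal hEpq, ← ENNReal.ofReal_toReal hHp, ← ENNReal.ofReal_toReal hHq] at h3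
    set ep := (weightedEnergy p).toReal
    set eq := (weightedEnergy q).toReal
    set epq := (mixedEnergy p q).toReal
    set kp := (klDiv p ν).toReal
    set kq := (klDiv q ν).toReal
    have n1 : 0 ≤ ep := ENNReal.toReal_nonneg
    have n2 : 0 ≤ eq := ENNReal.toReal_nonneg
    have n3 : 0 ≤ epq := ENNReal.toReal_nonneg
    have n4 : 0 ≤ kp := ENNReal.toReal_nonneg
    have n5 : 0 ≤ kq := ENNReal.toReal_nonneg
    rw [← ENNReal.ofReal_mul (by positivity), ← ENNReal.ofReal_add (by positivity) n4,
      ← ENNReal.ofReal_mul (by positivity), ← ENNReal.ofReal_mul (by positivity),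
      ← ENNReal.ofReal_mul (by positivity), ← ENNReal.ofReal_mul (by positivity),
      ← ENNReal.ofReal_mul (by positivity), ← ENNReal.ofReal_add (by positivity) (by positivity),
      ← ENNReal.ofReal_add (by positivity) (by positivity), ← ENNReal.ofReal_mul (by positivity),
      ← ENNReal.ofReal_add (by positivity) (by positivity),
      ← ENNReal.ofReal_add (by positivity) (by positivity),
      ENNReal.ofReal_le_ofReal_iff (by positivity)] at h3
    rw [hkp]
    have h4 : 0 ≤ ε * (-(kp + γ * ep + Real.log (∫ x, Real.exp (tiltExponent γ p x) ∂ν)) +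
        ε * (γ / 2 * (ep - 2 * epq + eq))) := by
      have e1 : Real.log (∫ x, Real.exp (tiltExponent γ p x) ∂ν) = -(kq + γ * epq) := by linarith
      rw [e1]
      nlinarith
    exact nonneg_of_mul_nonneg_right h4 h0
  have h5 := nonneg_of_forall_add_mul_nonneg hineq
  have h6 : (klDiv p q).toReal = 0 := le_antisymm (by linarith) ENNReal.toReal_nonneg
  have h7 : klDiv p q = 0 := ((ENNReal.toReal_eq_zero_iff _).1 h6).resolve_right hkp1
  exact ⟨p, hp, klDiv_eq_zero_iff.1 h7⟩

/-! ### The reference measure -/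

theorem gaussDominated_withDensity {f : ℝ → ℝ} {C : ℝ} (hC : 0 ≤ C)
    (hf : ∀ x, f x ≤ C * Real.exp (-x ^ 2 / 2)) :
    GaussDominated (volume.withDensity fun x => ENNReal.ofReal (f x)) := by
  refine ⟨(C * √(2 * Real.pi)).toNNReal, ?_⟩
  have h1 : (C * √(2 * Real.pi)).toNNReal • stdGauss = volume.withDensity
      (fun x => ENNReal.ofReal (C * √(2 * Real.pi)) *
        ENNReal.ofReal ((√(2 * Real.pi))⁻¹ * Real.exp (-x ^ 2 / 2))) := by
    rw [stdGauss_eq]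
    exact (withDensity_smul (μ := volume) (ENNReal.ofReal (C * √(2 * Real.pi)))
      (f := fun x => ENNReal.ofReal ((√(2 * Real.pi))⁻¹ * Real.exp (-x ^ 2 / 2)))
      (by fun_prop)).symm
  rw [h1]
  refine withDensity_mono (Eventually.of_forall fun x => ?_)
  simp only
  rw [← ENNReal.ofReal_mul (by positivity)]
  apply ENNReal.ofReal_le_ofReal
  have : √(2 * Real.pi) ≠ 0 := by positivity
  calc f x ≤ C * Real.exp (-x ^ 2 / 2) := hf x
    _ = _ := by field_simp

/-- Since `γ theta x ≤ γ |x| ≤ γ²/2 + x²/2`, half of the quadratic confinement survives. This is why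
the dominating measure is the standard Gaussian. -/
theorem exp_quadratic_le {γ : ℝ} (hγ : 0 ≤ γ) (x : ℝ) :
    Real.exp (-(x ^ 2 - γ * theta x)) ≤ Real.exp (γ ^ 2 / 2) * Real.exp (-x ^ 2 / 2) := by
  rw [← Real.exp_add]
  apply Real.exp_le_exp.2
  have h1 := mul_le_mul_of_nonneg_left (theta_le_abs x) hγ
  have h2 := sq_abs x
  nlinarith [sq_nonneg (γ - |x|)]

section

variable {γ : ℝ}

theorem gaussDominated_withDensity_referenceWeight (hγ : 0 ≤ γ) :
    GaussDominated (volume.withDensity (referenceWeight (fun x => x ^ 2) γ)) :=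
  gaussDominated_withDensity (Real.exp_pos _).le (exp_quadratic_le hγ)

@[fun_prop]
theorem measurable_referenceWeight : Measurable (referenceWeight (fun x => x ^ 2) γ) := by
  unfold referenceWeight
  fun_prop

theorem lintegral_referenceWeight_ne_top (hγ : 0 ≤ γ) : ∫⁻ x, referenceWeight (fun x => x ^ 2) γ x ≠ ∞ := by
  have := (gaussDominated_withDensity_referenceWeight hγ).isFiniteMeasure
  have h := measure_ne_top (volume.withDensity (referenceWeight (fun x => x ^ 2) γ)) Set.univ
  rwa [withDensity_apply _ MeasurableSet.univ, setLIntegral_univ] at h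

theorem lintegral_referenceWeight_ne_zero : ∫⁻ x, referenceWeight (fun x => x ^ 2) γ x ≠ 0 := by
  rw [Ne, lintegral_eq_zero_iff (by fun_prop)]
  intro h
  have h1 : ∀ᵐ x : ℝ, False := by
    filter_upwards [h] with x hx
    simp only [referenceWeight, Pi.zero_apply, ENNReal.ofReal_eq_zero] at hx
    exact absurd (Real.exp_pos _) (not_lt.2 hx)
  simp [ae_iff] at h1

theorem isProbabilityMeasure_referenceMeasure (hγ : 0 ≤ γ) :
    IsProbabilityMeasure (referenceMeasure (fun x => x ^ 2) γ) := by
  refine ⟨?_⟩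
  rw [referenceMeasure, Measure.smul_apply, withDensity_apply _ MeasurableSet.univ,
    setLIntegral_univ, smul_eq_mul, ENNReal.inv_mul_cancel lintegral_referenceWeight_ne_zero
    (lintegral_referenceWeight_ne_top hγ)]

theorem gaussDominated_referenceMeasure (hγ : 0 ≤ γ) :
    GaussDominated (referenceMeasure (fun x => x ^ 2) γ) := by
  refine (gaussDominated_withDensity_referenceWeight hγ).of_le
    (∫⁻ x, referenceWeight (fun x => x ^ 2) γ x).toNNReal⁻¹ ?_
  rw [referenceMeasure]
  have h : (∫⁻ x, referenceWeight (fun x => x ^ 2) γ x)⁻¹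
      = ((∫⁻ x, referenceWeight (fun x => x ^ 2) γ x).toNNReal⁻¹ : ℝ≥0) := by
    rw [ENNReal.coe_inv (by
      simp [ENNReal.toNNReal_eq_zero_iff, lintegral_referenceWeight_ne_zero,
        lintegral_referenceWeight_ne_top hγ]),
      ENNReal.coe_toNNReal (lintegral_referenceWeight_ne_top hγ)]
  rw [h]
  rfl

/-- At a fixed point `p`, the excess `F(m) - F(p)` equals `klDiv m p` plus `γ/2` times the energy
form of `m - p`. Both terms are nonnegative, and equality kills the entropy. -/
theorem isEquilibriumMeasure_of_eq_tilted (hγ : 0 ≤ γ) {p : Measure ℝ} [IsProbabilityMeasure p]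
    (hp : p = (referenceMeasure (fun x => x ^ 2) γ).tilted (tiltExponent γ p)) :
    IsEquilibriumMeasure (fun x => x ^ 2) γ p := by
  have iν := isProbabilityMeasure_referenceMeasure hγ
  have hν := gaussDominated_referenceMeasure hγ
  set ν := referenceMeasure (fun x => x ^ 2) γ with hν_def
  have hpd : GaussDominated p := by rw [hp]; exact gaussDominated_tilted hγ hν
  have hHp : klDiv p ν ≠ ∞ := by
    rw [hp]; exact klDiv_tilted_self_ne_top hγ (Or.inr (mixedEnergy_ne_top hν hpd))
  have hEp := weightedEnergy_ne_top hpd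
  have hself := (klDiv_tilted hγ hHp (Or.inr (mixedEnergy_ne_top hpd hpd))).2
  rw [← hp, klDiv_self, ENNReal.toReal_zero, mixedEnergy_self] at hself
  have hFp : freeEnergy (fun x => x ^ 2) γ p ≠ ∞ :=
    ENNReal.add_ne_top.2 ⟨ENNReal.mul_ne_top ENNReal.ofReal_ne_top hEp, hHp⟩
  have key : ∀ m : Measure ℝ, IsProbabilityMeasure m → freeEnergy (fun x => x ^ 2) γ m ≠ ∞ →
      klDiv m p ≠ ∞ ∧
      (klDiv m p).toReal + (freeEnergy (fun x => x ^ 2) γ p).toReal ≤ (freeEnergy (fun x => x ^ 2) γ m).toReal := by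
    intro m _ hm
    obtain ⟨hm1, hHm⟩ := ENNReal.add_ne_top.1 hm
    have hθ := integrable_theta_of_klDiv_ne_top hν hHm
    have hθp := hpd.integrable integrable_theta_stdGauss
    have h2 := two_mul_mixedEnergy_le hθ hθp
    have hEm : γ = 0 ∨ weightedEnergy m ≠ ∞ := by
      rcases hγ.eq_or_lt with h | h
      · exact Or.inl h.symm
      · refine Or.inr fun h3 => hm1 ?_
        rw [h3, ENNReal.mul_top (by simpa using h)]
    have hmix : γ = 0 ∨ mixedEnergy m p ≠ ∞ := by
      refine hEm.imp_right fun h h3 => ?_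
      rw [h3, ENNReal.mul_top (by simp), top_le_iff] at h2
      exact (ENNReal.add_ne_top.2 ⟨h, hEp⟩) h2
    obtain ⟨hk1, hk2⟩ := klDiv_tilted hγ hHm hmix
    rw [← hp] at hk1 hk2
    refine ⟨hk1, ?_⟩
    have h4 : 0 ≤ γ * ((weightedEnergy m).toReal + (weightedEnergy p).toReal
        - 2 * (mixedEnergy m p).toReal) := by
      rcases hEm with h | h
      · simp [h]
      · have h3 := ENNReal.toReal_mono (ENNReal.add_ne_top.2 ⟨h, hEp⟩) h2
        rw [ENNReal.toReal_mul, ENNReal.toReal_add h hEp] at h3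
        exact mul_nonneg hγ (by simpa using h3)
    rw [freeEnergy, freeEnergy, ENNReal.toReal_add hm1 hHm,
      ENNReal.toReal_add (ENNReal.mul_ne_top ENNReal.ofReal_ne_top hEp) hHp, ENNReal.toReal_mul,
      ENNReal.toReal_mul, ENNReal.toReal_ofReal (by positivity), hk2]
    linarith
  refine ⟨inferInstance, fun m hm => ?_, fun m hm hle => ?_⟩
  · by_cases h : freeEnergy (fun x => x ^ 2) γ m = ∞
    · rw [h]; exact le_top
    · rw [← ENNReal.toReal_le_toReal hFp h]
      linarith [(key m hm h).2, ENNReal.toReal_nonneg (a := klDiv m p)]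
  · have h := ne_top_of_le_ne_top hFp hle
    have h1 := ENNReal.toReal_mono hFp hle
    obtain ⟨h2, h3⟩ := key m hm h
    have h4 : (klDiv m p).toReal = 0 := le_antisymm (by linarith) ENNReal.toReal_nonneg
    exact klDiv_eq_zero_iff.1 (((ENNReal.toReal_eq_zero_iff _).1 h4).resolve_right h2)

theorem toReal_weightedPotential {p : Measure ℝ} [IsProbabilityMeasure p] (hp : GaussDominated p)
    (x : ℝ) : (weightedPotential p x).toReal = potential p x + theta x + ∫ z, theta z ∂p := by
  have hi1 : Integrable (logKernel x) p := hp.integrable (integrable_logKernel_stdGauss x)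
  have hi2 : Integrable theta p := hp.integrable integrable_theta_stdGauss
  have h1 : weightedPotential p x
      = ∫⁻ z, ENNReal.ofReal (logKernel x z + theta x + theta z) ∂p := by
    refine lintegral_congr_ae ?_
    have h3 : ∀ᵐ z ∂(volume : Measure ℝ), x ≠ z := by simp [ae_iff]
    filter_upwards [hp.absolutelyContinuous.ae_le h3] with z hz
    rw [weightedKernel, if_neg hz]
  have h2 : ∫ z, (logKernel x z + theta x + theta z) ∂p
      = potential p x + theta x + ∫ z, theta z ∂p := by
    have hi3 : Integrable (fun z => logKernel x z + theta x) p := hi1.add (integrable_const _)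
    rw [integral_add hi3 hi2, integral_add hi1 (integrable_const _)]
    simp [potential]
  rw [h1, ← h2, integral_eq_lintegral_of_nonneg_ae _ (by fun_prop)]
  refine Eventually.of_forall fun z => ?_
  have := neg_logKernel_le x z
  simp only [Pi.zero_apply]
  linarith

@[fun_prop]
theorem measurable_potential (p : Measure ℝ) [SFinite p] : Measurable (potential p) :=
  (measurable_logKernel.stronglyMeasurable.integral_prod_right' (ν := p)).measurable

theorem exists_isEquilibriumConstant (hγ : 0 ≤ γ) {p : Measure ℝ} [IsProbabilityMeasure p]
    (hpd : GaussDominated p) (hp : p = (referenceMeasure (fun x => x ^ 2) γ).tilted (tiltExponent γ p)) :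
    ∃ L, IsEquilibriumConstant (fun x => x ^ 2) γ p L := by
  have iν := isProbabilityMeasure_referenceMeasure hγ
  set c := ∫ x, Real.exp (tiltExponent γ p x) ∂(referenceMeasure (fun x => x ^ 2) γ) with hc
  have hc0 : 0 < c := integral_exp_tiltExponent_pos hγ
  set D := (∫⁻ x, referenceWeight (fun x => x ^ 2) γ x).toReal with hD
  have hD0 : 0 < D := ENNReal.toReal_pos lintegral_referenceWeight_ne_zero
    (lintegral_referenceWeight_ne_top hγ)
  set k := ∫ z, theta z ∂p with hk
  -- The three factors are the normalization of the tilt, that of the reference measure, and the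
  -- contribution of `∫ theta dμ` to the weighted potential. The factor `e^{γ theta}` of the
  -- reference weight cancels the `theta x` in the weighted potential.
  refine ⟨c * D * Real.exp (γ * k), by positivity,
    fun x => hpd.integrable (integrable_logKernel_stdGauss x), ?_⟩
  have hDinv : (∫⁻ x, referenceWeight (fun x => x ^ 2) γ x)⁻¹ = ENNReal.ofReal D⁻¹ := by
    rw [ENNReal.ofReal_inv_of_pos hD0, hD, ENNReal.ofReal_toReal
      (lintegral_referenceWeight_ne_top hγ)]
  conv_lhs => rw [hp, Measure.tilted, ← hc, referenceMeasure, hDinv]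
  rw [withDensity_smul_measure, ← withDensity_mul _ (by fun_prop) (by fun_prop),
    ← withDensity_smul _ (by fun_prop)]
  congr 1
  ext x
  simp only [Pi.smul_apply, Pi.mul_apply, smul_eq_mul, referenceWeight]
  rw [← ENNReal.ofReal_mul (by positivity), ← ENNReal.ofReal_mul (by positivity)]
  congr 1
  rw [tiltExponent, toReal_weightedPotential hpd, ← hk, mul_inv, mul_inv, ← Real.exp_neg]
  have : Real.exp (-γ * (potential p x + theta x + k)) = Real.exp (-(γ * k)) *
      (Real.exp (-(γ * potential p x) - x ^ 2) * (Real.exp (-(x ^ 2 - γ * theta x)))⁻¹) := by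
    rw [← Real.exp_neg, ← Real.exp_add, ← Real.exp_add]
    ring_nf
  rw [this]
  field_simp

theorem exists_equilibrium (hγ : 0 ≤ γ) : ∃ (μ : Measure ℝ) (L : ℝ),
    IsEquilibriumMeasure (fun x => x ^ 2) γ μ ∧ IsEquilibriumConstant (fun x => x ^ 2) γ μ L ∧ GaussDominated μ := by
  have iν := isProbabilityMeasure_referenceMeasure hγ
  have hν := gaussDominated_referenceMeasure hγ
  obtain ⟨p, ip, hp⟩ := exists_eq_tilted hν hγ
  have hpd : GaussDominated p := by rw [hp]; exact gaussDominated_tilted hγ hν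
  obtain ⟨L, hL⟩ := exists_isEquilibriumConstant hγ hpd hp
  exact ⟨p, L, isEquilibriumMeasure_of_eq_tilted hγ hp, hL, hpd⟩

end

end LogGas

end

/-! ### The finite ensemble and its decomposition into one particle and the rest. -/

noncomputable section

namespace LogGas

/-! ### Product measures -/

theorem lintegral_pi_prod {n : ℕ} {m : Fin n → Measure ℝ} [∀ i, SigmaFinite (m i)]
    {f : Fin n → ℝ → ℝ≥0∞} (hf : ∀ i, Measurable (f i)) :
    ∫⁻ x, ∏ i, f i (x i) ∂(Measure.pi m) = ∏ i, ∫⁻ x, f i x ∂(m i) := by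
  induction n with
  | zero => simp
  | succ n ih =>
    rw [← ((measurePreserving_piFinSuccAbove m 0).symm).lintegral_comp_emb
      (MeasurableEquiv.measurableEmbedding _)]
    simp_rw [MeasurableEquiv.piFinSuccAbove_symm_apply, Fin.insertNthEquiv,
      Fin.prod_univ_succ, Fin.insertNth_zero, Equiv.coe_fn_mk, Fin.cons_succ,
      Fin.zero_succAbove, cast_eq, Fin.cons_zero]
    rw [lintegral_prod_mul (f := f 0) (g := fun y : Fin n → ℝ => ∏ i, f i.succ (y i))
      (hf 0).aemeasurable]
    · rw [ih fun i => hf i.succ]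
    · refine Measurable.aemeasurable (Finset.measurable_fun_prod _ fun i _ => ?_)
      exact (hf _).comp (measurable_pi_apply i)

theorem pi_withDensity {n : ℕ} {m : Measure ℝ} [SigmaFinite m] {f : ℝ → ℝ≥0∞} (hf : Measurable f)
    (hfin : IsFiniteMeasure (m.withDensity f)) :
    Measure.pi (fun _ : Fin n => m.withDensity f) =
      (Measure.pi fun _ : Fin n => m).withDensity fun x => ∏ i, f (x i) := by
  refine Measure.pi_eq fun s hs => ?_
  rw [withDensity_apply _ (MeasurableSet.univ_pi hs), ← lintegral_indicator
    (MeasurableSet.univ_pi hs)]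
  have h1 : ∀ x : Fin n → ℝ, (Set.univ.pi s).indicator (fun x => ∏ i, f (x i)) x
      = ∏ i, (s i).indicator f (x i) := by
    intro x
    by_cases hx : x ∈ Set.univ.pi s
    · rw [Set.indicator_of_mem hx]
      exact Finset.prod_congr rfl fun i _ => (Set.indicator_of_mem (hx i (Set.mem_univ i)) f).symm
    · rw [Set.indicator_of_notMem hx]
      simp only [Set.mem_pi, Set.mem_univ, forall_const, not_forall] at hx
      obtain ⟨i, hi⟩ := hx
      exact (Finset.prod_eq_zero (Finset.mem_univ i) (Set.indicator_of_notMem hi f)).symm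
  simp_rw [h1]
  rw [lintegral_pi_prod fun i => hf.indicator (hs i)]
  refine Finset.prod_congr rfl fun i _ => ?_
  rw [lintegral_indicator (hs i), withDensity_apply _ (hs i)]

theorem map_pair_pi {n : ℕ} (m : Measure ℝ) [IsProbabilityMeasure m] {i j : Fin n} (hij : i ≠ j) :
    (Measure.pi fun _ : Fin n => m).map (fun x => (x i, x j)) = m.prod m := by
  have h := iIndepFun_pi (μ := fun _ : Fin n => m) (X := fun _ x => x)
    (fun _ => measurable_id.aemeasurable)
  have h2 := h.indepFun hij
  rw [indepFun_iff_map_prod_eq_prod_map_map (measurable_pi_apply i).aemeasurable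
    (measurable_pi_apply j).aemeasurable] at h2
  rw [h2]
  congr 1
  · exact (measurePreserving_eval (fun _ : Fin n => m) i).map_eq
  · exact (measurePreserving_eval (fun _ : Fin n => m) j).map_eq

theorem integrable_pair_pi {n : ℕ} {m : Measure ℝ} [IsProbabilityMeasure m] {i j : Fin n}
    (hij : i ≠ j) {F : ℝ × ℝ → ℝ} (hF : Integrable F (m.prod m)) :
    Integrable (fun x : Fin n → ℝ => F (x i, x j)) (Measure.pi fun _ => m) ∧
      ∫ x : Fin n → ℝ, F (x i, x j) ∂(Measure.pi fun _ => m) = ∫ q, F q ∂(m.prod m) := by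
  have h := map_pair_pi m hij
  rw [← h] at hF ⊢
  have hm : AEMeasurable (fun x : Fin n → ℝ => (x i, x j)) (Measure.pi fun _ => m) := by fun_prop
  exact ⟨hF.comp_aemeasurable hm, (integral_map hm hF.1).symm⟩

/-! ### The Gibbs measures -/

/-- The double sum `∑_{i, j} g(x_i, x_j)`; the diagonal terms vanish. -/
def pairSum {n : ℕ} (x : Fin n → ℝ) : ℝ := ∑ i, ∑ j, logKernel (x i) (x j)

/-- The interaction `∑_j g(v, y_j)` of one particle with the others. -/
def crossSum {n : ℕ} (v : ℝ) (y : Fin n → ℝ) : ℝ := ∑ j, logKernel v (y j)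

@[fun_prop]
theorem measurable_pairSum {n : ℕ} : Measurable (pairSum : (Fin n → ℝ) → ℝ) := by
  unfold pairSum
  fun_prop

@[fun_prop]
theorem measurable_crossSum {n : ℕ} :
    Measurable (fun q : ℝ × (Fin n → ℝ) => crossSum q.1 q.2) := by
  unfold crossSum
  fun_prop

theorem hamiltonian_eq (V : ℝ → ℝ) (n : ℕ) (β : ℝ) (x : Fin n → ℝ) :
    hamiltonian V n β x = β / 2 * pairSum x + ∑ j, V (x j) := by
  have h : pairSum x = 2 * ∑ i, ∑ j ∈ Finset.Ioi i, logKernel (x i) (x j) := by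
    have h1 : ∀ i, ∑ j, logKernel (x i) (x j) = ∑ j ∈ Finset.Ioi i, logKernel (x i) (x j)
        + ∑ j ∈ Finset.Iio i, logKernel (x i) (x j) := by
      intro i
      have hu : (Finset.univ : Finset (Fin n)) = (Finset.Ioi i ∪ Finset.Iio i) ∪ {i} := by
        ext j
        simp only [Finset.mem_univ, Finset.mem_union, Finset.mem_Ioi, Finset.mem_Iio,
          Finset.mem_singleton, true_iff]
        rcases lt_trichotomy i j with h | h | h
        · exact Or.inl (Or.inl h)
        · exact Or.inr h.symm
        · exact Or.inl (Or.inr h)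
      rw [hu, Finset.sum_union, Finset.sum_union, Finset.sum_singleton, logKernel_self, add_zero]
      · rw [Finset.disjoint_left]
        intro j hj hj'
        exact absurd (Finset.mem_Ioi.1 hj) (not_lt.2 (Finset.mem_Iio.1 hj').le)
      · simp
    have h2 : ∑ i, ∑ j ∈ Finset.Iio i, logKernel (x i) (x j)
        = ∑ i, ∑ j ∈ Finset.Ioi i, logKernel (x i) (x j) := by
      rw [Finset.sum_comm' (t' := Finset.univ) (s' := fun j => Finset.Ioi j) (by simp)]
      exact Finset.sum_congr rfl fun i _ => Finset.sum_congr rfl fun j _ => logKernel_comm _ _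
    unfold pairSum
    simp_rw [h1]
    rw [Finset.sum_add_distrib, h2, two_mul]
  rw [hamiltonian, h]
  ring

@[fun_prop]
theorem measurable_hamiltonian (n : ℕ) (β : ℝ) :
    Measurable (hamiltonian (fun x => x ^ 2) n β) := by
  unfold hamiltonian
  fun_prop

/-- The Gaussian β-ensemble. -/
abbrev gibbs (n : ℕ) (β : ℝ) : Measure (Fin n → ℝ) := gibbsMeasure (fun x => x ^ 2) n β

/-- The unnormalized Gibbs measure. -/
def gibbsWeight (n : ℕ) (β : ℝ) : Measure (Fin n → ℝ) :=
  (volume : Measure (Fin n → ℝ)).withDensity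
    fun x => ENNReal.ofReal (Real.exp (-hamiltonian (fun x => x ^ 2) n β x))

/-- The product of standard Gaussian measures. -/
abbrev gaussPi (n : ℕ) : Measure (Fin n → ℝ) := Measure.pi fun _ => stdGauss

theorem neg_pairSum_le {n : ℕ} (x : Fin n → ℝ) : -pairSum x ≤ 2 * n * ∑ j, theta (x j) := by
  have h : -pairSum x ≤ ∑ i : Fin n, ∑ j : Fin n, (theta (x i) + theta (x j)) := by
    unfold pairSum
    rw [← Finset.sum_neg_distrib]
    refine Finset.sum_le_sum fun i _ => ?_
    rw [← Finset.sum_neg_distrib]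
    exact Finset.sum_le_sum fun j _ => neg_logKernel_le _ _
  refine h.trans_eq ?_
  simp only [Finset.sum_add_distrib, Finset.sum_const, Finset.card_univ, Fintype.card_fin,
    nsmul_eq_mul]
  rw [← Finset.mul_sum]
  ring

theorem exp_neg_hamiltonian_le {n : ℕ} {β : ℝ} (hβ : 0 ≤ β) (x : Fin n → ℝ) :
    Real.exp (-hamiltonian (fun x => x ^ 2) n β x) ≤
      ∏ i, Real.exp (-((x i) ^ 2 - β * n * theta (x i))) := by
  rw [← Real.exp_sum, hamiltonian_eq]
  apply Real.exp_le_exp.2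
  have h := mul_le_mul_of_nonneg_left (neg_pairSum_le x) (show 0 ≤ β / 2 by positivity)
  have h2 : ∑ i, -((x i) ^ 2 - β * n * theta (x i))
      = β * n * ∑ i, theta (x i) - ∑ i, (x i) ^ 2 := by
    rw [Finset.mul_sum, ← Finset.sum_sub_distrib]
    exact Finset.sum_congr rfl fun i _ => by ring
  rw [h2]
  linarith

/-- The bound `log |x - z| ≤ theta x + theta z` decouples the particles. The constant depends on `n`
and `β`, so the result serves only for integrability and null sets, never for asymptotics. -/
theorem gibbsWeight_le {β : ℝ} (hβ : 0 ≤ β) (n : ℕ) : ∃ C : ℝ≥0, gibbsWeight n β ≤ C • gaussPi n := by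
  have hγ : 0 ≤ β * n := by positivity
  set c := Real.exp ((β * n) ^ 2 / 2) * √(2 * Real.pi) with hc
  have hc0 : 0 ≤ c := by positivity
  refine ⟨(c ^ n).toNNReal, ?_⟩
  have hg : gaussPi n = volume.withDensity fun x : Fin n → ℝ =>
      ∏ i, ENNReal.ofReal ((√(2 * Real.pi))⁻¹ * Real.exp (-(x i) ^ 2 / 2)) := by
    have h1 : IsFiniteMeasure (volume.withDensity (fun x : ℝ =>
        ENNReal.ofReal ((√(2 * Real.pi))⁻¹ * Real.exp (-x ^ 2 / 2)))) := by
      rw [← stdGauss_eq]; infer_instance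
    have := pi_withDensity (n := n) (m := volume) (f := fun x : ℝ =>
        ENNReal.ofReal ((√(2 * Real.pi))⁻¹ * Real.exp (-x ^ 2 / 2))) (by fun_prop) h1
    rw [gaussPi, stdGauss_eq, this]
    rfl
  rw [hg, gibbsWeight]
  have h2 : (c ^ n).toNNReal • volume.withDensity (fun x : Fin n → ℝ =>
      ∏ i, ENNReal.ofReal ((√(2 * Real.pi))⁻¹ * Real.exp (-(x i) ^ 2 / 2)))
      = volume.withDensity (ENNReal.ofReal (c ^ n) • fun x : Fin n → ℝ =>
      ∏ i, ENNReal.ofReal ((√(2 * Real.pi))⁻¹ * Real.exp (-(x i) ^ 2 / 2))) :=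
    (withDensity_smul _ (by fun_prop)).symm
  rw [h2]
  refine withDensity_mono (Eventually.of_forall fun x => ?_)
  simp only [Pi.smul_apply, smul_eq_mul]
  rw [← ENNReal.ofReal_prod_of_nonneg (fun i _ => by positivity),
    ← ENNReal.ofReal_mul (by positivity)]
  apply ENNReal.ofReal_le_ofReal
  refine (exp_neg_hamiltonian_le hβ x).trans ?_
  have h3 : c ^ n = ∏ i : Fin n, c := by simp
  rw [h3, ← Finset.prod_mul_distrib]
  refine Finset.prod_le_prod (fun i _ => (Real.exp_pos _).le) fun i _ => ?_
  refine (exp_quadratic_le hγ (x i)).trans_eq ?_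
  rw [hc]
  have : √(2 * Real.pi) ≠ 0 := by positivity
  field_simp

theorem partitionFunction_eq (n : ℕ) (β : ℝ) :
    partitionFunction (fun x => x ^ 2) n β = gibbsWeight n β Set.univ := by
  rw [gibbsWeight, withDensity_apply _ MeasurableSet.univ, setLIntegral_univ, partitionFunction]

theorem partitionFunction_ne_top {β : ℝ} (hβ : 0 ≤ β) (n : ℕ) :
    partitionFunction (fun x => x ^ 2) n β ≠ ∞ := by
  obtain ⟨C, hC⟩ := gibbsWeight_le hβ n
  rw [partitionFunction_eq]
  have : IsFiniteMeasure (gibbsWeight n β) := isFiniteMeasure_of_le _ hC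
  exact measure_ne_top _ _

theorem partitionFunction_ne_zero (n : ℕ) (β : ℝ) :
    partitionFunction (fun x => x ^ 2) n β ≠ 0 := by
  rw [partitionFunction, Ne, lintegral_eq_zero_iff (by fun_prop)]
  intro h
  have h1 : ∀ᵐ x : Fin n → ℝ, False := by
    filter_upwards [h] with x hx
    simp only [Pi.zero_apply, ENNReal.ofReal_eq_zero] at hx
    exact absurd (Real.exp_pos _) (not_lt.2 hx)
  have h2 : (volume : Measure (Fin n → ℝ)) Set.univ = 0 := by
    rw [ae_iff] at h1
    simpa only [not_false_eq_true, Set.ofPred_true] using h1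
  exact isOpen_univ.measure_ne_zero volume Set.univ_nonempty h2

theorem gibbs_eq (n : ℕ) (β : ℝ) :
    gibbs n β = (partitionFunction (fun x => x ^ 2) n β)⁻¹ • gibbsWeight n β := rfl

theorem isProbabilityMeasure_gibbs {β : ℝ} (hβ : 0 ≤ β) (n : ℕ) :
    IsProbabilityMeasure (gibbs n β) := by
  refine ⟨?_⟩
  rw [gibbs_eq, Measure.smul_apply, ← partitionFunction_eq, smul_eq_mul,
    ENNReal.inv_mul_cancel (partitionFunction_ne_zero n β) (partitionFunction_ne_top hβ n)]

/-- The partition function as a real number. -/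
def partitionConst (n : ℕ) (β : ℝ) : ℝ := (partitionFunction (fun x => x ^ 2) n β).toReal

theorem partitionConst_pos {β : ℝ} (hβ : 0 ≤ β) (n : ℕ) : 0 < partitionConst n β :=
  ENNReal.toReal_pos (partitionFunction_ne_zero n β) (partitionFunction_ne_top hβ n)

theorem partitionFunction_eq_ofReal {β : ℝ} (hβ : 0 ≤ β) (n : ℕ) :
    partitionFunction (fun x => x ^ 2) n β = ENNReal.ofReal (partitionConst n β) :=
  (ENNReal.ofReal_toReal (partitionFunction_ne_top hβ n)).symm

theorem gibbs_eq_ofReal {β : ℝ} (hβ : 0 ≤ β) (n : ℕ) :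
    gibbs n β = ENNReal.ofReal (partitionConst n β)⁻¹ • gibbsWeight n β := by
  rw [gibbs_eq, partitionFunction_eq_ofReal hβ, ENNReal.ofReal_inv_of_pos (partitionConst_pos hβ n)]

theorem gibbs_le {β : ℝ} (hβ : 0 ≤ β) (n : ℕ) : ∃ C : ℝ≥0, gibbs n β ≤ C • gaussPi n := by
  obtain ⟨C, hC⟩ := gibbsWeight_le hβ n
  refine ⟨(partitionConst n β)⁻¹.toNNReal * C, ?_⟩
  rw [gibbs_eq_ofReal hβ, mul_smul]
  exact Measure.le_iff.2 fun s hs => by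
    simp only [Measure.smul_apply]
    exact mul_le_mul_right (hC s) _

theorem integrable_gibbs {β : ℝ} (hβ : 0 ≤ β) {n : ℕ} {F : (Fin n → ℝ) → ℝ}
    (hF : Integrable F (gaussPi n)) : Integrable F (gibbs n β) := by
  obtain ⟨C, hC⟩ := gibbs_le hβ n
  exact hF.smul_measure_nnreal.mono_measure hC

theorem gibbs_absolutelyContinuous {β : ℝ} (hβ : 0 ≤ β) (n : ℕ) : gibbs n β ≪ gaussPi n := by
  obtain ⟨C, hC⟩ := gibbs_le hβ n
  exact (Measure.absolutelyContinuous_of_le hC).trans Measure.smul_absolutelyContinuous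

theorem integrable_sum_gaussPi {n : ℕ} {f : ℝ → ℝ} (hf : Integrable f stdGauss) :
    Integrable (fun x : Fin n → ℝ => ∑ i, f (x i)) (gaussPi n) :=
  integrable_finsetSum _ fun _ _ => integrable_comp_eval (μ := fun _ : Fin n => stdGauss) hf

theorem integrable_logKernel_pi {n : ℕ} {m : Measure ℝ} [IsProbabilityMeasure m]
    (hm : Integrable (fun q : ℝ × ℝ => logKernel q.1 q.2) (m.prod m)) (i j : Fin n) :
    Integrable (fun x : Fin n → ℝ => logKernel (x i) (x j)) (Measure.pi fun _ => m) := by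
  rcases eq_or_ne i j with rfl | h
  · simp [logKernel_self]
  · exact (integrable_pair_pi h hm).1

theorem integrable_pairSum_pi {n : ℕ} {m : Measure ℝ} [IsProbabilityMeasure m]
    (hm : Integrable (fun q : ℝ × ℝ => logKernel q.1 q.2) (m.prod m)) :
    Integrable (fun x : Fin n → ℝ => pairSum x) (Measure.pi fun _ => m) :=
  integrable_finsetSum _ fun i _ => integrable_finsetSum _ fun j _ => integrable_logKernel_pi hm i j

theorem ae_injective_gaussPi (n : ℕ) : ∀ᵐ x ∂(gaussPi n), Function.Injective x := by
  have h : ∀ i j : Fin n, ∀ᵐ x ∂(gaussPi n), i ≠ j → x i ≠ x j := by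
    intro i j
    by_cases hij : i = j
    · simp [hij]
    · have h1 := GaussDominated.stdGauss.ae_ne stdGauss
      rw [← map_pair_pi stdGauss hij] at h1
      filter_upwards [ae_of_ae_map (by fun_prop) h1] with x hx _ using hx
  have h2 : ∀ᵐ x ∂(gaussPi n), ∀ i j : Fin n, i ≠ j → x i ≠ x j :=
    ae_all_iff.2 fun i => ae_all_iff.2 fun j => h i j
  filter_upwards [h2] with x hx i j hij
  by_contra hne
  exact hx i j hne hij

/-! ### Removing one particle -/

/-- The splitting of a configuration into the `k`-th particle and the others. -/
abbrev splitAt {n : ℕ} (k : Fin (n + 1)) : (Fin (n + 1) → ℝ) ≃ᵐ ℝ × (Fin n → ℝ) :=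
  MeasurableEquiv.piFinSuccAbove (fun _ => ℝ) k

theorem splitAt_apply {n : ℕ} (k : Fin (n + 1)) (x : Fin (n + 1) → ℝ) :
    splitAt k x = (x k, fun j => x (k.succAbove j)) := rfl

theorem pairSum_splitAt {n : ℕ} (k : Fin (n + 1)) (x : Fin (n + 1) → ℝ) :
    pairSum x = pairSum (splitAt k x).2 + 2 * crossSum (splitAt k x).1 (splitAt k x).2 := by
  simp only [splitAt_apply, pairSum, crossSum]
  rw [Fin.sum_univ_succAbove _ k]
  simp_rw [Fin.sum_univ_succAbove (fun j => logKernel _ (x j)) k]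
  rw [logKernel_self, Finset.sum_add_distrib]
  simp_rw [logKernel_comm _ (x k)]
  ring

theorem hamiltonian_splitAt {n : ℕ} (β : ℝ) (k : Fin (n + 1)) (x : Fin (n + 1) → ℝ) :
    hamiltonian (fun x => x ^ 2) (n + 1) β x = hamiltonian (fun x => x ^ 2) n β (splitAt k x).2
      + (β * crossSum (splitAt k x).1 (splitAt k x).2 + (splitAt k x).1 ^ 2) := by
  rw [hamiltonian_eq, hamiltonian_eq, pairSum_splitAt k x, Fin.sum_univ_succAbove _ k]
  simp only [splitAt_apply]
  ring

theorem map_splitAt_gibbsWeight {n : ℕ} (β : ℝ) (k : Fin (n + 1)) :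
    (gibbsWeight (n + 1) β).map (splitAt k) =
      ((volume : Measure ℝ).prod (gibbsWeight n β)).withDensity
        fun q => ENNReal.ofReal (Real.exp (-(β * crossSum q.1 q.2) - q.1 ^ 2)) := by
  have hsf : SigmaFinite (gibbsWeight n β) := by
    unfold gibbsWeight
    exact SigmaFinite.withDensity_of_ne_top (Eventually.of_forall fun x => ENNReal.ofReal_ne_top)
  refine Measure.ext_of_lintegral _ fun F hF => ?_
  have hd : (volume : Measure ℝ).prod (gibbsWeight n β) =
      ((volume : Measure ℝ).prod (volume : Measure (Fin n → ℝ))).withDensity fun q =>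
        ENNReal.ofReal (Real.exp (-hamiltonian (fun x => x ^ 2) n β q.2)) := by
    rw [gibbsWeight, prod_withDensity_right (by fun_prop)]
  have hmp : MeasurePreserving (splitAt k) (volume : Measure (Fin (n + 1) → ℝ))
      ((volume : Measure ℝ).prod (volume : Measure (Fin n → ℝ))) :=
    volume_preserving_piFinSuccAbove (fun _ : Fin (n + 1) => ℝ) k
  have hFe : Measurable fun x => F (splitAt k x) := hF.comp (splitAt k).measurable
  rw [lintegral_map hF (splitAt k).measurable, gibbsWeight,
    lintegral_withDensity_eq_lintegral_mul _ (by fun_prop) hFe,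
    lintegral_withDensity_eq_lintegral_mul _ (by fun_prop) hF, hd,
    lintegral_withDensity_eq_lintegral_mul _ (by fun_prop) (by fun_prop),
    ← hmp.lintegral_comp_emb
      (MeasurableEquiv.measurableEmbedding _)]
  refine lintegral_congr fun x => ?_
  simp only [Pi.mul_apply]
  rw [← mul_assoc, ← ENNReal.ofReal_mul (Real.exp_pos _).le, ← Real.exp_add,
    hamiltonian_splitAt β k x]
  congr 3
  ring

end LogGas

end

/-! ### Comparison of the ensemble with the product of self-consistent measures. -/

noncomputable section

namespace LogGas

/-! ### Exponential inequalities -/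

theorem exp_integral_le_integral_exp {Ω : Type*} [MeasurableSpace Ω] {P : Measure Ω}
    [IsProbabilityMeasure P] {X : Ω → ℝ} (hX : Integrable X P)
    (he : Integrable (fun ω => Real.exp (X ω)) P) :
    Real.exp (∫ ω, X ω ∂P) ≤ ∫ ω, Real.exp (X ω) ∂P := by
  set a := ∫ ω, X ω ∂P with ha
  have hX' : Integrable (fun ω => X ω - a) P := hX.sub (integrable_const _)
  have h1 : ∫ ω, Real.exp a * (1 + (X ω - a)) ∂P = Real.exp a := by
    rw [integral_const_mul, integral_add (integrable_const _) hX',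
      integral_sub hX (integrable_const _), ← ha]
    simp
  rw [← h1]
  refine integral_mono (((integrable_const _).add (hX.sub (integrable_const _))).const_mul _) he
    fun ω => ?_
  have h2 := Real.add_one_le_exp (X ω - a)
  rw [Real.exp_sub, le_div_iff₀ (Real.exp_pos _)] at h2
  linarith

/-- If `E e^X ≤ 1 + ε` and `E X ≥ -ε` then `e^X` is close to `1` in mean. -/
theorem integral_abs_exp_sub_one_le {Ω : Type*} [MeasurableSpace Ω] {P : Measure Ω}
    [IsProbabilityMeasure P] {X : Ω → ℝ} (hX : Integrable X P)
    (he : Integrable (fun ω => Real.exp (X ω)) P) {ε δ : ℝ} (hδ : 0 < δ)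
    (h1 : ∫ ω, Real.exp (X ω) ∂P ≤ 1 + ε) (h2 : -ε ≤ ∫ ω, X ω ∂P) :
    ∫ ω, |Real.exp (X ω) - 1| ∂P ≤ ε / δ + δ * (2 + ε) := by
  -- With `A = e^{X/2}` one has `|e^X - 1| = |A - 1| (A + 1)` and `(A - 1)² ≤ e^X - X - 1`. Young's
  -- inequality with parameter `δ` separates the two factors.
  have hpt : ∀ ω, |Real.exp (X ω) - 1| ≤
      (Real.exp (X ω) - X ω - 1) / (2 * δ) + δ * (Real.exp (X ω) + 1) := by
    intro ω
    set A := Real.exp (X ω / 2) with hA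
    have hA0 : 0 < A := Real.exp_pos _
    have hAA : Real.exp (X ω) = A ^ 2 := by
      rw [hA, ← Real.exp_nat_mul]; congr 1; push_cast; ring
    have hXA : 1 + X ω / 2 ≤ A := by
      have := Real.add_one_le_exp (X ω / 2); linarith
    have h3 : (A - 1) ^ 2 ≤ Real.exp (X ω) - X ω - 1 := by rw [hAA]; nlinarith
    have h4 : (A + 1) ^ 2 ≤ 2 * (Real.exp (X ω) + 1) := by rw [hAA]; nlinarith [sq_nonneg (A - 1)]
    have h5 : |Real.exp (X ω) - 1| = |A - 1| * (A + 1) := by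
      rw [hAA, ← abs_of_pos (show 0 < A + 1 by linarith), ← abs_mul]; ring_nf
    have h6 : |A - 1| * (A + 1) ≤ (A - 1) ^ 2 / (2 * δ) + δ / 2 * (A + 1) ^ 2 := by
      have h7 : (A - 1) ^ 2 / (2 * δ) + δ / 2 * (A + 1) ^ 2 - |A - 1| * (A + 1)
          = (|A - 1| - δ * (A + 1)) ^ 2 / (2 * δ) := by
        rw [← sq_abs (A - 1)]
        field_simp
        ring
      have : 0 ≤ (|A - 1| - δ * (A + 1)) ^ 2 / (2 * δ) := by positivity
      linarith
    have h8 : (A - 1) ^ 2 / (2 * δ) ≤ (Real.exp (X ω) - X ω - 1) / (2 * δ) := by gcongr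
    rw [h5]
    nlinarith
  have hi1 : Integrable (fun ω => Real.exp (X ω) - X ω - 1) P :=
    (he.sub hX).sub (integrable_const _)
  have hi0 : Integrable (fun ω => Real.exp (X ω) - X ω) P := he.sub hX
  have hi2 : Integrable (fun ω => Real.exp (X ω) + 1) P := he.add (integrable_const _)
  have hi3 : Integrable (fun ω => Real.exp (X ω) - 1) P := he.sub (integrable_const _)
  refine (integral_mono hi3.abs ((hi1.div_const _).add (hi2.const_mul _)) hpt).trans ?_
  simp only [Pi.add_apply]
  rw [integral_add (hi1.div_const _) (hi2.const_mul _), integral_div, integral_const_mul,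
    integral_sub hi0 (integrable_const _), integral_sub he hX,
    integral_add he (integrable_const _)]
  simp only [integral_const, probReal_univ, smul_eq_mul, mul_one]
  have h3 : (∫ ω, Real.exp (X ω) ∂P - ∫ ω, X ω ∂P - 1) / (2 * δ) ≤ ε / δ := by
    rw [div_le_div_iff₀ (by positivity) hδ]
    nlinarith
  nlinarith

/-! ### The self-consistent measure -/

/-- A measure dominated by the Gaussian and solving the self-consistent equation. -/
structure SelfConsistent (γ : ℝ) (μ : Measure ℝ) (L : ℝ) : Prop where
  isProbabilityMeasure : IsProbabilityMeasure μ
  gaussDominated : GaussDominated μ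
  isEquilibriumConstant : IsEquilibriumConstant (fun x => x ^ 2) γ μ L

theorem GaussDominated.exists_integral_inv_sqrt_le {m : Measure ℝ} (h : GaussDominated m) :
    ∃ C : ℝ, 0 ≤ C ∧ ∀ x : ℝ,
      Integrable (fun z => (√|x - z|)⁻¹) m ∧ ∫ z, (√|x - z|)⁻¹ ∂m ≤ C := by
  obtain ⟨C, hC0, hC⟩ := h.exists_integral_le
  obtain ⟨D, hD⟩ := LogGas.exists_integral_inv_sqrt_le
  have hD0 : 0 ≤ D := (integral_nonneg fun z => by positivity).trans (hD 0).2
  exact ⟨C * D, by positivity, fun x => ⟨h.integrable (hD x).1,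
    (hC _ (fun z => by positivity) (hD x).1).trans (by gcongr; exact (hD x).2)⟩⟩

/-- The logarithmic energy `∬ g dμ dμ`. -/
def logEnergy (μ : Measure ℝ) : ℝ := ∫ x, potential μ x ∂μ

namespace SelfConsistent

variable {γ L : ℝ} {μ : Measure ℝ} (h : SelfConsistent γ μ L)
include h

theorem pos : 0 < L := h.isEquilibriumConstant.pos

theorem integrable_logKernel (x : ℝ) : Integrable (logKernel x) μ :=
  h.gaussDominated.integrable (integrable_logKernel_stdGauss x)

theorem integrable_theta : Integrable theta μ := h.gaussDominated.integrable integrable_theta_stdGauss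

theorem integrable_logKernel_prod :
    Integrable (fun q : ℝ × ℝ => logKernel q.1 q.2) (μ.prod μ) :=
  h.gaussDominated.integrable_prod h.gaussDominated integrable_logKernel_prod_stdGauss

theorem logEnergy_eq : logEnergy μ = ∫ q, logKernel q.1 q.2 ∂(μ.prod μ) := by
  have := h.isProbabilityMeasure
  rw [integral_prod _ h.integrable_logKernel_prod]
  rfl

theorem measurable_potential : Measurable (potential μ) := by
  have := h.isProbabilityMeasure
  exact LogGas.measurable_potential μ

theorem exists_abs_potential_le : ∃ C : ℝ, ∀ x, |potential μ x| ≤ C + |x| := by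
  have := h.isProbabilityMeasure
  obtain ⟨C, hC0, hC⟩ := h.gaussDominated.exists_integral_inv_sqrt_le
  refine ⟨2 * C + ∫ z, theta z ∂μ, fun x => ?_⟩
  have hθ : 0 ≤ ∫ z, theta z ∂μ := integral_nonneg theta_nonneg
  have h1 : potential μ x ≤ 2 * C := by
    calc potential μ x ≤ ∫ z, 2 * (√|x - z|)⁻¹ ∂μ :=
          integral_mono (h.integrable_logKernel x) ((hC x).1.const_mul 2) fun z => logKernel_le x z
      _ = 2 * ∫ z, (√|x - z|)⁻¹ ∂μ := integral_const_mul _ _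
      _ ≤ 2 * C := by linarith [(hC x).2]
  have h2 : -potential μ x ≤ theta x + ∫ z, theta z ∂μ := by
    calc -potential μ x = ∫ z, -logKernel x z ∂μ := (integral_neg _).symm
      _ ≤ ∫ z, (theta x + theta z) ∂μ := integral_mono (h.integrable_logKernel x).neg
          ((integrable_const _).add h.integrable_theta) fun z => neg_logKernel_le x z
      _ = theta x + ∫ z, theta z ∂μ := by
          rw [integral_add (integrable_const _) h.integrable_theta]; simp
  have h3 := theta_le_abs x
  rw [abs_le]
  constructor <;> linarith [abs_nonneg x]

theorem integrable_potential_stdGauss : Integrable (potential μ) stdGauss := by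
  obtain ⟨C, hC⟩ := h.exists_abs_potential_le
  exact ((integrable_const C).add integrable_abs_stdGauss).mono'
    h.measurable_potential.aestronglyMeasurable (Eventually.of_forall hC)

theorem integrable_potential : Integrable (potential μ) μ :=
  h.gaussDominated.integrable h.integrable_potential_stdGauss

theorem integrable_exp_mul_potential (s : ℝ) :
    Integrable (fun x => Real.exp (s * potential μ x)) μ := by
  obtain ⟨C, hC⟩ := h.exists_abs_potential_le
  have hm := h.measurable_potential
  refine h.gaussDominated.integrable (((integrable_exp_mul_abs_stdGauss |s|).const_mul
    (Real.exp (|s| * C))).mono' (by fun_prop) (Eventually.of_forall fun x => ?_))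
  rw [Real.norm_of_nonneg (Real.exp_pos _).le, ← Real.exp_add]
  apply Real.exp_le_exp.2
  have := mul_le_mul_of_nonneg_left (hC x) (abs_nonneg s)
  have h2 := le_abs_self (s * potential μ x)
  rw [abs_mul] at h2
  linarith

/-- The density of the self-consistent measure. -/
theorem eq_withDensity : μ = volume.withDensity fun x =>
    ENNReal.ofReal (L⁻¹ * Real.exp (-(γ * potential μ x) - x ^ 2)) :=
  h.isEquilibriumConstant.equation

/-! ### The Gibbs measure relative to the product of self-consistent measures -/

/-- The self-consistent equation absorbs the confinement into `μ`. What remains is the pair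
interaction against the counterterm `γ ∑ U`, which nearly balance when `β n ≈ γ`. -/
theorem gibbsWeight_eq (n : ℕ) (β : ℝ) : gibbsWeight n β =
    ENNReal.ofReal (L ^ n) • (Measure.pi fun _ : Fin n => μ).withDensity fun x =>
      ENNReal.ofReal (Real.exp (-(β / 2 * pairSum x) + γ * ∑ i, potential μ (x i))) := by
  have hp := h.isProbabilityMeasure
  have hm := h.measurable_potential
  have hL := h.pos
  have h1 : (Measure.pi fun _ : Fin n => μ) = volume.withDensity fun x : Fin n → ℝ =>
      ∏ i, ENNReal.ofReal (L⁻¹ * Real.exp (-(γ * potential μ (x i)) - (x i) ^ 2)) := by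
    have h2 := pi_withDensity (n := n) (m := volume) (f := fun x =>
      ENNReal.ofReal (L⁻¹ * Real.exp (-(γ * potential μ x) - x ^ 2))) (by fun_prop)
      (by rw [← h.eq_withDensity]; infer_instance)
    rw [← h.eq_withDensity] at h2
    exact h2
  rw [h1, ← withDensity_mul _ (by fun_prop) (by fun_prop), ← withDensity_smul _ (by fun_prop),
    gibbsWeight]
  congr 1
  ext x
  simp only [Pi.smul_apply, Pi.mul_apply, smul_eq_mul]
  rw [← ENNReal.ofReal_prod_of_nonneg (fun i _ => by positivity), ← ENNReal.ofReal_mul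
    (Finset.prod_nonneg fun i _ => by positivity), ← ENNReal.ofReal_mul (by positivity)]
  congr 1
  rw [Finset.prod_mul_distrib, Finset.prod_const, Finset.card_univ, Fintype.card_fin,
    ← Real.exp_sum, mul_assoc, ← mul_assoc (L ^ n), ← mul_pow, mul_inv_cancel₀ hL.ne', one_pow,
    one_mul, ← Real.exp_add, hamiltonian_eq, Finset.sum_sub_distrib, Finset.sum_neg_distrib,
    ← Finset.mul_sum]
  congr 1
  ring

theorem integrable_weight {β : ℝ} (hβ : 0 ≤ β) (n : ℕ) :
    Integrable (fun x : Fin n → ℝ => Real.exp (-(β / 2 * pairSum x)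
      + γ * ∑ i, potential μ (x i))) (Measure.pi fun _ => μ) ∧
    L ^ n * ∫ x : Fin n → ℝ, Real.exp (-(β / 2 * pairSum x)
      + γ * ∑ i, potential μ (x i)) ∂(Measure.pi fun _ => μ) = partitionConst n β := by
  have hp := h.isProbabilityMeasure
  have hm := h.measurable_potential
  have hL := h.pos
  have h1 := partitionFunction_eq n β
  rw [h.gibbsWeight_eq, Measure.smul_apply, withDensity_apply _ MeasurableSet.univ,
    setLIntegral_univ, smul_eq_mul] at h1
  have h2 : ∫⁻ x : Fin n → ℝ, ENNReal.ofReal (Real.exp (-(β / 2 * pairSum x)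
      + γ * ∑ i, potential μ (x i))) ∂(Measure.pi fun _ => μ) ≠ ∞ := by
    intro h3
    rw [h3, ENNReal.mul_top (by simpa using pow_pos hL n)] at h1
    exact partitionFunction_ne_top hβ n h1
  refine ⟨⟨by fun_prop, ?_⟩, ?_⟩
  · rw [hasFiniteIntegral_iff_ofReal (Eventually.of_forall fun x => (Real.exp_pos _).le)]
    exact h2.lt_top
  · rw [partitionConst, h1, ENNReal.toReal_mul, ENNReal.toReal_ofReal (by positivity),
      integral_eq_lintegral_of_nonneg_ae (Eventually.of_forall fun x => (Real.exp_pos _).le)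
      (by fun_prop)]

theorem integral_gibbs {β : ℝ} (hβ : 0 ≤ β) (n : ℕ) (F : (Fin n → ℝ) → ℝ) :
    ∫ x, F x ∂(gibbs n β) = L ^ n / partitionConst n β * ∫ x : Fin n → ℝ,
      Real.exp (-(β / 2 * pairSum x) + γ * ∑ i, potential μ (x i)) * F x
        ∂(Measure.pi fun _ => μ) := by
  have hm := h.measurable_potential
  have hZ := partitionConst_pos hβ n
  have hL := h.pos
  rw [gibbs_eq_ofReal hβ, h.gibbsWeight_eq, integral_smul_measure, integral_smul_measure,
    integral_withDensity_eq_integral_toReal_smul (by fun_prop)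
    (Eventually.of_forall fun z => ENNReal.ofReal_lt_top)]
  simp only [ENNReal.toReal_ofReal (Real.exp_pos _).le, smul_eq_mul]
  rw [ENNReal.toReal_ofReal (by positivity), ENNReal.toReal_ofReal (by positivity)]
  ring

theorem integrable_gibbs_iff {β : ℝ} (hβ : 0 ≤ β) (n : ℕ) (F : (Fin n → ℝ) → ℝ) :
    Integrable F (gibbs n β) ↔ Integrable (fun x : Fin n → ℝ =>
      Real.exp (-(β / 2 * pairSum x) + γ * ∑ i, potential μ (x i)) * F x)
        (Measure.pi fun _ => μ) := by
  have hm := h.measurable_potential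
  have hZ := partitionConst_pos hβ n
  have hL := h.pos
  rw [gibbs_eq_ofReal hβ, h.gibbsWeight_eq, integrable_smul_measure (by simpa using hZ)
    ENNReal.ofReal_ne_top, integrable_smul_measure (by simpa using pow_pos hL n)
    ENNReal.ofReal_ne_top, integrable_withDensity_iff_integrable_smul' (by fun_prop)
    (Eventually.of_forall fun z => ENNReal.ofReal_lt_top)]
  simp only [ENNReal.toReal_ofReal (Real.exp_pos _).le, smul_eq_mul]

theorem integrable_sum_potential {β : ℝ} (hβ : 0 ≤ β) (n : ℕ) :
    Integrable (fun x : Fin n → ℝ => ∑ i, potential μ (x i)) (gibbs n β) :=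
  integrable_gibbs hβ (integrable_sum_gaussPi h.integrable_potential_stdGauss)

/-- Jensen under the product measure. The factor `n (n - 1)` appears because diagonal terms of
`pairSum` vanish. -/
theorem exp_le_partitionConst {β : ℝ} (hβ : 0 ≤ β) (n : ℕ) :
    Real.exp (-(β / 2 * (n * (n - 1)) * logEnergy μ) + γ * n * logEnergy μ) ≤
      partitionConst n β / L ^ n := by
  have hp := h.isProbabilityMeasure
  have hL := h.pos
  obtain ⟨h1, h2⟩ := h.integrable_weight hβ n
  rw [← h2, mul_div_cancel_left₀ _ (pow_pos hL n).ne']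
  have hpot : ∀ i : Fin n, Integrable (fun x : Fin n → ℝ => potential μ (x i))
      (Measure.pi fun _ => μ) := fun i => integrable_comp_eval (μ := fun _ : Fin n => μ)
        h.integrable_potential
  have hsum : Integrable (fun x : Fin n → ℝ => ∑ i, potential μ (x i)) (Measure.pi fun _ => μ) :=
    integrable_finsetSum _ fun i _ => hpot i
  have hpair := integrable_pairSum_pi (n := n) h.integrable_logKernel_prod
  have e1 : ∫ x : Fin n → ℝ, ∑ i, potential μ (x i) ∂(Measure.pi fun _ => μ)
      = n * logEnergy μ := by
    rw [integral_finsetSum _ fun i _ => hpot i]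
    simp_rw [integral_comp_eval (μ := fun _ : Fin n => μ)
      h.measurable_potential.aestronglyMeasurable]
    simp [logEnergy]
  have e2 : ∫ x : Fin n → ℝ, pairSum x ∂(Measure.pi fun _ => μ)
      = n * (n - 1) * logEnergy μ := by
    have h3 : ∀ i j : Fin n, ∫ x : Fin n → ℝ, logKernel (x i) (x j) ∂(Measure.pi fun _ => μ)
        = logEnergy μ - if i = j then logEnergy μ else 0 := by
      intro i j
      split_ifs with hij
      · subst hij; simp [logKernel_self]
      · rw [sub_zero, h.logEnergy_eq]
        exact (integrable_pair_pi hij h.integrable_logKernel_prod).2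
    unfold pairSum
    rw [integral_finsetSum _ fun i _ => integrable_finsetSum _ fun j _ =>
      integrable_logKernel_pi h.integrable_logKernel_prod i j]
    simp_rw [integral_finsetSum _ fun j _ =>
      integrable_logKernel_pi h.integrable_logKernel_prod _ j, h3]
    simp [Finset.sum_sub_distrib]
    ring
  have h4 := exp_integral_le_integral_exp ((hpair.const_mul (β / 2)).neg.add (hsum.const_mul γ)) h1
  refine le_trans (Real.exp_le_exp.2 (le_of_eq ?_)) h4
  simp only [Pi.add_apply, Pi.neg_apply]
  have hn : Integrable (fun x : Fin n → ℝ => -(β / 2 * pairSum x)) (Measure.pi fun _ => μ) :=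
    (hpair.const_mul (β / 2)).neg
  rw [integral_add hn (hsum.const_mul γ), integral_neg, integral_const_mul,
    integral_const_mul, e1, e2]
  ring

/-! ### A lower bound for the interaction energy -/

/-- Positivity of the regularized form at the difference of the empirical measure and `μ`.
Regularization gives the atoms finite self-energy; passing back to `logKernel` off the diagonal only
increases the energy, provided the points are distinct. -/
theorem exists_pairSum_ge : ∃ C : ℝ, ∀ (n : ℕ), 1 ≤ n → ∀ x : Fin n → ℝ, Function.Injective x →
    2 * n * ∑ i, potential μ (x i) - (n : ℝ) ^ 2 * logEnergy μ - n * (C + 4 * Real.log n)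
      ≤ pairSum x := by
  have hp := h.isProbabilityMeasure
  obtain ⟨C, hC0, hC⟩ := h.gaussDominated.exists_integral_inv_sqrt_le
  refine ⟨4 * C, fun n hn x hx => ?_⟩
  have hn0 : (0 : ℝ) < n := by exact_mod_cast hn
  have hn1 : (1 : ℝ) ≤ n := by exact_mod_cast hn
  -- With `η = n^{-4}` the self-energies total `4 n log n`, while the error in the cross term is of
  -- order `n² √η`, a constant.
  set η : ℝ := ((n : ℝ)⁻¹ ^ 2) ^ 2 with hη
  have hη0 : 0 < η := by positivity
  have hη1 : η ≤ 1 := pow_le_one₀ (by positivity) (pow_le_one₀ (by positivity)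
    (inv_le_one_of_one_le₀ hn1))
  have hsη : √η = (n : ℝ)⁻¹ ^ 2 := Real.sqrt_sq (by positivity)
  have hlη : Real.log η = -(4 * Real.log n) := by
    rw [hη, Real.log_pow, Real.log_pow, Real.log_inv]; push_cast; ring
  set e : Measure ℝ := (n : ℝ≥0∞)⁻¹ • ∑ i, Measure.dirac (x i) with he
  have hint : ∀ F : ℝ → ℝ, Measurable F → Integrable F e ∧ ∫ y, F y ∂e = (n : ℝ)⁻¹ * ∑ i, F (x i) := by
    intro F hF
    have h1 : ∀ i ∈ Finset.univ, Integrable F (Measure.dirac (x i)) := fun i _ =>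
      integrable_dirac (by simp)
    refine ⟨Integrable.smul_measure (integrable_finsetSum_measure.2 h1)
      (by simp; omega), ?_⟩
    rw [he, integral_smul_measure, integral_finsetSum_measure h1]
    simp [integral_dirac]
  have hep : IsProbabilityMeasure e := by
    refine ⟨?_⟩
    rw [he, Measure.smul_apply, Measure.finsetSum_apply]
    simp only [measure_univ, Finset.sum_const, Finset.card_univ, Fintype.card_fin, nsmul_eq_mul,
      mul_one, smul_eq_mul]
    exact ENNReal.inv_mul_cancel (by simp; omega) (by simp)
  have hθe := (hint theta measurable_theta).1
  have hreg := regKernel_form_nonneg hθe h.integrable_theta hη0 hη1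
  have hri : ∀ y, Integrable (fun z => regKernel η y z) μ := by
    intro y
    refine (((integrable_const (theta y)).add h.integrable_theta).add
      (integrable_const (-Real.log η))).mono' ?_ (Eventually.of_forall fun z => ?_)
    · exact Measurable.aestronglyMeasurable (by unfold regKernel; fun_prop)
    have h1 := neg_regKernel_le hη0 hη1 y z
    have h2 := regKernel_le hη0 y z
    have h3 := Real.log_nonpos hη0.le hη1
    simp only [Real.norm_eq_abs, Pi.add_apply, abs_le]
    constructor <;> linarith [theta_nonneg y, theta_nonneg z]
  have hcross : (n : ℝ)⁻¹ * ∑ i, potential μ (x i) - 2 * √η * C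
      ≤ ∫ q, regKernel η q.1 q.2 ∂(e.prod μ) := by
    rw [integral_prod _ (integrable_regKernel hθe h.integrable_theta hη0 hη1), (hint _ ?_).2]
    · have h1 : ∀ i, potential μ (x i) - 2 * √η * C ≤ ∫ z, regKernel η (x i) z ∂μ := by
        intro i
        have h2 : potential μ (x i) - ∫ z, regKernel η (x i) z ∂μ ≤ 2 * √η * C := by
          rw [potential, ← integral_sub (h.integrable_logKernel _) (hri _)]
          refine (integral_mono ((h.integrable_logKernel _).sub (hri _))
            ((hC (x i)).1.const_mul (2 * √η))
            fun z => logKernel_sub_regKernel_le hη0 hη1 (x i) z).trans ?_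
          rw [integral_const_mul]
          exact mul_le_mul_of_nonneg_left (hC (x i)).2 (by positivity)
        linarith
      have h3 := Finset.sum_le_sum fun i (_ : i ∈ Finset.univ) => h1 i
      rw [Finset.sum_sub_distrib, Finset.sum_const, Finset.card_univ, Fintype.card_fin,
        nsmul_eq_mul] at h3
      have h4 := mul_le_mul_of_nonneg_left h3 (inv_nonneg.2 hn0.le)
      refine le_trans (le_of_eq ?_) h4
      field_simp
    · exact ((measurable_regKernel η).stronglyMeasurable.integral_prod_right' (ν := μ)).measurable
  have hself : ∫ q, regKernel η q.1 q.2 ∂(μ.prod μ) ≤ logEnergy μ := by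
    rw [h.logEnergy_eq]
    refine integral_mono_ae (integrable_regKernel h.integrable_theta h.integrable_theta hη0 hη1)
      h.integrable_logKernel_prod ?_
    filter_upwards [h.gaussDominated.ae_ne μ] with q hq using regKernel_le_logKernel hq
  have hemp : ∫ q, regKernel η q.1 q.2 ∂(e.prod e) ≤
      (n : ℝ)⁻¹ * ((n : ℝ)⁻¹ * (pairSum x + n * (4 * Real.log n))) := by
    rw [integral_prod _ (integrable_regKernel hθe hθe hη0 hη1), (hint _ ?_).2]
    · gcongr
      have h1 : ∀ i, ∫ z, regKernel η (x i) z ∂e = (n : ℝ)⁻¹ * ∑ j, regKernel η (x i) (x j) :=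
        fun i => (hint _ (by unfold regKernel; fun_prop)).2
      simp_rw [h1, ← Finset.mul_sum]
      gcongr
      have h2 : ∀ i j, regKernel η (x i) (x j) ≤ logKernel (x i) (x j)
          + if i = j then 4 * Real.log n else 0 := by
        intro i j
        split_ifs with hij
        · subst hij
          rw [regKernel_self, logKernel_self, hlη]; simp
        · rw [add_zero]
          exact regKernel_le_logKernel (hx.ne hij)
      refine (Finset.sum_le_sum fun i _ => Finset.sum_le_sum fun j _ => h2 i j).trans_eq ?_
      simp [Finset.sum_add_distrib, pairSum]
    · exact ((measurable_regKernel η).stronglyMeasurable.integral_prod_right' (ν := e)).measurable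
  have hfin : 2 * ((n : ℝ)⁻¹ * ∑ i, potential μ (x i) - 2 * √η * C) ≤
      (n : ℝ)⁻¹ * ((n : ℝ)⁻¹ * (pairSum x + n * (4 * Real.log n))) + logEnergy μ := by
    linarith
  have h5 := mul_le_mul_of_nonneg_left hfin (show 0 ≤ (n : ℝ) ^ 2 by positivity)
  rw [hsη] at h5
  have e1 : (n : ℝ) ^ 2 * (2 * ((n : ℝ)⁻¹ * ∑ i, potential μ (x i) - 2 * (n : ℝ)⁻¹ ^ 2 * C))
      = 2 * n * ∑ i, potential μ (x i) - 4 * C := by field_simp; ring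
  have e2 : (n : ℝ) ^ 2 * ((n : ℝ)⁻¹ * ((n : ℝ)⁻¹ * (pairSum x + n * (4 * Real.log n)))
      + logEnergy μ) = pairSum x + n * (4 * Real.log n) + (n : ℝ) ^ 2 * logEnergy μ := by field_simp
  rw [e1, e2] at h5
  nlinarith

end SelfConsistent

end LogGas

end

/-! ### Linear statistics and the insertion of one particle. -/

noncomputable section

namespace LogGas

/-- The mean over the particles of the expected potential. -/
def meanPotential (μ : Measure ℝ) (n : ℕ) (β : ℝ) : ℝ :=
  (∫ x : Fin n → ℝ, ∑ i, potential μ (x i) ∂(gibbs n β)) / n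

/-- The logarithm of the density of the law of a configuration with one particle singled out,
relative to the product of `μ` and the law of the other particles, up to a constant. -/
def insertionExponent (γ : ℝ) (μ : Measure ℝ) (β : ℝ) {n : ℕ} (q : ℝ × (Fin n → ℝ)) : ℝ :=
  γ * potential μ q.1 - β * crossSum q.1 q.2

/-- The ratio `L Z_n / Z_{n+1}`. -/
def partitionRatio (L : ℝ) (n : ℕ) (β : ℝ) : ℝ :=
  L * partitionConst n β / partitionConst (n + 1) β

theorem integrable_pairSum_gibbs {β : ℝ} (hβ : 0 ≤ β) (n : ℕ) :
    Integrable (pairSum : (Fin n → ℝ) → ℝ) (gibbs n β) :=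
  integrable_gibbs hβ (integrable_pairSum_pi integrable_logKernel_prod_stdGauss)

theorem ae_injective_gibbs {β : ℝ} (hβ : 0 ≤ β) (n : ℕ) :
    ∀ᵐ x ∂(gibbs n β), Function.Injective x :=
  (gibbs_absolutelyContinuous hβ n).ae_le (ae_injective_gaussPi n)

theorem map_splitAt_gibbs {β : ℝ} (hβ : 0 ≤ β) {n : ℕ} (k : Fin (n + 1)) :
    (gibbs (n + 1) β).map (splitAt k) =
      ENNReal.ofReal (partitionConst n β / partitionConst (n + 1) β) •
        ((volume : Measure ℝ).prod (gibbs n β)).withDensity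
          fun q => ENNReal.ofReal (Real.exp (-(β * crossSum q.1 q.2) - q.1 ^ 2)) := by
  have hZ := partitionConst_pos hβ n
  have hZ' := partitionConst_pos hβ (n + 1)
  have hfin : IsFiniteMeasure (gibbsWeight n β) :=
    isFiniteMeasure_of_le _ (gibbsWeight_le hβ n).choose_spec
  rw [gibbs_eq_ofReal hβ (n + 1), gibbs_eq_ofReal hβ n, Measure.map_smul,
    map_splitAt_gibbsWeight, Measure.prod_smul_right, withDensity_smul_measure, smul_smul,
    ← ENNReal.ofReal_mul (by positivity)]
  congr 2
  field_simp

theorem map_splitAt_gaussPi {n : ℕ} (k : Fin (n + 1)) :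
    (gaussPi (n + 1)).map (splitAt k) = stdGauss.prod (gaussPi n) :=
  (measurePreserving_piFinSuccAbove (fun _ : Fin (n + 1) => stdGauss) k).map_eq

theorem integrable_crossSum_prod {m : Measure ℝ} (hm : GaussDominated m) {β : ℝ} (hβ : 0 ≤ β)
    (n : ℕ) : Integrable (fun q : ℝ × (Fin n → ℝ) => crossSum q.1 q.2) (m.prod (gibbs n β)) := by
  have h1 : Integrable (fun q : ℝ × (Fin n → ℝ) => crossSum q.1 q.2)
      (stdGauss.prod (gaussPi n)) := by
    rw [← map_splitAt_gaussPi (0 : Fin (n + 1)), integrable_map_equiv]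
    have h2 : Integrable (fun x : Fin (n + 1) → ℝ => ∑ j : Fin n, logKernel (x 0)
        (x (Fin.succAbove 0 j))) (gaussPi (n + 1)) := integrable_finsetSum _ fun j _ =>
      integrable_logKernel_pi integrable_logKernel_prod_stdGauss (0 : Fin (n + 1)) _
    exact h2
  have := isProbabilityMeasure_gibbs hβ n
  obtain ⟨C, hC⟩ := hm
  obtain ⟨C', hC'⟩ := gibbs_le hβ n
  have h2 : m.prod (gibbs n β) ≤ (C • stdGauss).prod (C' • gaussPi n) := Measure.prod_mono hC hC'
  have h3 : (C • stdGauss).prod (C' • gaussPi n) = (C * C') • (stdGauss.prod (gaussPi n)) := by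
    ext s hs
    simp only [Measure.prod_smul_left, Measure.prod_smul_right, smul_smul, mul_comm]
  rw [h3] at h2
  exact h1.smul_measure_nnreal.mono_measure h2

namespace SelfConsistent

variable {γ L : ℝ} {μ : Measure ℝ} (h : SelfConsistent γ μ L)
include h

/-! ### The entropy inequality -/

/-- An entropy bound for linear statistics of the Gibbs measure. -/
theorem exists_linear_statistic_le : ∃ C : ℝ, ∀ (n : ℕ), 1 ≤ n → ∀ β : ℝ, 0 ≤ β →
    2 * (n : ℝ) ^ 2 * meanPotential μ n β - (n : ℝ) ^ 2 * logEnergy μ - n * (C + 4 * Real.log n)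
      ≤ ∫ x, pairSum x ∂(gibbs n β) ∧
    ∀ f : ℝ → ℝ, Integrable f stdGauss → Integrable (fun x => Real.exp (f x)) μ →
      (∫ x : Fin n → ℝ, ∑ i, f (x i) ∂(gibbs n β)) / n ≤ Real.log (∫ x, Real.exp (f x) ∂μ)
        + (γ - β * n) * (meanPotential μ n β - logEnergy μ)
        + β / 2 * (C + 4 * Real.log n - logEnergy μ) := by
  have hp := h.isProbabilityMeasure
  have hL := h.pos
  obtain ⟨C, hC⟩ := h.exists_pairSum_ge
  refine ⟨C, fun n hn β hβ => ?_⟩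
  have hn0 : (0 : ℝ) < n := by exact_mod_cast hn
  have hP := isProbabilityMeasure_gibbs hβ n
  have hZ := partitionConst_pos hβ n
  have hpair := integrable_pairSum_gibbs hβ n
  have hpot := h.integrable_sum_potential hβ n
  have hu : ∫ x : Fin n → ℝ, ∑ i, potential μ (x i) ∂(gibbs n β) = n * meanPotential μ n β := by
    rw [meanPotential]; field_simp
  have hE : 2 * (n : ℝ) ^ 2 * meanPotential μ n β - (n : ℝ) ^ 2 * logEnergy μ
      - n * (C + 4 * Real.log n) ≤ ∫ x, pairSum x ∂(gibbs n β) := by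
    have h1 : ∫ x : Fin n → ℝ, (2 * n * ∑ i, potential μ (x i) - ((n : ℝ) ^ 2 * logEnergy μ
        + n * (C + 4 * Real.log n))) ∂(gibbs n β) ≤ ∫ x, pairSum x ∂(gibbs n β) := by
      refine integral_mono_ae ((hpot.const_mul _).sub (integrable_const _)) hpair ?_
      filter_upwards [ae_injective_gibbs hβ n] with x hx
      linarith [hC n hn x hx]
    rw [integral_sub (hpot.const_mul _) (integrable_const _), integral_const_mul, hu] at h1
    simp only [integral_const, probReal_univ, smul_eq_mul, one_mul] at h1
    linarith
  refine ⟨hE, fun f hf hef => ?_⟩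
  have hfs : Integrable (fun x : Fin n → ℝ => ∑ i, f (x i)) (gibbs n β) :=
    integrable_gibbs hβ (integrable_sum_gaussPi hf)
  -- `W` is the log-density relative to `μ^⊗n`, up to a constant. Jensen for `e^{∑ f - W}` under the
  -- ensemble is the entropy inequality. When the bounds on partition function and pair energy are
  -- inserted, the leading terms combine into `(γ - β n) (meanPotential - logEnergy)`.
  set W : (Fin n → ℝ) → ℝ := fun x => -(β / 2 * pairSum x) + γ * ∑ i, potential μ (x i) with hW
  have hWi : Integrable W (gibbs n β) := (hpair.const_mul (β / 2)).neg.add (hpot.const_mul γ)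
  have hWe : ∫ x, W x ∂(gibbs n β) = -(β / 2 * ∫ x, pairSum x ∂(gibbs n β))
      + γ * (n * meanPotential μ n β) := by
    have h1 : Integrable (fun x : Fin n → ℝ => -(β / 2 * pairSum x)) (gibbs n β) :=
      (hpair.const_mul (β / 2)).neg
    rw [hW, integral_add h1 (hpot.const_mul γ), integral_neg, integral_const_mul,
      integral_const_mul, hu]
  have hprod : ∀ x : Fin n → ℝ, Real.exp (W x) * Real.exp (∑ i, f (x i) - W x)
      = ∏ i, Real.exp (f (x i)) := by
    intro x
    rw [← Real.exp_add, ← Real.exp_sum]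
    ring_nf
  have hint : Integrable (fun x : Fin n → ℝ => Real.exp (∑ i, f (x i) - W x)) (gibbs n β) := by
    rw [h.integrable_gibbs_iff hβ]
    refine Integrable.congr (Integrable.fintype_prod (f := fun _ : Fin n => fun x =>
      Real.exp (f x)) (μ := fun _ => μ) fun _ => hef) (Eventually.of_forall fun x => ?_)
    exact (hprod x).symm
  have hval : ∫ x : Fin n → ℝ, Real.exp (∑ i, f (x i) - W x) ∂(gibbs n β)
      = L ^ n / partitionConst n β * (∫ x, Real.exp (f x) ∂μ) ^ n := by
    rw [h.integral_gibbs hβ]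
    congr 1
    rw [integral_congr_ae (Eventually.of_forall hprod),
      integral_fintype_prod_eq_pow (fun x => Real.exp (f x)), Fintype.card_fin]
  have hjen := exp_integral_le_integral_exp (hfs.sub hWi) hint
  simp only [Pi.sub_apply] at hjen
  rw [hval, integral_sub hfs hWi, hWe] at hjen
  have hpos : 0 < ∫ x, Real.exp (f x) ∂μ := integral_exp_pos hef
  have h2 := (Real.log_le_log (Real.exp_pos _) hjen)
  rw [Real.log_exp, Real.log_mul (by positivity) (by positivity), Real.log_pow] at h2
  have h3 := Real.log_le_log (Real.exp_pos _) (h.exp_le_partitionConst hβ n)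
  have h5 : Real.log (L ^ n / partitionConst n β) = -Real.log (partitionConst n β / L ^ n) := by
    rw [← Real.log_inv, inv_div]
  rw [Real.log_exp] at h3
  have h4 := mul_le_mul_of_nonneg_left hE (show 0 ≤ β / 2 by positivity)
  rw [div_le_iff₀ hn0]
  nlinarith

theorem integrable_exp_mul_potential_sub (s : ℝ) :
    Integrable (fun x => Real.exp (s * (potential μ x - logEnergy μ))) μ := by
  refine ((h.integrable_exp_mul_potential s).mul_const (Real.exp (-(s * logEnergy μ)))).congr
    (Eventually.of_forall fun x => ?_)
  simp only
  rw [← Real.exp_add]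
  ring_nf

/-- The cumulant generating function of the centred potential has value and derivative 0 at the
origin, so it is below `c |s|` at small arguments of either sign. -/
theorem exists_log_integral_exp_le {c : ℝ} (hc : 0 < c) : ∃ s : ℝ, 0 < s ∧
    Real.log (∫ x, Real.exp (s * (potential μ x - logEnergy μ)) ∂μ) ≤ c * s ∧
    Real.log (∫ x, Real.exp (-s * (potential μ x - logEnergy μ)) ∂μ) ≤ c * s := by
  have hp := h.isProbabilityMeasure
  set X : ℝ → ℝ := fun x => potential μ x - logEnergy μ with hX
  have hset : integrableExpSet X μ = Set.univ :=
    Set.eq_univ_of_forall fun s => h.integrable_exp_mul_potential_sub s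
  have h0 : (0 : ℝ) ∈ interior (integrableExpSet X μ) := by rw [hset]; simp
  have hd : HasDerivAt (cgf X μ) 0 0 := by
    have h1 := (analyticAt_cgf h0).differentiableAt.hasDerivAt
    rw [deriv_cgf_zero h0] at h1
    have h2 : ∫ x, X x ∂μ = 0 := by
      rw [hX, integral_sub h.integrable_potential (integrable_const _)]
      simp [logEnergy]
    rwa [h2, zero_div] at h1
  have h3 := hd.isLittleO.def hc
  simp only [sub_zero, smul_eq_mul, mul_zero, cgf_zero, Real.norm_eq_abs] at h3
  obtain ⟨δ, hδ, hb⟩ := Metric.eventually_nhds_iff.1 h3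
  refine ⟨δ / 2, by positivity, ?_, ?_⟩
  · have h4 := hb (y := δ / 2) (by rw [Real.dist_eq, sub_zero, abs_of_pos (by positivity)]; linarith)
    rw [abs_of_pos (show 0 < δ / 2 by positivity)] at h4
    exact (le_abs_self _).trans h4
  · have h4 := hb (y := -(δ / 2)) (by
      rw [Real.dist_eq, sub_zero, abs_neg, abs_of_pos (by positivity)]; linarith)
    rw [abs_neg (δ / 2), abs_of_pos (show 0 < δ / 2 by positivity)] at h4
    exact (le_abs_self _).trans h4

end SelfConsistent

/-- Asymptotic form of `integral_abs_exp_sub_one_le`: exponential means tending to 1 and means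
tending to 0 force L¹ convergence. -/
theorem tendsto_zero_of_exp_bound {A a c : ℕ → ℝ} (hA : ∀ n, 0 ≤ A n)
    (ha : Tendsto a atTop (𝓝 1)) (hc : Tendsto c atTop (𝓝 0))
    (hbd : ∀ n, ∀ ε δ : ℝ, 0 < δ → a n ≤ 1 + ε → -ε ≤ c n → A n ≤ ε / δ + δ * (2 + ε)) :
    Tendsto A atTop (𝓝 0) := by
  rw [Metric.tendsto_atTop']
  intro η hη
  -- The two error terms are then at most `η/4` and `3η/8`.
  set δ := η / 8 with hδ
  have hδ0 : 0 < δ := by positivity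
  set ε := min 1 (δ * (η / 4)) with hε
  have hε0 : 0 < ε := lt_min one_pos (by positivity)
  obtain ⟨N, hN⟩ := eventually_atTop.1 ((ha.eventually_le_const (show (1 : ℝ) < 1 + ε by linarith)).and
    (hc.eventually_const_le (show -ε < 0 by linarith)))
  refine ⟨N, fun n hn => ?_⟩
  obtain ⟨h1, h2⟩ := hN n hn.le
  have h3 := hbd n ε δ hδ0 h1 h2
  have h4 : ε / δ ≤ η / 4 := by
    rw [div_le_iff₀ hδ0, mul_comm]
    exact min_le_right _ _
  have h5 : ε ≤ 1 := min_le_left _ _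
  rw [Real.dist_eq, sub_zero, abs_of_nonneg (hA n)]
  nlinarith

/-- Makes the errors `β log N` from the regularized self-energies negligible. -/
theorem tendsto_zero_of_mul_tendsto {b : ℕ → ℝ} {m : ℕ → ℕ} {γ : ℝ} (hm : Tendsto m atTop atTop)
    (hb : Tendsto (fun n => b n * m n) atTop (𝓝 γ)) :
    Tendsto b atTop (𝓝 0) ∧ Tendsto (fun n => b n * Real.log (m n)) atTop (𝓝 0) := by
  have hmr : Tendsto (fun n => (m n : ℝ)) atTop atTop := tendsto_natCast_atTop_atTop.comp hm
  have h0 : ∀ᶠ n in atTop, (m n : ℝ) ≠ 0 := hmr.eventually_ne_atTop 0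
  constructor
  · have h1 := hb.mul (tendsto_inv_atTop_zero.comp hmr)
    rw [mul_zero] at h1
    refine h1.congr' ?_
    filter_upwards [h0] with n hn
    simp only [Function.comp_apply]
    field_simp
  · have h2 : Tendsto (fun x : ℝ => Real.log x / x) atTop (𝓝 0) :=
      Real.isLittleO_log_id_atTop.tendsto_div_nhds_zero
    have h1 := hb.mul (h2.comp hmr)
    rw [mul_zero] at h1
    refine h1.congr' ?_
    filter_upwards [h0] with n hn
    simp only [Function.comp_apply]
    field_simp

namespace SelfConsistent

variable {γ L : ℝ} {μ : Measure ℝ} (h : SelfConsistent γ μ L)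
include h

/-- The entropy inequality is tested with `±s (U - logEnergy)`. For the deviation `D` it gives `s
|D| ≤ sε/4 + |γ - β n| |D| + sε/8`, and the middle term is absorbed once `|γ - β n| < s/2`. -/
theorem tendsto_meanPotential {b : ℕ → ℝ} {m : ℕ → ℕ} (hb0 : ∀ n, 0 ≤ b n)
    (hm : Tendsto m atTop atTop) (hb : Tendsto (fun n => b n * m n) atTop (𝓝 γ)) :
    Tendsto (fun n => meanPotential μ (m n) (b n)) atTop (𝓝 (logEnergy μ)) := by
  have hp := h.isProbabilityMeasure
  obtain ⟨C, hC⟩ := h.exists_linear_statistic_le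
  obtain ⟨hb1, hb2⟩ := tendsto_zero_of_mul_tendsto hm hb
  have herr : Tendsto (fun n => b n / 2 * (C + 4 * Real.log (m n) - logEnergy μ)) atTop (𝓝 0) := by
    have h1 := (hb1.mul_const ((C - logEnergy μ) / 2)).add (hb2.mul_const 2)
    rw [zero_mul, zero_mul, add_zero] at h1
    exact h1.congr fun n => by ring
  rw [Metric.tendsto_atTop']
  intro ε hε
  obtain ⟨s, hs, hs1, hs2⟩ := h.exists_log_integral_exp_le (c := ε / 4) (by positivity)
  have e1 : ∀ᶠ n in atTop, |γ - b n * m n| < s / 2 := by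
    have := (tendsto_const_nhds (x := γ)).sub hb
    rw [sub_self] at this
    have := this.abs
    rw [abs_zero] at this
    exact this.eventually_lt_const (by positivity)
  have e2 := herr.eventually_lt_const (show 0 < s * ε / 8 by positivity)
  obtain ⟨N, hN⟩ := eventually_atTop.1 (e1.and (e2.and (hm.eventually_ge_atTop 1)))
  refine ⟨N, fun n hn => ?_⟩
  obtain ⟨h1, h2, h3⟩ := hN n hn.le
  have hn0 : (0 : ℝ) < m n := by exact_mod_cast h3
  have hP := isProbabilityMeasure_gibbs (hb0 n) (m n)
  have key : ∀ c : ℝ, c * (meanPotential μ (m n) (b n) - logEnergy μ) ≤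
      Real.log (∫ x, Real.exp (c * (potential μ x - logEnergy μ)) ∂μ)
        + (γ - b n * m n) * (meanPotential μ (m n) (b n) - logEnergy μ) + s * ε / 8 := by
    intro c
    have h4 := (hC (m n) h3 (b n) (hb0 n)).2 (fun x => c * (potential μ x - logEnergy μ))
      ((h.integrable_potential_stdGauss.sub (integrable_const _)).const_mul c)
      (h.integrable_exp_mul_potential_sub c)
    have h5 : (∫ x : Fin (m n) → ℝ, ∑ i, c * (potential μ (x i) - logEnergy μ)
        ∂(gibbs (m n) (b n))) / (m n) = c * (meanPotential μ (m n) (b n) - logEnergy μ) := by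
      simp_rw [← Finset.mul_sum, Finset.sum_sub_distrib, Finset.sum_const, Finset.card_univ,
        Fintype.card_fin, nsmul_eq_mul]
      rw [integral_const_mul, integral_sub (h.integrable_sum_potential (hb0 n) _)
        (integrable_const _), meanPotential]
      simp only [integral_const, probReal_univ, smul_eq_mul, one_mul]
      field_simp
    rw [h5] at h4
    linarith
  have k1 := key s
  have k2 := key (-s)
  rw [Real.dist_eq]
  set D := meanPotential μ (m n) (b n) - logEnergy μ with hD
  have h6 : (γ - b n * m n) * D ≤ s / 2 * |D| := by
    calc (γ - b n * m n) * D ≤ |(γ - b n * m n) * D| := le_abs_self _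
      _ = |γ - b n * m n| * |D| := abs_mul _ _
      _ ≤ s / 2 * |D| := by gcongr
  rcases abs_cases D with ⟨hD1, _⟩ | ⟨hD1, _⟩
  · rw [hD1] at h6 ⊢
    have : s * D < s * ε ∨ s * ε ≤ s * D := lt_or_ge _ _
    rcases this with h7 | h7
    · exact lt_of_mul_lt_mul_left h7 hs.le
    · nlinarith
  · rw [hD1] at h6 ⊢
    have : s * -D < s * ε ∨ s * ε ≤ s * -D := lt_or_ge _ _
    rcases this with h7 | h7
    · exact lt_of_mul_lt_mul_left h7 hs.le
    · nlinarith

/-! ### Inserting one particle -/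

theorem measurable_insertionExponent (β : ℝ) (n : ℕ) :
    Measurable (insertionExponent γ μ β : ℝ × (Fin n → ℝ) → ℝ) := by
  have := h.measurable_potential
  unfold insertionExponent
  fun_prop

/-- The exact density of `n + 1` particles relative to `μ` times the ensemble of `n` particles at
the same `β`. Showing that this density tends to 1 in L¹ makes consecutive ensembles comparable. -/
theorem map_splitAt_gibbs {β : ℝ} (hβ : 0 ≤ β) {n : ℕ} (k : Fin (n + 1)) :
    (gibbs (n + 1) β).map (splitAt k) = ENNReal.ofReal (partitionRatio L n β) •
      (μ.prod (gibbs n β)).withDensity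
        fun q => ENNReal.ofReal (Real.exp (insertionExponent γ μ β q)) := by
  have hm := h.measurable_potential
  have hmi := h.measurable_insertionExponent β n
  have hL := h.pos
  have hp := h.isProbabilityMeasure
  have hP := isProbabilityMeasure_gibbs hβ n
  have hZ := partitionConst_pos hβ n
  have hZ' := partitionConst_pos hβ (n + 1)
  have h1 : μ.prod (gibbs n β) = ((volume : Measure ℝ).prod (gibbs n β)).withDensity
      fun q => ENNReal.ofReal (L⁻¹ * Real.exp (-(γ * potential μ q.1) - q.1 ^ 2)) := by
    conv_lhs => rw [h.eq_withDensity]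
    rw [prod_withDensity_left (by fun_prop)]
  rw [LogGas.map_splitAt_gibbs hβ k, h1, ← withDensity_mul _ (by fun_prop) (by fun_prop),
    ← withDensity_smul _ (by fun_prop), ← withDensity_smul _ (by fun_prop)]
  congr 1
  ext q
  simp only [Pi.smul_apply, Pi.mul_apply, smul_eq_mul]
  rw [← ENNReal.ofReal_mul (by positivity), ← ENNReal.ofReal_mul (by positivity),
    ← ENNReal.ofReal_mul (by unfold partitionRatio; positivity), mul_assoc L⁻¹, ← Real.exp_add,
    partitionRatio, insertionExponent]
  congr 1
  rw [show -(γ * potential μ q.1) - q.1 ^ 2 + (γ * potential μ q.1 - β * crossSum q.1 q.2)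
    = -(β * crossSum q.1 q.2) - q.1 ^ 2 by ring]
  field_simp

theorem partitionRatio_pos {β : ℝ} (hβ : 0 ≤ β) (n : ℕ) : 0 < partitionRatio L n β := by
  have hZ := partitionConst_pos hβ n
  have hZ' := partitionConst_pos hβ (n + 1)
  have hL := h.pos
  unfold partitionRatio
  positivity

theorem integrable_splitAt_iff {β : ℝ} (hβ : 0 ≤ β) {n : ℕ} (k : Fin (n + 1))
    (G : ℝ × (Fin n → ℝ) → ℝ) :
    Integrable (fun x => G (splitAt k x)) (gibbs (n + 1) β) ↔
      Integrable (fun q => Real.exp (insertionExponent γ μ β q) * G q) (μ.prod (gibbs n β)) := by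
  have hmi := h.measurable_insertionExponent β n
  have hr := h.partitionRatio_pos hβ n
  have h1 := integrable_map_equiv (μ := gibbs (n + 1) β) (splitAt k) G
  rw [h.map_splitAt_gibbs hβ k, integrable_smul_measure (by simpa using hr)
    ENNReal.ofReal_ne_top, integrable_withDensity_iff_integrable_smul' (by fun_prop)
    (Eventually.of_forall fun z => ENNReal.ofReal_lt_top)] at h1
  simp only [ENNReal.toReal_ofReal (Real.exp_pos _).le, smul_eq_mul] at h1
  exact h1.symm

theorem integral_splitAt {β : ℝ} (hβ : 0 ≤ β) {n : ℕ} (k : Fin (n + 1))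
    (G : ℝ × (Fin n → ℝ) → ℝ) :
    ∫ x, G (splitAt k x) ∂(gibbs (n + 1) β) = partitionRatio L n β *
      ∫ q, Real.exp (insertionExponent γ μ β q) * G q ∂(μ.prod (gibbs n β)) := by
  have hmi := h.measurable_insertionExponent β n
  have hr := h.partitionRatio_pos hβ n
  have h1 := integral_map_equiv (μ := gibbs (n + 1) β) (splitAt k) G
  rw [h.map_splitAt_gibbs hβ k, integral_smul_measure,
    integral_withDensity_eq_integral_toReal_smul (by fun_prop)
    (Eventually.of_forall fun z => ENNReal.ofReal_lt_top)] at h1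
  simp only [ENNReal.toReal_ofReal (Real.exp_pos _).le, smul_eq_mul,
    ENNReal.toReal_ofReal hr.le] at h1
  exact h1.symm

theorem integrable_exp_insertionExponent {β : ℝ} (hβ : 0 ≤ β) (n : ℕ) :
    Integrable (fun q : ℝ × (Fin n → ℝ) => Real.exp (insertionExponent γ μ β q))
      (μ.prod (gibbs n β)) ∧
    ∫ q : ℝ × (Fin n → ℝ), Real.exp (insertionExponent γ μ β q) ∂(μ.prod (gibbs n β))
      = (partitionRatio L n β)⁻¹ := by
  have hP := isProbabilityMeasure_gibbs hβ (n + 1)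
  have hr := h.partitionRatio_pos hβ n
  have h1 := (h.integrable_splitAt_iff hβ (0 : Fin (n + 1)) fun _ => 1).1 (integrable_const 1)
  have h2 := h.integral_splitAt hβ (0 : Fin (n + 1)) fun _ => 1
  simp only [mul_one] at h1 h2
  refine ⟨h1, ?_⟩
  simp only [integral_const, probReal_univ, smul_eq_mul, mul_one] at h2
  exact eq_inv_of_mul_eq_one_right h2.symm

theorem integrable_insertionExponent {β : ℝ} (hβ : 0 ≤ β) (n : ℕ) :
    Integrable (insertionExponent γ μ β : ℝ × (Fin n → ℝ) → ℝ) (μ.prod (gibbs n β)) ∧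
    ∫ q : ℝ × (Fin n → ℝ), insertionExponent γ μ β q ∂(μ.prod (gibbs n β))
      = γ * logEnergy μ - β * (n * meanPotential μ n β) := by
  have hp := h.isProbabilityMeasure
  have hP := isProbabilityMeasure_gibbs hβ n
  have h1 : Integrable (fun q : ℝ × (Fin n → ℝ) => potential μ q.1) (μ.prod (gibbs n β)) :=
    h.integrable_potential.comp_fst _
  have h2 := integrable_crossSum_prod h.gaussDominated hβ n
  refine ⟨(h1.const_mul γ).sub (h2.const_mul β), ?_⟩
  unfold insertionExponent
  rw [integral_sub (h1.const_mul γ) (h2.const_mul β), integral_const_mul, integral_const_mul,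
    integral_prod_symm _ h2, integral_fun_fst]
  have h3 : ∀ y : Fin n → ℝ, ∫ v, crossSum v y ∂μ = ∑ i, potential μ (y i) := by
    intro y
    unfold crossSum potential
    rw [integral_finsetSum]
    · simp_rw [logKernel_comm (y _)]
    · intro j _
      simp_rw [logKernel_comm _ (y j)]
      exact h.integrable_logKernel _
  simp only [h3, probReal_univ, one_smul]
  rw [meanPotential, logEnergy]
  rcases Nat.eq_zero_or_pos n with rfl | hn
  · simp
  · field_simp

/-- Under the larger ensemble `e^{-insertionExponent}` has mean `partitionRatio`, and Jensen
applies. Averaging over the singled-out particle turns the cross interactions into the full pair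
energy, which is bounded below. -/
theorem exists_partitionRatio_ge : ∃ C : ℝ, ∀ (n : ℕ) (β : ℝ), 0 ≤ β →
    1 - (γ * meanPotential μ (n + 1) β - 2 * (β * (n + 1 : ℕ)) * meanPotential μ (n + 1) β
      + β * (n + 1 : ℕ) * logEnergy μ + β * (C + 4 * Real.log (n + 1 : ℕ)))
      ≤ partitionRatio L n β := by
  have hp := h.isProbabilityMeasure
  obtain ⟨C, hC⟩ := h.exists_linear_statistic_le
  refine ⟨C, fun n β hβ => ?_⟩
  have hP := isProbabilityMeasure_gibbs hβ n
  have hP' := isProbabilityMeasure_gibbs hβ (n + 1)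
  have hE := (hC (n + 1) (by omega) β hβ).1
  set N : ℝ := ((n + 1 : ℕ) : ℝ) with hN
  have hN0 : 0 < N := by rw [hN]; positivity
  obtain ⟨hei, hev⟩ := h.integrable_exp_insertionExponent hβ n
  have hcr : ∀ k : Fin (n + 1), Integrable (fun x => crossSum (splitAt k x).1 (splitAt k x).2)
      (gibbs (n + 1) β) := fun k => integrable_gibbs hβ (integrable_finsetSum _ fun j _ =>
        integrable_logKernel_pi integrable_logKernel_prod_stdGauss k _)
  have hpt : ∀ k : Fin (n + 1), Integrable (fun x => potential μ (splitAt k x).1)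
      (gibbs (n + 1) β) := fun k => integrable_gibbs hβ
        (integrable_comp_eval (μ := fun _ : Fin (n + 1) => stdGauss) (i := k)
          h.integrable_potential_stdGauss)
  have hΞ : ∀ k : Fin (n + 1), Integrable (fun x => -insertionExponent γ μ β (splitAt k x))
      (gibbs (n + 1) β) := fun k => (((hpt k).const_mul γ).sub ((hcr k).const_mul β)).neg
  have hk : ∀ k : Fin (n + 1), 1 + ∫ x, -insertionExponent γ μ β (splitAt k x) ∂(gibbs (n + 1) β)
      ≤ partitionRatio L n β := by
    intro k
    have hcancel : (fun q : ℝ × (Fin n → ℝ) => Real.exp (insertionExponent γ μ β q)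
        * Real.exp (-insertionExponent γ μ β q)) = fun _ => 1 := by
      ext q; rw [← Real.exp_add]; simp
    have h1 := (h.integrable_splitAt_iff hβ k fun q => Real.exp (-insertionExponent γ μ β q)).2
      (by rw [hcancel]; exact integrable_const _)
    have h2 := h.integral_splitAt hβ k fun q => Real.exp (-insertionExponent γ μ β q)
    rw [hcancel] at h2
    simp only [integral_const, probReal_univ, smul_eq_mul, mul_one] at h2
    have h3 := exp_integral_le_integral_exp (hΞ k) h1
    rw [h2] at h3
    have h4 := Real.add_one_le_exp
      (∫ x, -insertionExponent γ μ β (splitAt k x) ∂(gibbs (n + 1) β))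
    linarith
  have hsum := Finset.sum_le_sum fun k (_ : k ∈ Finset.univ) => hk k
  rw [Finset.sum_add_distrib, ← integral_finsetSum _ fun k _ => hΞ k] at hsum
  simp only [Finset.sum_const, Finset.card_univ, Fintype.card_fin, nsmul_eq_mul, mul_one] at hsum
  rw [← hN] at hsum
  have hid : ∀ x : Fin (n + 1) → ℝ, ∑ k, -insertionExponent γ μ β (splitAt k x)
      = β * pairSum x - γ * ∑ k, potential μ (x k) := by
    intro x
    have h5 : pairSum x = ∑ k, crossSum (splitAt k x).1 (splitAt k x).2 := by
      unfold pairSum crossSum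
      refine Finset.sum_congr rfl fun k _ => ?_
      rw [Fin.sum_univ_succAbove _ k]
      simp [splitAt_apply, logKernel_self]
    rw [h5, Finset.mul_sum, Finset.mul_sum, ← Finset.sum_sub_distrib]
    refine Finset.sum_congr rfl fun k _ => ?_
    simp only [insertionExponent, splitAt_apply]
    ring
  simp_rw [hid] at hsum
  rw [integral_sub ((integrable_pairSum_gibbs hβ _).const_mul β)
    ((h.integrable_sum_potential hβ _).const_mul γ), integral_const_mul, integral_const_mul] at hsum
  have hu : ∫ x : Fin (n + 1) → ℝ, ∑ i, potential μ (x i) ∂(gibbs (n + 1) β)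
      = N * meanPotential μ (n + 1) β := by
    rw [meanPotential, ← hN]; field_simp
  rw [hu] at hsum
  have h6 := mul_le_mul_of_nonneg_left hE hβ
  refine le_of_mul_le_mul_left ?_ hN0
  refine le_trans ?_ hsum
  nlinarith

/-- Jensen under the larger ensemble bounds the ratio below, Jensen under the smaller one bounds it
above. The exponential mean, which is the inverse ratio, and the mean of the insertion exponent then
converge, which gives the L¹ statement. -/
theorem tendsto_partitionRatio {b : ℕ → ℝ} (hb0 : ∀ n, 0 ≤ b n)
    (hb : Tendsto (fun n : ℕ => b n * (n + 1 : ℕ)) atTop (𝓝 γ)) :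
    Tendsto (fun n => partitionRatio L n (b n)) atTop (𝓝 1) ∧
    Tendsto (fun n => ∫ q : ℝ × (Fin n → ℝ), |Real.exp (insertionExponent γ μ (b n) q) - 1|
      ∂(μ.prod (gibbs n (b n)))) atTop (𝓝 0) := by
  have hp := h.isProbabilityMeasure
  obtain ⟨C, hC⟩ := h.exists_partitionRatio_ge
  obtain ⟨hb1, hb2⟩ := tendsto_zero_of_mul_tendsto (tendsto_add_atTop_nat 1) hb
  have hb' : Tendsto (fun n : ℕ => b n * n) atTop (𝓝 γ) := by
    have := hb.sub hb1
    rw [sub_zero] at this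
    exact this.congr fun n => by push_cast; ring
  have hu := h.tendsto_meanPotential hb0 tendsto_id hb'
  have hu' := h.tendsto_meanPotential hb0 (tendsto_add_atTop_nat 1) hb
  have hpos := fun n => h.partitionRatio_pos (hb0 n) n
  have hmean : Tendsto (fun n => ∫ q : ℝ × (Fin n → ℝ), insertionExponent γ μ (b n) q
      ∂(μ.prod (gibbs n (b n)))) atTop (𝓝 0) := by
    have h1 := (tendsto_const_nhds (x := γ * logEnergy μ)).sub (hb'.mul hu)
    rw [sub_self] at h1
    refine h1.congr fun n => ?_
    rw [(h.integrable_insertionExponent (hb0 n) n).2]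
    simp only [id]
    ring
  have hlow : Tendsto (fun n => 1 - (γ * meanPotential μ (n + 1) (b n)
      - 2 * (b n * (n + 1 : ℕ)) * meanPotential μ (n + 1) (b n)
      + b n * (n + 1 : ℕ) * logEnergy μ + b n * (C + 4 * Real.log (n + 1 : ℕ)))) atTop (𝓝 1) := by
    have h1 := (((hu'.const_mul γ).sub ((hb.const_mul 2).mul hu')).add
      (hb.mul_const (logEnergy μ))).add ((hb1.mul_const C).add (hb2.mul_const 4))
    have h2 := (tendsto_const_nhds (x := (1 : ℝ))).sub h1
    -- The mean potential tends to `logEnergy`, so the three energy terms cancel.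
    rw [show (1 : ℝ) - (γ * logEnergy μ - 2 * γ * logEnergy μ + γ * logEnergy μ
      + (0 * C + 0 * 4)) = 1 by ring] at h2
    exact h2.congr fun n => by ring
  have hinv : ∀ n, 1 + ∫ q : ℝ × (Fin n → ℝ), insertionExponent γ μ (b n) q
      ∂(μ.prod (gibbs n (b n))) ≤ (partitionRatio L n (b n))⁻¹ := by
    intro n
    have hP := isProbabilityMeasure_gibbs (hb0 n) n
    obtain ⟨h1, h2⟩ := h.integrable_exp_insertionExponent (hb0 n) n
    rw [← h2]
    refine le_trans ?_ (exp_integral_le_integral_exp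
      (h.integrable_insertionExponent (hb0 n) n).1 h1)
    linarith [Real.add_one_le_exp (∫ q : ℝ × (Fin n → ℝ), insertionExponent γ μ (b n) q
      ∂(μ.prod (gibbs n (b n))))]
  have hup : Tendsto (fun n => (1 + ∫ q : ℝ × (Fin n → ℝ), insertionExponent γ μ (b n) q
      ∂(μ.prod (gibbs n (b n))))⁻¹) atTop (𝓝 1) := by
    have h1 := ((tendsto_const_nhds (x := (1 : ℝ))).add hmean).inv₀ (by norm_num)
    simpa using h1
  have hratio : Tendsto (fun n => partitionRatio L n (b n)) atTop (𝓝 1) := by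
    refine tendsto_of_tendsto_of_tendsto_of_le_of_le' hlow hup
      (Eventually.of_forall fun n => hC n (b n) (hb0 n)) ?_
    filter_upwards [hmean.eventually_const_lt (show (-1 : ℝ) < 0 by norm_num)] with n hn
    rw [le_inv_comm₀ (hpos n) (by linarith)]
    exact hinv n
  refine ⟨hratio, ?_⟩
  refine tendsto_zero_of_exp_bound (fun n => integral_nonneg fun q => abs_nonneg _)
    (a := fun n => (partitionRatio L n (b n))⁻¹) (by simpa using hratio.inv₀ one_ne_zero) hmean
    fun n ε δ hδ h1 h2 => ?_
  have hP := isProbabilityMeasure_gibbs (hb0 n) n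
  obtain ⟨h3, h4⟩ := h.integrable_exp_insertionExponent (hb0 n) n
  exact integral_abs_exp_sub_one_le (h.integrable_insertionExponent (hb0 n) n).1 h3 hδ
    (h4.trans_le h1) h2

end SelfConsistent

end LogGas

end

/-! ### Asymptotic decoupling of a distant particle. -/

noncomputable section

namespace LogGas

/-! ### Exponential moments of the sum of squares -/

theorem pairSum_smul_ge {n : ℕ} {c : ℝ} (hc : 1 ≤ c) (x : Fin n → ℝ) :
    pairSum x - (n : ℝ) ^ 2 * Real.log c ≤ pairSum (c • x) := by
  have hc0 : 0 < c := by linarith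
  have hl : 0 ≤ Real.log c := Real.log_nonneg hc
  have h1 : ∀ i j, logKernel (x i) (x j) - Real.log c ≤ logKernel ((c • x) i) ((c • x) j) := by
    intro i j
    rw [logKernel_eq, logKernel_eq, Pi.smul_apply, Pi.smul_apply, smul_eq_mul, smul_eq_mul,
      ← mul_sub, abs_mul, abs_of_pos hc0]
    rcases eq_or_ne (x i - x j) 0 with h0 | h0
    · simp [h0, hl]
    · rw [Real.log_mul hc0.ne' (abs_ne_zero.2 h0)]
      linarith
  have h2 := Finset.sum_le_sum fun i (_ : i ∈ Finset.univ) =>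
    Finset.sum_le_sum fun j (_ : j ∈ Finset.univ) => h1 i j
  refine le_trans (le_of_eq ?_) h2
  simp [pairSum, Finset.sum_sub_distrib]
  ring

/-- The dilation by `c` with `(1 - τ) c² = 1` absorbs `τ |y|²` into the confinement. It costs `c^n`
from the Jacobian and at most `c^{β n²/2}` from the interaction, and `log c ≤ τ` for `τ ≤ 1/2`.
Unlike the Gaussian domination, the bound has explicit constants. -/
theorem lintegral_exp_sum_sq_gibbs_le {β τ : ℝ} (hβ : 0 ≤ β) (hτ0 : 0 ≤ τ) (hτ1 : τ ≤ 1 / 2)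
    (n : ℕ) : ∫⁻ y : Fin n → ℝ, ENNReal.ofReal (Real.exp (τ * ∑ i, (y i) ^ 2)) ∂(gibbs n β) ≤
      ENNReal.ofReal (Real.exp (τ * n * (1 + β * n / 2))) := by
  set κ : ℝ := -(Real.log (1 - τ) / 2) with hκ
  have hκτ : κ ≤ τ := by
    have h1 := Real.one_sub_inv_le_log_of_pos (show 0 < 1 - τ by linarith)
    have h2 : (1 - τ)⁻¹ ≤ 1 + 2 * τ := by
      rw [inv_le_iff_one_le_mul₀ (by linarith)]
      nlinarith
    rw [hκ]
    linarith
  have hκ0 : 0 ≤ κ := by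
    have h1 := Real.log_nonpos (show 0 ≤ 1 - τ by linarith) (by linarith)
    rw [hκ]
    linarith
  set c := Real.exp κ with hc
  have hc1 : 1 ≤ c := Real.one_le_exp hκ0
  have hc0 : 0 < c := Real.exp_pos _
  have hc2 : (1 - τ) * c ^ 2 = 1 := by
    rw [hc, ← Real.exp_nat_mul, hκ]
    push_cast
    rw [show 2 * -(Real.log (1 - τ) / 2) = -Real.log (1 - τ) by ring, Real.exp_neg,
      Real.exp_log (by linarith), mul_inv_cancel₀ (by linarith)]
  have hlc : Real.log c = κ := Real.log_exp _
  have hvol : (volume : Measure (Fin n → ℝ)) =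
      ENNReal.ofReal (c ^ n) • (volume : Measure (Fin n → ℝ)).map (fun x => c • x) := by
    rw [Measure.map_addHaar_smul _ hc0.ne', Module.finrank_fin_fun, smul_smul,
      ← ENNReal.ofReal_mul (by positivity), abs_of_pos (by positivity),
      mul_inv_cancel₀ (by positivity), ENNReal.ofReal_one, one_smul]
  have hpt : ∀ x : Fin n → ℝ, Real.exp (-hamiltonian (fun x => x ^ 2) n β (c • x))
      * Real.exp (τ * ∑ i, ((c • x) i) ^ 2)
      ≤ Real.exp (β / 2 * (n : ℝ) ^ 2 * κ) * Real.exp (-hamiltonian (fun x => x ^ 2) n β x) := by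
    intro x
    rw [← Real.exp_add, ← Real.exp_add, hamiltonian_eq, hamiltonian_eq]
    apply Real.exp_le_exp.2
    have h1 := mul_le_mul_of_nonneg_left (pairSum_smul_ge hc1 x) (show 0 ≤ β / 2 by positivity)
    rw [hlc] at h1
    have h2 : ∑ i, ((c • x) i) ^ 2 = c ^ 2 * ∑ i, (x i) ^ 2 := by
      rw [Finset.mul_sum]
      exact Finset.sum_congr rfl fun i _ => by simp [mul_pow]
    rw [h2]
    have h3 : c ^ 2 * ∑ i, (x i) ^ 2 - τ * (c ^ 2 * ∑ i, (x i) ^ 2) = ∑ i, (x i) ^ 2 := by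
      linear_combination (∑ i, (x i) ^ 2) * hc2
    linarith
  have hw : ∫⁻ y : Fin n → ℝ, ENNReal.ofReal (Real.exp (τ * ∑ i, (y i) ^ 2)) ∂(gibbsWeight n β)
      ≤ ENNReal.ofReal (c ^ n) * (ENNReal.ofReal (Real.exp (β / 2 * (n : ℝ) ^ 2 * κ))
        * partitionFunction (fun x => x ^ 2) n β) := by
    rw [gibbsWeight, lintegral_withDensity_eq_lintegral_mul _ (by fun_prop) (by fun_prop)]
    conv_lhs => rw [hvol]
    rw [lintegral_smul_measure, lintegral_map (by fun_prop) (by fun_prop), smul_eq_mul,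
      partitionFunction, ← lintegral_const_mul (ENNReal.ofReal (Real.exp (β / 2 * (n : ℝ) ^ 2 * κ)))
        (by fun_prop)]
    refine mul_le_mul' le_rfl (lintegral_mono fun x => ?_)
    simp only [Pi.mul_apply]
    rw [← ENNReal.ofReal_mul (Real.exp_pos _).le, ← ENNReal.ofReal_mul (Real.exp_pos _).le]
    exact ENNReal.ofReal_le_ofReal (hpt x)
  rw [gibbs_eq, lintegral_smul_measure, smul_eq_mul]
  calc _ ≤ (partitionFunction (fun x => x ^ 2) n β)⁻¹ * (ENNReal.ofReal (c ^ n) *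
        (ENNReal.ofReal (Real.exp (β / 2 * (n : ℝ) ^ 2 * κ))
        * partitionFunction (fun x => x ^ 2) n β)) := by gcongr
    _ = ENNReal.ofReal (c ^ n) * ENNReal.ofReal (Real.exp (β / 2 * (n : ℝ) ^ 2 * κ)) *
        ((partitionFunction (fun x => x ^ 2) n β)⁻¹ *
          partitionFunction (fun x => x ^ 2) n β) := by ring
    _ = ENNReal.ofReal (Real.exp (κ * n * (1 + β * n / 2))) := by
        rw [ENNReal.inv_mul_cancel (partitionFunction_ne_zero n β)
          (partitionFunction_ne_top hβ n), mul_one, ← ENNReal.ofReal_mul (by positivity), hc,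
          ← Real.exp_nat_mul, ← Real.exp_add]
        ring_nf
    _ ≤ _ := by
        apply ENNReal.ofReal_le_ofReal
        apply Real.exp_le_exp.2
        gcongr

/-! ### The interaction with a distant particle -/

/-- The exponent of `∏_j |1 - y_j / v|^β`. -/
def tailExponent (β : ℝ) {n : ℕ} (v : ℝ) (y : Fin n → ℝ) : ℝ :=
  -(β * (crossSum v y + n * Real.log v))

@[fun_prop]
theorem measurable_tailExponent (β : ℝ) {n : ℕ} :
    Measurable (fun q : ℝ × (Fin n → ℝ) => tailExponent β q.1 q.2) := by
  unfold tailExponent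
  fun_prop

theorem neg_logKernel_sub_log_le {v : ℝ} (hv : 1 ≤ v) (y : ℝ) :
    -(logKernel v y + Real.log v) ≤ |y| / v := by
  have hv0 : 0 < v := by linarith
  rw [logKernel_eq]
  rcases eq_or_ne v y with rfl | hne
  · simp only [sub_self, abs_zero, Real.log_zero, neg_zero, zero_add]
    have := Real.log_nonneg hv
    have : 0 ≤ |v| / v := by positivity
    linarith
  · have h0 : 0 < |v - y| := abs_pos.2 (sub_ne_zero.2 hne)
    have h1 : -(-Real.log |v - y| + Real.log v) = Real.log (|v - y| / v) := by
      rw [Real.log_div h0.ne' hv0.ne']; ring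
    rw [h1]
    refine (Real.log_le_sub_one_of_pos (by positivity)).trans ?_
    rw [sub_le_iff_le_add, div_add_one hv0.ne']
    gcongr
    have := abs_sub v y
    rw [abs_of_pos hv0] at this
    linarith

theorem tailExponent_le {β : ℝ} (hβ : 0 ≤ β) {t v : ℝ} (ht : 1 ≤ t) (hv : t ≤ v) {n : ℕ}
    (y : Fin n → ℝ) :
    tailExponent β v y ≤ β / (2 * t) * n + β / (2 * t) * ∑ i, (y i) ^ 2 := by
  have ht0 : 0 < t := by linarith
  have h1 : -(crossSum v y + n * Real.log v) ≤ (2 * t)⁻¹ * n + (2 * t)⁻¹ * ∑ i, (y i) ^ 2 := by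
    have h2 : ∀ i, -(logKernel v (y i) + Real.log v) ≤ (2 * t)⁻¹ + (2 * t)⁻¹ * (y i) ^ 2 := by
      intro i
      refine (neg_logKernel_sub_log_le (ht.trans hv) (y i)).trans ?_
      have h3 : |y i| ≤ (1 + (y i) ^ 2) / 2 := by
        rw [← sq_abs]; nlinarith [sq_nonneg (|y i| - 1)]
      calc |y i| / v ≤ |y i| / t := by gcongr
        _ ≤ (1 + (y i) ^ 2) / 2 / t := by gcongr
        _ = _ := by field_simp
    have h4 := Finset.sum_le_sum fun i (_ : i ∈ Finset.univ) => h2 i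
    rw [Finset.sum_neg_distrib, Finset.sum_add_distrib, Finset.sum_add_distrib,
      ← Finset.mul_sum] at h4
    simp only [Finset.sum_const, Finset.card_univ, Fintype.card_fin, nsmul_eq_mul] at h4
    rw [crossSum]
    linarith
  have h5 := mul_le_mul_of_nonneg_left h1 hβ
  rw [tailExponent]
  refine (le_of_eq (by ring)).trans (h5.trans_eq ?_)
  field_simp

theorem integrable_exp_tailExponent {β : ℝ} (hβ : 0 ≤ β) {t v : ℝ} (ht : 1 ≤ t) (hβt : β ≤ t)
    (hv : t ≤ v) (n : ℕ) :
    Integrable (fun y : Fin n → ℝ => Real.exp (tailExponent β v y)) (gibbs n β) ∧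
    ∫ y : Fin n → ℝ, Real.exp (tailExponent β v y) ∂(gibbs n β)
      ≤ Real.exp (β * n / (2 * t) * (2 + β * n / 2)) := by
  have ht0 : 0 < t := by linarith
  have hτ : β / (2 * t) ≤ 1 / 2 := by
    rw [div_le_div_iff₀ (by positivity) (by norm_num)]
    linarith
  have hm : Measurable (fun y : Fin n → ℝ => tailExponent β v y) :=
    by unfold tailExponent crossSum; fun_prop
  have h1 : ∫⁻ y : Fin n → ℝ, ENNReal.ofReal (Real.exp (tailExponent β v y)) ∂(gibbs n β) ≤
      ENNReal.ofReal (Real.exp (β * n / (2 * t) * (2 + β * n / 2))) := by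
    calc _ ≤ ∫⁻ y : Fin n → ℝ, ENNReal.ofReal (Real.exp (β / (2 * t) * n)) *
          ENNReal.ofReal (Real.exp (β / (2 * t) * ∑ i, (y i) ^ 2)) ∂(gibbs n β) := by
          refine lintegral_mono fun y => ?_
          rw [← ENNReal.ofReal_mul (Real.exp_pos _).le, ← Real.exp_add]
          exact ENNReal.ofReal_le_ofReal (Real.exp_le_exp.2 (tailExponent_le hβ ht hv y))
      _ ≤ ENNReal.ofReal (Real.exp (β / (2 * t) * n)) *
          ENNReal.ofReal (Real.exp (β / (2 * t) * n * (1 + β * n / 2))) := by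
          rw [lintegral_const_mul _ (by fun_prop)]
          gcongr
          exact lintegral_exp_sum_sq_gibbs_le hβ (by positivity) hτ n
      _ = _ := by
          rw [← ENNReal.ofReal_mul (Real.exp_pos _).le, ← Real.exp_add]
          congr 2
          ring
  have hnn : ∀ y : Fin n → ℝ, 0 ≤ Real.exp (tailExponent β v y) := fun y => (Real.exp_pos _).le
  have hme : AEStronglyMeasurable (fun y : Fin n → ℝ => Real.exp (tailExponent β v y))
      (gibbs n β) := hm.exp.aestronglyMeasurable
  refine ⟨⟨hme, ?_⟩, ?_⟩
  · rw [hasFiniteIntegral_iff_ofReal (Eventually.of_forall hnn)]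
    exact h1.trans_lt ENNReal.ofReal_lt_top
  · rw [integral_eq_lintegral_of_nonneg_ae (Eventually.of_forall hnn) hme]
    exact ENNReal.toReal_le_of_le_ofReal (Real.exp_pos _).le h1

theorem integrable_crossSum_gibbs {β : ℝ} (hβ : 0 ≤ β) (v : ℝ) (n : ℕ) :
    Integrable (fun y : Fin n → ℝ => crossSum v y) (gibbs n β) :=
  integrable_gibbs hβ (integrable_sum_gaussPi (integrable_logKernel_stdGauss v))

/-- For `|y| ≤ v/2` this is `(1 - z)^{-1/2} ≤ 1 + 2z`; otherwise `1 < 2|y|/v` and the singular term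
suffices. -/
theorem inv_sqrt_le {v y : ℝ} (hv : 0 < v) (hy : v ≠ y) :
    √v * (√|v - y|)⁻¹ ≤ 1 + 2 / v * |y| + 2 / √v * (|y| * (√|v - y|)⁻¹) := by
  have hd : 0 < |v - y| := abs_pos.2 (sub_ne_zero.2 hy)
  have hs : 0 < √|v - y| := Real.sqrt_pos.2 hd
  have hsv : 0 < √v := Real.sqrt_pos.2 hv
  rcases le_or_gt |y| (v / 2) with h | h
  · have h1 : √v * (√|v - y|)⁻¹ ≤ 1 + 2 / v * |y| := by
      rw [← div_eq_mul_inv, div_le_iff₀ hs]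
      apply Real.sqrt_le_iff.2
      refine ⟨by positivity, ?_⟩
      rw [mul_pow, Real.sq_sqrt hd.le]
      have h2 : v - |y| ≤ |v - y| := by
        have := abs_sub_abs_le_abs_sub v y
        rwa [abs_of_pos hv] at this
      set z := |y| / v with hz
      have hz0 : 0 ≤ z := by positivity
      have hz1 : z ≤ 1 / 2 := by rw [hz, div_le_iff₀ hv]; linarith
      have e1 : 2 / v * |y| = 2 * z := by rw [hz]; ring
      have e2 : |y| = v * z := by rw [hz]; field_simp
      rw [e1]
      rw [e2] at h2
      have h3 : 1 ≤ (1 + 2 * z) ^ 2 * (1 - z) := by nlinarith [mul_nonneg hz0 hz0]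
      calc v = v * 1 := (mul_one v).symm
        _ ≤ v * ((1 + 2 * z) ^ 2 * (1 - z)) := by gcongr
        _ = (1 + 2 * z) ^ 2 * (v - v * z) := by ring
        _ ≤ _ := by gcongr
    have : 0 ≤ 2 / √v * (|y| * (√|v - y|)⁻¹) := by positivity
    linarith
  · have h1 : √v * (√|v - y|)⁻¹ ≤ 2 / √v * (|y| * (√|v - y|)⁻¹) := by
      rw [← mul_assoc]
      gcongr
      rw [div_mul_eq_mul_div, le_div_iff₀ hsv, Real.mul_self_sqrt hv.le]
      linarith
    have : 0 ≤ 2 / v * |y| := by positivity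
    linarith

namespace SelfConsistent

variable {γ L : ℝ} {μ : Measure ℝ} (h : SelfConsistent γ μ L)
include h

/-- Halving the exponent turns it into `(v/|v - y|)^{1/2}`, an integrable singularity. The decay in
`v` comes from the first moment of `μ` and from the uniform bound on `∫ |z| |v - z|^{-1/2}`. -/
theorem exists_log_integral_exp_kernel_le : ∃ K : ℝ, 0 ≤ K ∧ ∀ v : ℝ, 1 ≤ v →
    Integrable (fun y => Real.exp ((logKernel v y + Real.log v) / 2)) μ ∧
    Real.log (∫ y, Real.exp ((logKernel v y + Real.log v) / 2) ∂μ) ≤ K / √v := by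
  have hp := h.isProbabilityMeasure
  obtain ⟨C, hC0, hC⟩ := h.gaussDominated.exists_integral_le
  obtain ⟨D, hD⟩ := exists_integral_abs_mul_inv_sqrt_le
  have hD0 : 0 ≤ D := (integral_nonneg fun z => by positivity).trans (hD 0).2
  have hDi := fun v => h.gaussDominated.integrable (hD v).1
  have hDv : ∀ v, ∫ z, |z| * (√|v - z|)⁻¹ ∂μ ≤ C * D := fun v =>
    (hC _ (fun z => by positivity) (hD v).1).trans (by gcongr; exact (hD v).2)
  have habs : Integrable (fun y : ℝ => |y|) μ := h.gaussDominated.integrable integrable_abs_stdGauss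
  have hA0 : 0 ≤ ∫ y, |y| ∂μ := integral_nonneg fun y => abs_nonneg y
  refine ⟨2 * (∫ y, |y| ∂μ) + 2 * (C * D), by positivity, fun v hv => ?_⟩
  have hv0 : 0 < v := by linarith
  have hsv : 0 < √v := Real.sqrt_pos.2 hv0
  have hsv1 : √v ≤ v := by
    have h1 := Real.sq_sqrt hv0.le
    have h2 : 1 ≤ √v := Real.one_le_sqrt.2 hv
    nlinarith
  have hne : ∀ᵐ y ∂μ, v ≠ y := by
    have h3 : ∀ᵐ z ∂(volume : Measure ℝ), v ≠ z := by simp [ae_iff]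
    exact h.gaussDominated.absolutelyContinuous.ae_le h3
  have hbd : ∀ᵐ y ∂μ, Real.exp ((logKernel v y + Real.log v) / 2) ≤
      1 + 2 / v * |y| + 2 / √v * (|y| * (√|v - y|)⁻¹) := by
    filter_upwards [hne] with y hy
    refine le_trans (le_of_eq ?_) (inv_sqrt_le hv0 hy)
    have hd : 0 < |v - y| := abs_pos.2 (sub_ne_zero.2 hy)
    rw [logKernel_eq, show (-Real.log |v - y| + Real.log v) / 2
      = Real.log v / 2 - Real.log |v - y| / 2 by ring, Real.exp_sub, ← Real.log_sqrt hv0.le,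
      ← Real.log_sqrt hd.le, Real.exp_log hsv, Real.exp_log (Real.sqrt_pos.2 hd), div_eq_mul_inv]
  have hi1 : Integrable (fun y : ℝ => 1 + 2 / v * |y|) μ :=
    (integrable_const 1).add (habs.const_mul _)
  have hi2 : Integrable (fun y : ℝ => 2 / √v * (|y| * (√|v - y|)⁻¹)) μ := (hDi v).const_mul _
  have hi : Integrable (fun y => Real.exp ((logKernel v y + Real.log v) / 2)) μ := by
    refine (hi1.add hi2).mono' (by fun_prop) ?_
    filter_upwards [hbd] with y hy
    rwa [Real.norm_of_nonneg (Real.exp_pos _).le]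
  refine ⟨hi, ?_⟩
  have h4 := integral_mono_ae hi (hi1.add hi2) hbd
  simp only [Pi.add_apply] at h4
  rw [integral_add hi1 hi2, integral_add (integrable_const 1) (habs.const_mul _),
    integral_const_mul, integral_const_mul] at h4
  simp only [integral_const, probReal_univ, smul_eq_mul, mul_one] at h4
  have h5 := Real.log_le_sub_one_of_pos (integral_exp_pos hi)
  have h6 : 2 / v * ∫ y, |y| ∂μ ≤ 2 * (∫ y, |y| ∂μ) / √v := by
    rw [div_mul_eq_mul_div]
    gcongr
  have h7 : 2 / √v * ∫ z, |z| * (√|v - z|)⁻¹ ∂μ ≤ 2 * (C * D) / √v := by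
    rw [div_mul_eq_mul_div]
    gcongr
    exact hDv v
  rw [add_div]
  linarith

/-- The L¹ criterion for `β ∑ log |1 - y_j/v|`. The exponential mean is bounded above by the
dilation argument, the mean is bounded below by the entropy inequality. Both bounds only improve as
`v` grows, hence uniformity beyond `t n`. -/
theorem eventually_integral_abs_exp_tailExponent_le {b t : ℕ → ℝ} (hb0 : ∀ n, 0 ≤ b n)
    (hb : Tendsto (fun n : ℕ => b n * (n + 1 : ℕ)) atTop (𝓝 γ)) (ht : Tendsto t atTop atTop)
    {η : ℝ} (hη : 0 < η) : ∀ᶠ n in atTop, ∀ v, t n ≤ v →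
      Integrable (fun y : Fin n → ℝ => Real.exp (tailExponent (b n) v y)) (gibbs n (b n)) ∧
      ∫ y : Fin n → ℝ, |Real.exp (tailExponent (b n) v y) - 1| ∂(gibbs n (b n)) ≤ η := by
  have hp := h.isProbabilityMeasure
  obtain ⟨K, hK0, hK⟩ := h.exists_log_integral_exp_kernel_le
  obtain ⟨C, hC⟩ := h.exists_linear_statistic_le
  obtain ⟨hb1, hb2⟩ := tendsto_zero_of_mul_tendsto (tendsto_add_atTop_nat 1) hb
  have hb' : Tendsto (fun n : ℕ => b n * n) atTop (𝓝 γ) := by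
    have := hb.sub hb1
    rw [sub_zero] at this
    exact this.congr fun n => by push_cast; ring
  have hb3 := (tendsto_zero_of_mul_tendsto tendsto_id hb').2
  have hu := h.tendsto_meanPotential hb0 tendsto_id hb'
  simp only [id] at hu hb3
  set δ := η / 8 with hδ
  have hδ0 : 0 < δ := by positivity
  set ε := min 1 (δ * (η / 4)) with hε
  have hε0 : 0 < ε := lt_min one_pos (by positivity)
  have hup : Tendsto (fun n : ℕ => Real.exp (b n * n / (2 * t n) * (2 + b n * n / 2))) atTop
      (𝓝 1) := by
    have h1 : Tendsto (fun n : ℕ => b n * n / (2 * t n)) atTop (𝓝 0) :=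
      hb'.div_atTop (ht.const_mul_atTop two_pos)
    have h2 := (Real.continuous_exp.tendsto _).comp
      (h1.mul ((tendsto_const_nhds (x := (2 : ℝ))).add (hb'.div_const 2)))
    rw [zero_mul, Real.exp_zero] at h2
    exact h2
  have hlow : Tendsto (fun n : ℕ => 2 * (b n * n) * (K / √(t n)
      + (γ - b n * n) * (meanPotential μ n (b n) - logEnergy μ)
      + b n / 2 * (C + 4 * Real.log n - logEnergy μ))) atTop (𝓝 0) := by
    have h1 : Tendsto (fun n : ℕ => K / √(t n)) atTop (𝓝 0) :=
      tendsto_const_nhds.div_atTop (Real.tendsto_sqrt_atTop.comp ht)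
    have h2 := ((tendsto_const_nhds (x := γ)).sub hb').mul
      (hu.sub (tendsto_const_nhds (x := logEnergy μ)))
    have h3 : Tendsto (fun n : ℕ => b n / 2 * (C + 4 * Real.log n - logEnergy μ)) atTop
        (𝓝 0) := by
      have h1 := (hb1.mul_const ((C - logEnergy μ) / 2)).add (hb3.mul_const 2)
      rw [zero_mul, zero_mul, add_zero] at h1
      exact h1.congr fun n => by ring
    have h4 := (hb'.const_mul 2).mul ((h1.add h2).add h3)
    simpa using h4
  filter_upwards [hup.eventually_le_const (show (1 : ℝ) < 1 + ε by linarith),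
    hlow.eventually_le_const hε0, ht.eventually_ge_atTop 1,
    hb1.eventually_le_const one_pos, eventually_ge_atTop 1] with n h1 h2 h3 h5 hn v hv
  have hn0 : (0 : ℝ) < n := by exact_mod_cast hn
  have hP := isProbabilityMeasure_gibbs (hb0 n) n
  have hv1 : 1 ≤ v := h3.trans hv
  obtain ⟨hi, hle⟩ := integrable_exp_tailExponent (hb0 n) h3 (h5.trans h3) hv n
  refine ⟨hi, ?_⟩
  have hcr := integrable_crossSum_gibbs (hb0 n) v n
  have hYi : Integrable (fun y : Fin n → ℝ => tailExponent (b n) v y) (gibbs n (b n)) :=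
    ((hcr.add (integrable_const _)).const_mul _).neg
  have hY : -ε ≤ ∫ y : Fin n → ℝ, tailExponent (b n) v y ∂(gibbs n (b n)) := by
    have h6 := (hC n hn (b n) (hb0 n)).2 (fun y => (logKernel v y + Real.log v) / 2)
      (((integrable_logKernel_stdGauss v).add (integrable_const _)).div_const 2) (hK v hv1).1
    -- The factor 2 undoes the halving needed for exponential integrability of the test function.
    have h7 : ∫ y : Fin n → ℝ, tailExponent (b n) v y ∂(gibbs n (b n)) = -(2 * b n * ∫ y : Fin n → ℝ,
        ∑ i, (logKernel v (y i) + Real.log v) / 2 ∂(gibbs n (b n))) := by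
      rw [← integral_const_mul, ← integral_neg]
      congr 1
      ext y
      rw [← Finset.sum_div, Finset.sum_add_distrib, tailExponent, crossSum]
      simp only [Finset.sum_const, Finset.card_univ, Fintype.card_fin, nsmul_eq_mul]
      ring
    rw [h7, neg_le_neg_iff]
    refine le_trans ?_ h2
    rw [div_le_iff₀ hn0] at h6
    have h8 : K / √v ≤ K / √(t n) := by
      have : 0 < √(t n) := Real.sqrt_pos.2 (by linarith)
      gcongr
    have h9 := h6.trans (mul_le_mul_of_nonneg_right (add_le_add_left (add_le_add_left
      ((hK v hv1).2.trans h8) _) _) hn0.le)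
    have h10 := mul_le_mul_of_nonneg_left h9 (show 0 ≤ 2 * b n by linarith [hb0 n])
    refine h10.trans (le_of_eq ?_)
    ring
  refine (integral_abs_exp_sub_one_le hYi hi hδ0 (hle.trans h1) hY).trans ?_
  have h6 : ε / δ ≤ η / 4 := by
    rw [div_le_iff₀ hδ0, mul_comm]
    exact min_le_right _ _
  have h7 : ε ≤ 1 := min_le_left _ _
  nlinarith

end SelfConsistent

end LogGas

end

/-! ### The generating function of exceedances and its approximate differential equation. -/

noncomputable section

namespace LogGas

/-! ### The generating function of the number of exceedances -/

/-- The indicator of the event that `x` exceeds the level `t`. -/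
def exceed (t x : ℝ) : ℝ := if t < x then 1 else 0

theorem exceed_nonneg (t x : ℝ) : 0 ≤ exceed t x := by unfold exceed; split_ifs <;> norm_num

theorem exceed_le_one (t x : ℝ) : exceed t x ≤ 1 := by unfold exceed; split_ifs <;> norm_num

@[fun_prop]
theorem measurable_exceed (t : ℝ) : Measurable (exceed t) :=
  Measurable.ite measurableSet_Ioi measurable_const measurable_const

/-- The product `∏_j (1 - θ 1_{y_j > t})`. -/
def thinning (t θ : ℝ) {n : ℕ} (y : Fin n → ℝ) : ℝ := ∏ j, (1 - θ * exceed t (y j))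

/-- The generating function of the number of exceedances of the level `t`. -/
def exceedGen (n : ℕ) (β t θ : ℝ) : ℝ := ∫ y : Fin n → ℝ, thinning t θ y ∂(gibbs n β)

@[fun_prop]
theorem measurable_thinning (t θ : ℝ) (n : ℕ) : Measurable (thinning t θ : (Fin n → ℝ) → ℝ) := by
  unfold thinning
  fun_prop

theorem factor_mem {t θ : ℝ} (hθ : θ ∈ Set.Icc (0 : ℝ) 1) (x : ℝ) :
    0 ≤ 1 - θ * exceed t x ∧ 1 - θ * exceed t x ≤ 1 := by
  have h1 := exceed_nonneg t x
  have h2 := exceed_le_one t x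
  obtain ⟨h3, h4⟩ := hθ
  constructor <;> nlinarith

theorem thinning_nonneg {t θ : ℝ} (hθ : θ ∈ Set.Icc (0 : ℝ) 1) {n : ℕ} (y : Fin n → ℝ) :
    0 ≤ thinning t θ y := Finset.prod_nonneg fun _ _ => (factor_mem hθ _).1

theorem thinning_le_one {t θ : ℝ} (hθ : θ ∈ Set.Icc (0 : ℝ) 1) {n : ℕ} (y : Fin n → ℝ) :
    thinning t θ y ≤ 1 :=
  Finset.prod_le_one (fun _ _ => (factor_mem hθ _).1) fun _ _ => (factor_mem hθ _).2

theorem thinning_zero (t : ℝ) {n : ℕ} (y : Fin n → ℝ) : thinning t 0 y = 1 := by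
  simp [thinning]

theorem thinning_succ (t θ : ℝ) {n : ℕ} (k : Fin (n + 1)) (x : Fin (n + 1) → ℝ) :
    thinning t θ x = (1 - θ * exceed t (splitAt k x).1) * thinning t θ (splitAt k x).2 := by
  rw [thinning, Fin.prod_univ_succAbove _ k]
  rfl

theorem integrable_of_unit {Ω : Type*} [MeasurableSpace Ω] {P : Measure Ω} [IsFiniteMeasure P]
    {F : Ω → ℝ} (hm : AEStronglyMeasurable F P) (h0 : ∀ ω, 0 ≤ F ω) (h1 : ∀ ω, F ω ≤ 1) :
    Integrable F P :=
  (integrable_const (1 : ℝ)).mono' hm (Eventually.of_forall fun ω => by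
    rw [Real.norm_of_nonneg (h0 ω)]; exact h1 ω)

theorem hasDerivAt_thinning (t θ : ℝ) {n : ℕ} (x : Fin (n + 1) → ℝ) :
    HasDerivAt (fun θ => thinning t θ x)
      (∑ k, -(exceed t (splitAt k x).1 * thinning t θ (splitAt k x).2)) θ := by
  have h1 : HasDerivAt (fun θ => ∏ j ∈ Finset.univ, (1 - θ * exceed t (x j)))
      (∑ k ∈ Finset.univ, (∏ j ∈ Finset.univ.erase k, (1 - θ * exceed t (x j)))
        • (-exceed t (x k))) θ := by
    refine HasDerivAt.fun_finsetProd fun j _ => ?_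
    have := ((hasDerivAt_id θ).mul_const (exceed t (x j))).const_sub 1
    simpa using this
  unfold thinning
  convert h1 using 1
  refine Finset.sum_congr rfl fun k _ => ?_
  rw [Fin.univ_succAbove n k, Finset.erase_cons, Finset.prod_map, smul_eq_mul]
  simp only [splitAt_apply, Fin.coe_succAboveEmb]
  ring

theorem hasDerivAt_exceedGen {β t θ : ℝ} (hβ : 0 ≤ β) (hθ : θ ∈ Set.Icc (0 : ℝ) 1) (n : ℕ) :
    HasDerivAt (exceedGen (n + 1) β t) (-∑ k : Fin (n + 1), ∫ x : Fin (n + 1) → ℝ,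
      exceed t (splitAt k x).1 * thinning t θ (splitAt k x).2 ∂(gibbs (n + 1) β)) θ := by
  have hP := isProbabilityMeasure_gibbs hβ (n + 1)
  have hms : ∀ (θ' : ℝ) (k : Fin (n + 1)), Measurable fun x : Fin (n + 1) → ℝ =>
      exceed t (splitAt k x).1 * thinning t θ' (splitAt k x).2 := fun θ' k => by fun_prop
  have h1 := hasDerivAt_integral_of_dominated_loc_of_deriv_le (μ := gibbs (n + 1) β)
    (F := fun θ x => thinning t θ x) (x₀ := θ) (s := Metric.ball θ 1)
    -- On the unit ball around a point of `[0, 1]` each factor of the thinning is at most 3 in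
    -- absolute value.
    (bound := fun _ => ∑ k : Fin (n + 1), (3 : ℝ) ^ n)
    (F' := fun θ x => ∑ k, -(exceed t (splitAt k x).1 * thinning t θ (splitAt k x).2))
    (Metric.ball_mem_nhds θ one_pos) (Eventually.of_forall fun θ' => by fun_prop)
    (integrable_of_unit (by fun_prop) (fun y => thinning_nonneg hθ y)
      fun y => thinning_le_one hθ y)
    (Measurable.aestronglyMeasurable (Finset.measurable_fun_sum _ fun k _ => (hms θ k).neg))
    (Eventually.of_forall fun x θ' hθ' => ?_)
    (integrable_const _) (Eventually.of_forall fun x θ' _ => hasDerivAt_thinning t θ' x)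
  · have h2 := h1.2
    rw [integral_finsetSum] at h2
    · simp_rw [integral_neg, Finset.sum_neg_distrib] at h2
      exact h2
    · intro k _
      refine Integrable.neg (integrable_of_unit (hms θ k).aestronglyMeasurable
        (fun x => mul_nonneg (exceed_nonneg _ _) (thinning_nonneg hθ _)) fun x => ?_)
      exact mul_le_one₀ (exceed_le_one _ _) (thinning_nonneg hθ _) (thinning_le_one hθ _)
  · refine (norm_sum_le _ _).trans (Finset.sum_le_sum fun k _ => ?_)
    rw [norm_neg, norm_mul, Real.norm_of_nonneg (exceed_nonneg _ _)]
    refine (mul_le_of_le_one_left (norm_nonneg _) (exceed_le_one _ _)).trans ?_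
    rw [thinning, norm_prod]
    have h3 : ∀ j : Fin n, ‖1 - θ' * exceed t ((splitAt k x).2 j)‖ ≤ 3 := by
      intro j
      have h4 := exceed_nonneg t ((splitAt k x).2 j)
      have h5 := exceed_le_one t ((splitAt k x).2 j)
      rw [Metric.mem_ball, Real.dist_eq, abs_lt] at hθ'
      rw [Real.norm_eq_abs, abs_le]
      constructor <;> nlinarith [hθ.1, hθ.2]
    calc _ ≤ ∏ j : Fin n, (3 : ℝ) := Finset.prod_le_prod (fun j _ => norm_nonneg _) fun j _ => h3 j
      _ = 3 ^ n := by simp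

/-! ### The law of a particle beyond the level -/

/-- The measure `v^{βn} e^{-v²} dv` on the half-line `v > t`. -/
def tailMeasure (n : ℕ) (β t : ℝ) : Measure ℝ :=
  ((volume : Measure ℝ).restrict (Set.Ioi t)).withDensity
    fun v => ENNReal.ofReal (Real.exp (β * n * Real.log v - v ^ 2))

theorem integrableOn_tail {b t : ℝ} (hb : 0 ≤ b) (ht : 0 ≤ t) :
    IntegrableOn (fun v => Real.exp (b * Real.log v - v ^ 2)) (Set.Ioi t) := by
  have h1 : Integrable (fun v : ℝ => Real.exp (b ^ 2 / 2) * Real.exp (-(1 / 2) * v ^ 2)) :=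
    (integrable_exp_neg_mul_sq (by norm_num)).const_mul _
  refine h1.integrableOn.mono' (by fun_prop) ?_
  filter_upwards [ae_restrict_mem measurableSet_Ioi] with v hv
  have hv0 : 0 < v := lt_of_le_of_lt ht hv
  rw [Real.norm_of_nonneg (Real.exp_pos _).le]
  refine le_trans (Real.exp_le_exp.2 ?_) ((exp_quadratic_le hb v).trans_eq (by ring_nf))
  have h2 : Real.log v ≤ theta v := by
    rw [theta, abs_of_pos hv0]
    exact Real.log_le_log hv0 (by linarith)
  have := mul_le_mul_of_nonneg_left h2 hb
  linarith

theorem isFiniteMeasure_tailMeasure {n : ℕ} {β t : ℝ} (hβ : 0 ≤ β) (ht : 0 ≤ t) :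
    IsFiniteMeasure (tailMeasure n β t) :=
  isFiniteMeasure_withDensity_ofReal (integrableOn_tail (by positivity) ht).2

theorem tailMeasure_real (n : ℕ) (β t : ℝ) :
    (tailMeasure n β t).real Set.univ
      = ∫ v in Set.Ioi t, Real.exp (β * n * Real.log v - v ^ 2) := by
  rw [Measure.real, tailMeasure, withDensity_apply _ MeasurableSet.univ, setLIntegral_univ,
    integral_eq_lintegral_of_nonneg_ae (Eventually.of_forall fun x => (Real.exp_pos _).le)
      (by fun_prop)]

/-- Writing `|v - y_j|^β = v^β |1 - y_j/v|^β` isolates the weight `v^{βn} e^{-v²}` of the distant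
particle; the remaining factor is near 1 in L¹. -/
theorem map_splitAt_gibbs_restrict {β : ℝ} (hβ : 0 ≤ β) (t : ℝ) {n : ℕ} (k : Fin (n + 1)) :
    ((gibbs (n + 1) β).map (splitAt k)).restrict (Set.Ioi t ×ˢ Set.univ) =
      ENNReal.ofReal (partitionConst n β / partitionConst (n + 1) β) •
        ((tailMeasure n β t).prod (gibbs n β)).withDensity
          fun q => ENNReal.ofReal (Real.exp (tailExponent β q.1 q.2)) := by
  have hP := isProbabilityMeasure_gibbs hβ n
  have h1 : (tailMeasure n β t).prod (gibbs n β) =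
      (((volume : Measure ℝ).prod (gibbs n β)).restrict (Set.Ioi t ×ˢ Set.univ)).withDensity
        fun q => ENNReal.ofReal (Real.exp (β * n * Real.log q.1 - q.1 ^ 2)) := by
    rw [tailMeasure, prod_withDensity_left (by fun_prop), ← Measure.prod_restrict,
      Measure.restrict_univ]
  rw [map_splitAt_gibbs hβ, Measure.restrict_smul, restrict_withDensity
    (measurableSet_Ioi.prod MeasurableSet.univ), h1,
    ← withDensity_mul _ (by fun_prop) (by fun_prop)]
  congr 2
  ext q
  simp only [Pi.mul_apply]
  rw [← ENNReal.ofReal_mul (Real.exp_pos _).le, ← Real.exp_add, tailExponent]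
  congr 2
  ring

/-- The event that a given particle is beyond the level decouples from any observable of the others
with values in `[0, 1]`. -/
theorem abs_integral_exceed_sub_le {β t η : ℝ} (hβ : 0 ≤ β) (ht : 0 ≤ t) {n : ℕ}
    (hη : ∀ v, t ≤ v → ∫ y : Fin n → ℝ, |Real.exp (tailExponent β v y) - 1| ∂(gibbs n β) ≤ η)
    {F : (Fin n → ℝ) → ℝ} (hF : Measurable F) (hF0 : ∀ y, 0 ≤ F y) (hF1 : ∀ y, F y ≤ 1)
    (k : Fin (n + 1)) :
    |∫ x, exceed t (splitAt k x).1 * F (splitAt k x).2 ∂(gibbs (n + 1) β)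
      - partitionConst n β / partitionConst (n + 1) β * (tailMeasure n β t).real Set.univ
        * ∫ y, F y ∂(gibbs n β)|
      ≤ partitionConst n β / partitionConst (n + 1) β * (tailMeasure n β t).real Set.univ * η := by
  have hP := isProbabilityMeasure_gibbs hβ n
  have hP' := isProbabilityMeasure_gibbs hβ (n + 1)
  have hT := isFiniteMeasure_tailMeasure (n := n) hβ ht
  have hZ := partitionConst_pos hβ n
  have hZ' := partitionConst_pos hβ (n + 1)
  set ρ := partitionConst n β / partitionConst (n + 1) β with hρ
  have hρ0 : 0 < ρ := by positivity
  set T := tailMeasure n β t with hTd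
  have hmp : IsProbabilityMeasure ((gibbs (n + 1) β).map (splitAt k)) :=
    Measure.isProbabilityMeasure_map (splitAt k).measurable.aemeasurable
  have hset : MeasurableSet (Set.Ioi t ×ˢ (Set.univ : Set (Fin n → ℝ))) :=
    measurableSet_Ioi.prod MeasurableSet.univ
  have hres := map_splitAt_gibbs_restrict hβ t k
  rw [← hρ, ← hTd] at hres
  have hei : Integrable (fun q : ℝ × (Fin n → ℝ) => Real.exp (tailExponent β q.1 q.2))
      (T.prod (gibbs n β)) := by
    have h1 : Integrable (fun _ : ℝ × (Fin n → ℝ) => (1 : ℝ))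
        (((gibbs (n + 1) β).map (splitAt k)).restrict (Set.Ioi t ×ˢ Set.univ)) := integrable_const _
    rw [hres, integrable_smul_measure (by simpa using hρ0) ENNReal.ofReal_ne_top,
      integrable_withDensity_iff_integrable_smul' (by fun_prop)
      (Eventually.of_forall fun z => ENNReal.ofReal_lt_top)] at h1
    simpa only [ENNReal.toReal_ofReal (Real.exp_pos _).le, smul_eq_mul, mul_one] using h1
  have hleft : ∫ x, exceed t (splitAt k x).1 * F (splitAt k x).2 ∂(gibbs (n + 1) β)
      = ρ * ∫ q, Real.exp (tailExponent β q.1 q.2) * F q.2 ∂(T.prod (gibbs n β)) := by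
    have h1 := integral_map_equiv (μ := gibbs (n + 1) β) (splitAt k)
      fun q => exceed t q.1 * F q.2
    rw [← h1]
    have h2 : ∀ q : ℝ × (Fin n → ℝ), exceed t q.1 * F q.2
        = (Set.Ioi t ×ˢ Set.univ).indicator (fun q => F q.2) q := by
      intro q
      by_cases hq : t < q.1
      · rw [Set.indicator_of_mem (by simpa using hq), exceed, if_pos hq, one_mul]
      · rw [Set.indicator_of_notMem (by simpa using hq), exceed, if_neg hq, zero_mul]
    simp_rw [h2]
    rw [integral_indicator hset, hres, integral_smul_measure,
      integral_withDensity_eq_integral_toReal_smul (by fun_prop)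
      (Eventually.of_forall fun z => ENNReal.ofReal_lt_top)]
    simp only [ENNReal.toReal_ofReal (Real.exp_pos _).le, smul_eq_mul,
      ENNReal.toReal_ofReal hρ0.le]
  have hFi : Integrable F (gibbs n β) := integrable_of_unit hF.aestronglyMeasurable hF0 hF1
  have hright : T.real Set.univ * ∫ y, F y ∂(gibbs n β) = ∫ q, F q.2 ∂(T.prod (gibbs n β)) := by
    rw [integral_fun_snd, smul_eq_mul]
  have hFi2 : Integrable (fun q : ℝ × (Fin n → ℝ) => F q.2) (T.prod (gibbs n β)) :=
    hFi.comp_snd T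
  have heF : Integrable (fun q : ℝ × (Fin n → ℝ) => Real.exp (tailExponent β q.1 q.2) * F q.2)
      (T.prod (gibbs n β)) := by
    refine hei.mono' (by fun_prop) (Eventually.of_forall fun q => ?_)
    rw [Real.norm_of_nonneg (mul_nonneg (Real.exp_pos _).le (hF0 _))]
    exact mul_le_of_le_one_right (Real.exp_pos _).le (hF1 _)
  have hei1 : Integrable (fun q : ℝ × (Fin n → ℝ) => |Real.exp (tailExponent β q.1 q.2) - 1|)
      (T.prod (gibbs n β)) := (hei.sub (integrable_const 1)).abs
  have hTm : ∀ᵐ v ∂T, t ≤ v := by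
    refine (withDensity_absolutelyContinuous _ _).ae_le ?_
    filter_upwards [ae_restrict_mem measurableSet_Ioi] with v hv using le_of_lt hv
  have hbd : ∫ q : ℝ × (Fin n → ℝ), |Real.exp (tailExponent β q.1 q.2) - 1| ∂(T.prod (gibbs n β))
      ≤ T.real Set.univ * η := by
    rw [integral_prod _ hei1]
    have h1 : ∫ v, (∫ y : Fin n → ℝ, |Real.exp (tailExponent β v y) - 1| ∂(gibbs n β)) ∂T
        ≤ ∫ v, η ∂T := by
      refine integral_mono_ae hei1.integral_prod_left (integrable_const _) ?_
      filter_upwards [hTm] with v hv using hη v hv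
    rwa [integral_const, smul_eq_mul] at h1
  rw [hleft, mul_assoc, hright, ← mul_sub, ← integral_sub heF hFi2, abs_mul, abs_of_pos hρ0,
    mul_assoc]
  refine mul_le_mul_of_nonneg_left ?_ hρ0.le
  refine (abs_integral_le_integral_abs).trans (le_trans ?_ hbd)
  refine integral_mono (heF.sub hFi2).abs hei1 fun q => ?_
  simp only
  rw [← sub_one_mul, abs_mul, abs_of_nonneg (hF0 _)]
  exact mul_le_of_le_one_right (abs_nonneg _) (hF1 _)

/-! ### The differential equation of the generating function -/

/-- Integrating factor `e^{aθ}`: its largest value `e^a` on the interval cancels against its value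
at the endpoint, so the error is not amplified. -/
theorem abs_sub_exp_neg_le {G G' : ℝ → ℝ} {a c : ℝ} (ha : 0 ≤ a)
    (hG : ∀ θ ∈ Set.Icc (0 : ℝ) 1, HasDerivAt G (G' θ) θ) (h0 : G 0 = 1)
    (hc : ∀ θ ∈ Set.Icc (0 : ℝ) 1, |G' θ + a * G θ| ≤ c) : |G 1 - Real.exp (-a)| ≤ c := by
  have hd : ∀ θ ∈ Set.Icc (0 : ℝ) 1, HasDerivWithinAt (fun θ => Real.exp (a * θ) * G θ)
      (Real.exp (a * θ) * (G' θ + a * G θ)) (Set.Icc (0 : ℝ) 1) θ := by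
    intro θ hθ
    have h1 : HasDerivAt (fun θ : ℝ => Real.exp (a * θ)) (Real.exp (a * θ) * a) θ := by
      simpa using ((hasDerivAt_id θ).const_mul a).exp
    refine ((h1.mul (hG θ hθ)).congr_deriv ?_).hasDerivWithinAt
    ring
  have h1 := norm_image_sub_le_of_norm_deriv_le_segment_01' (C := Real.exp a * c) hd fun θ hθ => by
    rw [norm_mul, Real.norm_of_nonneg (Real.exp_pos _).le, Real.norm_eq_abs]
    refine mul_le_mul (Real.exp_le_exp.2 ?_) (hc θ ⟨hθ.1, hθ.2.le⟩) (abs_nonneg _)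
      (Real.exp_pos _).le
    nlinarith [hθ.2]
  rw [mul_zero, Real.exp_zero, h0, mul_one, mul_one, Real.norm_eq_abs] at h1
  have h2 : Real.exp a * G 1 - 1 = Real.exp a * (G 1 - Real.exp (-a)) := by
    rw [mul_sub, ← Real.exp_add, add_neg_cancel, Real.exp_zero]
  rw [h2, abs_mul, abs_of_pos (Real.exp_pos _)] at h1
  exact le_of_mul_le_mul_left h1 (Real.exp_pos _)

namespace SelfConsistent

variable {γ L : ℝ} {μ : Measure ℝ} (h : SelfConsistent γ μ L)
include h

/-- Insertion of one particle changes the generating function by three effects: the density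
`e^{insertionExponent}` differs from 1, the normalization differs from 1, and the new particle may
itself exceed the level. -/
theorem abs_exceedGen_succ_sub_le {β t θ : ℝ} (hβ : 0 ≤ β) (hθ : θ ∈ Set.Icc (0 : ℝ) 1) (n : ℕ) :
    |exceedGen (n + 1) β t θ - exceedGen n β t θ| ≤
      partitionRatio L n β * ∫ q : ℝ × (Fin n → ℝ), |Real.exp (insertionExponent γ μ β q) - 1|
        ∂(μ.prod (gibbs n β)) + |partitionRatio L n β - 1| + μ.real (Set.Ioi t) := by
  have hp := h.isProbabilityMeasure
  have hP := isProbabilityMeasure_gibbs hβ n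
  have hmi := h.measurable_insertionExponent β n
  have hr := h.partitionRatio_pos hβ n
  set r := partitionRatio L n β with hrd
  obtain ⟨hei, -⟩ := h.integrable_exp_insertionExponent hβ n
  have hG1 : exceedGen (n + 1) β t θ = ∫ q : ℝ × (Fin n → ℝ),
      r * (Real.exp (insertionExponent γ μ β q) * ((1 - θ * exceed t q.1) * thinning t θ q.2))
        ∂(μ.prod (gibbs n β)) := by
    rw [integral_const_mul, exceedGen]
    simp_rw [thinning_succ t θ (0 : Fin (n + 1))]
    exact h.integral_splitAt hβ 0 fun q => (1 - θ * exceed t q.1) * thinning t θ q.2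
  have hG0 : exceedGen n β t θ = ∫ q : ℝ × (Fin n → ℝ), thinning t θ q.2
      ∂(μ.prod (gibbs n β)) := by
    rw [integral_fun_snd, probReal_univ, one_smul, exceedGen]
  have hi0 : Integrable (fun q : ℝ × (Fin n → ℝ) => thinning t θ q.2) (μ.prod (gibbs n β)) :=
    integrable_of_unit (Measurable.aestronglyMeasurable (by fun_prop)) (fun q => thinning_nonneg hθ _) fun q => thinning_le_one hθ _
  have hu : ∀ q : ℝ × (Fin n → ℝ), 0 ≤ (1 - θ * exceed t q.1) * thinning t θ q.2 ∧
      (1 - θ * exceed t q.1) * thinning t θ q.2 ≤ 1 := fun q =>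
    ⟨mul_nonneg (factor_mem hθ _).1 (thinning_nonneg hθ _),
      mul_le_one₀ (factor_mem hθ _).2 (thinning_nonneg hθ _) (thinning_le_one hθ _)⟩
  have hi1 : Integrable (fun q : ℝ × (Fin n → ℝ) => r * (Real.exp (insertionExponent γ μ β q)
      * ((1 - θ * exceed t q.1) * thinning t θ q.2))) (μ.prod (gibbs n β)) := by
    refine Integrable.const_mul (hei.mono' (by fun_prop) (Eventually.of_forall fun q => ?_)) r
    rw [Real.norm_of_nonneg (mul_nonneg (Real.exp_pos _).le (hu q).1)]
    exact mul_le_of_le_one_right (Real.exp_pos _).le (hu q).2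
  have hia : Integrable (fun q : ℝ × (Fin n → ℝ) => r * |Real.exp (insertionExponent γ μ β q) - 1|)
      (μ.prod (gibbs n β)) := ((hei.sub (integrable_const 1)).abs).const_mul r
  have hie : Integrable (fun q : ℝ × (Fin n → ℝ) => exceed t q.1) (μ.prod (gibbs n β)) :=
    integrable_of_unit (Measurable.aestronglyMeasurable (by fun_prop)) (fun q => exceed_nonneg _ _) fun q => exceed_le_one _ _
  have hib : Integrable (fun q : ℝ × (Fin n → ℝ) => |r - 1| + exceed t q.1) (μ.prod (gibbs n β)) :=
    (integrable_const _).add hie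
  have hev : ∫ q : ℝ × (Fin n → ℝ), exceed t q.1 ∂(μ.prod (gibbs n β)) = μ.real (Set.Ioi t) := by
    rw [integral_fun_fst, probReal_univ, one_smul]
    have : exceed t = (Set.Ioi t).indicator fun _ => (1 : ℝ) := by
      ext x
      by_cases hx : t < x
      · rw [Set.indicator_of_mem (by simpa using hx), exceed, if_pos hx]
      · rw [Set.indicator_of_notMem (by simpa using hx), exceed, if_neg hx]
    rw [this, integral_indicator measurableSet_Ioi]
    simp [Measure.real]
  rw [hG1, hG0, ← integral_sub hi1 hi0]
  refine abs_integral_le_integral_abs.trans ?_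
  refine (integral_mono (hi1.sub hi0).abs (hia.add hib) fun q => ?_).trans_eq ?_
  · simp only [Pi.sub_apply, Pi.add_apply]
    set E := Real.exp (insertionExponent γ μ β q)
    set Θ := thinning t θ q.2
    have hΘ0 : 0 ≤ Θ := thinning_nonneg hθ _
    have hΘ1 : Θ ≤ 1 := thinning_le_one hθ _
    have he0 := exceed_nonneg t q.1
    have he1 := exceed_le_one t q.1
    obtain ⟨hf0, hf1⟩ := factor_mem (t := t) hθ q.1
    have e1 : r * (E * ((1 - θ * exceed t q.1) * Θ)) - Θ
        = Θ * ((1 - θ * exceed t q.1) * (r * (E - 1) + (r - 1)) - θ * exceed t q.1) := by ring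
    rw [e1, abs_mul, abs_of_nonneg hΘ0]
    refine (mul_le_of_le_one_left (abs_nonneg _) hΘ1).trans ?_
    refine (abs_sub _ _).trans ?_
    rw [abs_mul, abs_of_nonneg hf0, abs_of_nonneg (mul_nonneg hθ.1 he0)]
    have h2 : |r * (E - 1) + (r - 1)| ≤ r * |E - 1| + |r - 1| := by
      refine (abs_add_le _ _).trans ?_
      rw [abs_mul, abs_of_pos hr]
    have h3 := (mul_le_of_le_one_left (abs_nonneg (r * (E - 1) + (r - 1))) hf1).trans h2
    have h4 := mul_le_of_le_one_left he0 hθ.2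
    linarith
  · simp only [Pi.add_apply]
    rw [integral_add hia hib, integral_add (integrable_const _) hie, integral_const_mul, hev]
    simp only [integral_const, probReal_univ, smul_eq_mul, one_mul]
    ring

/-- The probability that no particle exceeds a level is nearly exponential in the expected number
of exceedances. -/
theorem abs_exceedGen_one_sub_le {β t η κ a : ℝ} (hβ : 0 ≤ β) (ht : 0 ≤ t) {n : ℕ}
    (hη : ∀ v, t ≤ v → ∫ y : Fin n → ℝ, |Real.exp (tailExponent β v y) - 1| ∂(gibbs n β) ≤ η)
    (ha : a = (n + 1) * (partitionConst n β / partitionConst (n + 1) β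
      * (tailMeasure n β t).real Set.univ))
    (hκ : partitionRatio L n β * ∫ q : ℝ × (Fin n → ℝ),
      |Real.exp (insertionExponent γ μ β q) - 1| ∂(μ.prod (gibbs n β))
        + |partitionRatio L n β - 1| + μ.real (Set.Ioi t) ≤ κ) :
    |exceedGen (n + 1) β t 1 - Real.exp (-a)| ≤ a * (η + κ) := by
  have hP' := isProbabilityMeasure_gibbs hβ (n + 1)
  have hZ := partitionConst_pos hβ n
  have hZ' := partitionConst_pos hβ (n + 1)
  have ha0 : 0 ≤ a := by rw [ha]; positivity
  -- The derivative for `n + 1` particles is approximately `-a` times the generating function for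
  -- `n` particles; replacing the latter by that for `n + 1` closes the equation. The errors are `a
  -- η` and `a κ`.
  refine abs_sub_exp_neg_le ha0 (fun θ hθ => hasDerivAt_exceedGen hβ hθ n) ?_ fun θ hθ => ?_
  · simp [exceedGen, thinning_zero]
  have h1 := fun k : Fin (n + 1) => abs_integral_exceed_sub_le hβ ht hη
    (measurable_thinning t θ n) (thinning_nonneg hθ) (thinning_le_one hθ) k
  set A := partitionConst n β / partitionConst (n + 1) β * (tailMeasure n β t).real Set.univ
  set S : Fin (n + 1) → ℝ := fun k => ∫ x : Fin (n + 1) → ℝ,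
      exceed t (splitAt k x).1 * thinning t θ (splitAt k x).2 ∂(gibbs (n + 1) β) with hS
  have h2 : |∑ k, S k - a * exceedGen n β t θ| ≤ a * η := by
    have h3 : ∑ k, S k - a * exceedGen n β t θ = ∑ k, (S k - A * exceedGen n β t θ) := by
      rw [Finset.sum_sub_distrib, ha]
      simp
      ring
    rw [h3]
    refine (Finset.abs_sum_le_sum_abs _ _).trans ((Finset.sum_le_sum fun k _ => h1 k).trans_eq ?_)
    rw [ha]
    simp
    ring
  have h4 := (h.abs_exceedGen_succ_sub_le (t := t) hβ hθ n).trans hκ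
  have h5 : -∑ k, S k + a * exceedGen (n + 1) β t θ
      = -(∑ k, S k - a * exceedGen n β t θ)
        + a * (exceedGen (n + 1) β t θ - exceedGen n β t θ) := by ring
  rw [h5]
  refine (abs_add_le _ _).trans ?_
  rw [abs_neg, abs_mul, abs_of_nonneg ha0, mul_add]
  gcongr

end SelfConsistent

end LogGas

end

/-! ### Laplace asymptotics at the Gumbel level and convergence in law. -/

noncomputable section

namespace LogGas

/-! ### The expected number of exceedances -/

/-- Substitution `v = t + w/t`, the scale on which `e^{-v²}` decays past `t`. -/
theorem integral_tail_eq (b : ℝ) {t : ℝ} (ht : 0 < t) :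
    ∫ v in Set.Ioi t, Real.exp (b * Real.log v - v ^ 2) =
      t⁻¹ * Real.exp (b * Real.log t - t ^ 2) *
        ∫ w in Set.Ioi (0 : ℝ), Real.exp (b * Real.log (1 + w / t ^ 2) - 2 * w - w ^ 2 / t ^ 2) := by
  have h1 := (measurePreserving_add_right (volume : Measure ℝ) t).setIntegral_preimage_emb
    (measurableEmbedding_addRight t) (fun v => Real.exp (b * Real.log v - v ^ 2)) (Set.Ioi t)
  rw [Set.preimage_add_const_Ioi, sub_self] at h1
  have h2 := integral_comp_mul_left_Ioi
    (fun v => Real.exp (b * Real.log (v + t) - (v + t) ^ 2)) 0 (inv_pos.2 ht)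
  rw [mul_zero, inv_inv, smul_eq_mul] at h2
  rw [← h1, mul_assoc, eq_inv_mul_iff_mul_eq₀ ht.ne', ← h2, ← integral_const_mul]
  refine setIntegral_congr_fun measurableSet_Ioi fun w hw => ?_
  have hw0 : (0 : ℝ) < w := hw
  rw [← Real.exp_add]
  have h3 : t⁻¹ * w + t = t * (1 + w / t ^ 2) := by field_simp; ring
  rw [h3, Real.log_mul ht.ne' (by positivity)]
  congr 1
  field_simp
  ring

/-- The limit is `∫ e^{-2w} dw`, and the integrand is below `e^{-w}` as soon as `b n ≤ (t n)²`. The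
value 1/2 accounts for the 2 in `log (2L)`. -/
theorem tendsto_tail_factor {b t : ℕ → ℝ} {γ : ℝ} (hb0 : ∀ n, 0 ≤ b n)
    (hb : Tendsto b atTop (𝓝 γ)) (ht : Tendsto t atTop atTop) :
    Tendsto (fun n => ∫ w in Set.Ioi (0 : ℝ),
      Real.exp (b n * Real.log (1 + w / t n ^ 2) - 2 * w - w ^ 2 / t n ^ 2)) atTop
      (𝓝 (1 / 2)) := by
  have ht2 : Tendsto (fun n => t n ^ 2) atTop atTop :=
    (tendsto_pow_atTop two_ne_zero).comp ht
  have hlim : ∫ w in Set.Ioi (0 : ℝ), Real.exp (-2 * w) = 1 / 2 := by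
    rw [integral_exp_mul_Ioi (by norm_num)]
    norm_num
  rw [← hlim]
  refine tendsto_integral_filter_of_dominated_convergence (fun w => Real.exp (-1 * w))
    (Eventually.of_forall fun n => by fun_prop) ?_ (exp_neg_integrableOn_Ioi 0 one_pos) ?_
  · filter_upwards [hb.eventually_le_const (show γ < γ + 1 by linarith),
      ht2.eventually_ge_atTop (γ + 1), ht2.eventually_gt_atTop 0] with n h1 h2 h3
    filter_upwards [ae_restrict_mem measurableSet_Ioi] with w hw
    have hw0 : (0 : ℝ) < w := hw
    rw [Real.norm_of_nonneg (Real.exp_pos _).le]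
    apply Real.exp_le_exp.2
    have h4 : Real.log (1 + w / t n ^ 2) ≤ w / t n ^ 2 := by
      have := Real.log_le_sub_one_of_pos (show 0 < 1 + w / t n ^ 2 by positivity)
      linarith
    have h5 : b n * Real.log (1 + w / t n ^ 2) ≤ w := by
      calc _ ≤ b n * (w / t n ^ 2) := mul_le_mul_of_nonneg_left h4 (hb0 n)
        _ ≤ t n ^ 2 * (w / t n ^ 2) := by
          gcongr
          linarith
        _ = w := mul_div_cancel₀ _ h3.ne'
    have h6 : 0 ≤ w ^ 2 / t n ^ 2 := by positivity
    linarith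
  · refine Eventually.of_forall fun w => ?_
    have h1 : Tendsto (fun n => w / t n ^ 2) atTop (𝓝 0) := tendsto_const_nhds.div_atTop ht2
    have h2 : Tendsto (fun n => w ^ 2 / t n ^ 2) atTop (𝓝 0) := tendsto_const_nhds.div_atTop ht2
    have h3 : Tendsto (fun n => Real.log (1 + w / t n ^ 2)) atTop (𝓝 0) := by
      have := ((tendsto_const_nhds (x := (1 : ℝ))).add h1).log (by norm_num)
      simpa using this
    have h4 := (((hb.mul h3).sub_const (2 * w)).sub h2).rexp
    rw [mul_zero, zero_sub, sub_zero, ← neg_mul] at h4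
    exact h4

/-- The level at which the rescaled maximum equals `s`. -/
def gumbelLevel (L s : ℝ) (N : ℕ) (β : ℝ) : ℝ :=
  √(Real.log N) + (s + (β * N - 1) / 2 * Real.log (Real.log N) - Real.log (2 * L))
    / (2 * √(Real.log N))

theorem tendsto_log_div_sqrt : Tendsto (fun x : ℝ => Real.log x / √x) atTop (𝓝 0) := by
  have := (isLittleO_log_rpow_atTop (show (0 : ℝ) < 1 / 2 by norm_num)).tendsto_div_nhds_zero
  simpa only [Real.sqrt_eq_rpow] using this

/-- Write `ℓ = log (n + 1)`. The squared level is `ℓ + c + c²/(4ℓ)` with `c² / ℓ → 0`, and its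
logarithm is `½ log ℓ + o(1)`. The `log log` term in `c` is chosen to cancel the power of the level.
-/
theorem tendsto_gumbelLevel {b : ℕ → ℝ} {γ : ℝ} (L s : ℝ) (hb0 : ∀ n, 0 ≤ b n)
    (hb : Tendsto (fun n : ℕ => b n * (n + 1 : ℕ)) atTop (𝓝 γ)) :
    Tendsto (fun n => gumbelLevel L s (n + 1) (b n)) atTop atTop ∧
    Tendsto (fun n : ℕ => Real.log (n + 1 : ℕ) - Real.log (2 * L)
      + (b n * n - 1) * Real.log (gumbelLevel L s (n + 1) (b n))
      - gumbelLevel L s (n + 1) (b n) ^ 2) atTop (𝓝 (-s)) := by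
  obtain ⟨hb1, hb2⟩ := tendsto_zero_of_mul_tendsto (tendsto_add_atTop_nat 1) hb
  have hb' : Tendsto (fun n : ℕ => b n * n) atTop (𝓝 γ) := by
    have := hb.sub hb1
    rw [sub_zero] at this
    exact this.congr fun n => by push_cast; ring
  set ℓ : ℕ → ℝ := fun n => Real.log (n + 1 : ℕ) with hℓ
  have hℓt : Tendsto ℓ atTop atTop :=
    Real.tendsto_log_atTop.comp (tendsto_natCast_atTop_atTop.comp (tendsto_add_atTop_nat 1))
  have hst : Tendsto (fun n => √(ℓ n)) atTop atTop := Real.tendsto_sqrt_atTop.comp hℓt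
  set c : ℕ → ℝ := fun n => s + (b n * (n + 1 : ℕ) - 1) / 2 * Real.log (ℓ n) - Real.log (2 * L)
    with hc
  have hcd : Tendsto (fun n => c n / √(ℓ n)) atTop (𝓝 0) := by
    have h1 : Tendsto (fun n => (s - Real.log (2 * L)) / √(ℓ n)) atTop (𝓝 0) :=
      tendsto_const_nhds.div_atTop hst
    have h2 := ((hb.sub_const 1).div_const 2).mul (tendsto_log_div_sqrt.comp hℓt)
    have h3 := h1.add h2
    rw [mul_zero, add_zero] at h3
    refine h3.congr fun n => ?_
    simp only [Function.comp_apply, hc]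
    ring
  have hcl : Tendsto (fun n => c n / (2 * ℓ n)) atTop (𝓝 0) := by
    have h1 := hcd.div_atTop (hst.const_mul_atTop two_pos)
    refine h1.congr' ?_
    filter_upwards [hℓt.eventually_gt_atTop 0] with n hn
    rw [div_div]
    congr 1
    have := Real.mul_self_sqrt hn.le
    linarith
  have hlev : ∀ n, 0 < ℓ n → gumbelLevel L s (n + 1) (b n) = √(ℓ n) * (1 + c n / (2 * ℓ n)) := by
    intro n hn
    have h1 : 0 < √(ℓ n) := Real.sqrt_pos.2 hn
    have h2 : ℓ n = √(ℓ n) ^ 2 := (Real.sq_sqrt hn.le).symm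
    have h3 : gumbelLevel L s (n + 1) (b n) = √(ℓ n) + c n / (2 * √(ℓ n)) := rfl
    rw [h3, mul_add, mul_one]
    congr 1
    rw [div_eq_iff (by positivity)]
    field_simp
    rw [← h2]
  have h1c := (tendsto_const_nhds (x := (1 : ℝ))).add hcl
  rw [add_zero] at h1c
  constructor
  · refine (hst.atTop_mul_pos one_pos h1c).congr' ?_
    filter_upwards [hℓt.eventually_gt_atTop 0] with n hn using (hlev n hn).symm
  · have hlog := h1c.log one_ne_zero
    rw [Real.log_one] at hlog
    -- The level contains `β (n + 1)` but the tail weight contains `β n`; the mismatch is `½ β log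
    -- log (n + 1)`, which vanishes.
    have hbl : Tendsto (fun n => b n * Real.log (ℓ n)) atTop (𝓝 0) := by
      refine tendsto_of_tendsto_of_tendsto_of_le_of_le' tendsto_const_nhds hb2 ?_ ?_
      · filter_upwards [hℓt.eventually_ge_atTop 1] with n hn
        exact mul_nonneg (hb0 n) (Real.log_nonneg hn)
      · filter_upwards [hℓt.eventually_gt_atTop 0] with n hn
        refine mul_le_mul_of_nonneg_left ?_ (hb0 n)
        have := Real.log_le_sub_one_of_pos hn
        simp only [hℓ] at this ⊢
        linarith
    have hlim := ((((hbl.div_const 2).neg).add ((hb'.sub_const 1).mul hlog)).sub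
      ((hcd.pow 2).div_const 4)).const_add (-s)
    rw [show -s + (-(0 / 2) + (γ - 1) * 0 - 0 ^ 2 / 4) = -s by ring] at hlim
    refine hlim.congr' ?_
    filter_upwards [hℓt.eventually_gt_atTop 0, h1c.eventually_const_lt one_pos] with n hn hn1
    have h1 : 0 < √(ℓ n) := Real.sqrt_pos.2 hn
    rw [hlev n hn, Real.log_mul h1.ne' hn1.ne', Real.log_sqrt hn.le, mul_pow, Real.sq_sqrt hn.le,
      div_pow, Real.sq_sqrt hn.le]
    have h2 : ℓ n * (1 + c n / (2 * ℓ n)) ^ 2 = ℓ n + c n + c n ^ 2 / ℓ n / 4 := by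
      field_simp
      ring
    have h3 : c n = s + (b n * (n + 1 : ℕ) - 1) / 2 * Real.log (ℓ n) - Real.log (2 * L) := rfl
    have h4 : Real.log (n + 1 : ℕ) = ℓ n := rfl
    rw [h2, h4]
    push_cast at h3
    linear_combination h3

/-! ### Convergence of distribution functions -/

/-- Half-open intervals form a π-system containing small neighbourhoods of every point, and their
masses are differences of distribution functions. -/
theorem tendsto_of_tendsto_Iic {P : ℕ → ProbabilityMeasure ℝ} {ν : ProbabilityMeasure ℝ}
    (h : ∀ s, Tendsto (fun n => (P n : Measure ℝ).real (Set.Iic s)) atTop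
      (𝓝 ((ν : Measure ℝ).real (Set.Iic s)))) : Tendsto P atTop (𝓝 ν) := by
  refine (isPiSystem_Ioc (id : ℝ → ℝ) id).tendsto_probabilityMeasure_of_tendsto_of_mem ?_ ?_ ?_
  · rintro _ ⟨l, u, -, rfl⟩
    exact measurableSet_Ioc
  · intro U hU x hx
    obtain ⟨ε, hε, hball⟩ := Metric.isOpen_iff.1 hU x hx
    refine ⟨Set.Ioc (x - ε / 2) (x + ε / 2), ⟨x - ε / 2, x + ε / 2, ?_, rfl⟩,
      Ioc_mem_nhds (by linarith) (by linarith), fun y hy => hball ?_⟩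
    · simp only [id]; linarith
    · rw [Metric.mem_ball, Real.dist_eq, abs_lt]
      constructor <;> linarith [hy.1, hy.2]
  · rintro _ ⟨l, u, hlu, rfl⟩
    simp only [id] at hlu ⊢
    have hd : ∀ Q : ProbabilityMeasure ℝ, ((Q (Set.Ioc l u) : ℝ≥0) : ℝ)
        = (Q : Measure ℝ).real (Set.Iic u) - (Q : Measure ℝ).real (Set.Iic l) := by
      intro Q
      rw [← measureReal_sdiff (Set.Iic_subset_Iic.2 hlu.le) measurableSet_Iic,
        Set.Iic_sdiff_Iic]
      rfl
    rw [← NNReal.tendsto_coe]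
    simp_rw [hd]
    exact (h u).sub (h l)

theorem measurable_rescaledMax (L : ℝ) (N : ℕ) (β : ℝ) : Measurable (rescaledMax L N β) := by
  have h1 : Measurable fun x : Fin N → ℝ => ⨆ j, x j := Measurable.iSup fun j => by fun_prop
  unfold rescaledMax
  fun_prop

/-- At `θ = 1` the thinning is the indicator that no particle exceeds the level. At least two
particles are needed so that `log N > 0` and the rescaling can be inverted. -/
theorem exceedGen_one_eq {N : ℕ} {L s β : ℝ} (hN : 2 ≤ N) :
    exceedGen N β (gumbelLevel L s N β) 1 = (gibbs N β).real {x | rescaledMax L N β x ≤ s} := by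
  have hN0 : Nonempty (Fin N) := ⟨⟨0, by omega⟩⟩
  have hℓ : 0 < Real.log N := Real.log_pos (by exact_mod_cast hN)
  have hs : 0 < √(Real.log N) := Real.sqrt_pos.2 hℓ
  have hset : MeasurableSet {x | rescaledMax L N β x ≤ s} :=
    measurableSet_le (measurable_rescaledMax L N β) measurable_const
  have hiff : ∀ x : Fin N → ℝ, rescaledMax L N β x ≤ s ↔ ∀ j, x j ≤ gumbelLevel L s N β := by
    intro x
    rw [← ciSup_le_iff (Set.finite_range x).bddAbove, rescaledMax, gumbelLevel]
    set m := ⨆ j, x j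
    set c := s + (β * N - 1) / 2 * Real.log (Real.log N) - Real.log (2 * L) with hc
    have h1 : √(Real.log N) + c / (2 * √(Real.log N))
        = (2 * Real.log N + c) / (2 * √(Real.log N)) := by
      rw [eq_div_iff (by positivity), add_mul, div_mul_cancel₀ _ (by positivity)]
      linarith [Real.mul_self_sqrt hℓ.le]
    rw [h1, le_div_iff₀ (by positivity), hc]
    constructor <;> intro h <;> linarith
  have hth : (thinning (gumbelLevel L s N β) 1 : (Fin N → ℝ) → ℝ)
      = {x | rescaledMax L N β x ≤ s}.indicator fun _ => 1 := by
    ext x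
    by_cases hx : rescaledMax L N β x ≤ s
    · rw [Set.indicator_of_mem (show x ∈ {x | rescaledMax L N β x ≤ s} from hx), thinning]
      refine Finset.prod_eq_one fun j _ => ?_
      rw [exceed, if_neg (not_lt.2 ((hiff x).1 hx j))]
      simp
    · rw [Set.indicator_of_notMem (show x ∉ {x | rescaledMax L N β x ≤ s} from hx), thinning]
      rw [hiff] at hx
      push Not at hx
      obtain ⟨j, hj⟩ := hx
      refine Finset.prod_eq_zero (Finset.mem_univ j) ?_
      rw [exceed, if_pos hj]
      simp
  rw [exceedGen, hth, integral_indicator hset]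
  simp [Measure.real]

namespace SelfConsistent

variable {γ L : ℝ} {μ : Measure ℝ} (h : SelfConsistent γ μ L)
include h

theorem tendsto_real_rescaledMax_le {b : ℕ → ℝ} (hb0 : ∀ n, 0 ≤ b n)
    (hb : Tendsto (fun n : ℕ => b n * (n + 1 : ℕ)) atTop (𝓝 γ)) (s : ℝ) :
    Tendsto (fun n => (gibbs (n + 1) (b n)).real {x | rescaledMax L (n + 1) (b n) x ≤ s}) atTop
      (𝓝 (Real.exp (-Real.exp (-s)))) := by
  have hp := h.isProbabilityMeasure
  have hL := h.pos
  have hb1 := (tendsto_zero_of_mul_tendsto (tendsto_add_atTop_nat 1) hb).1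
  have hb' : Tendsto (fun n : ℕ => b n * n) atTop (𝓝 γ) := by
    have := hb.sub hb1
    rw [sub_zero] at this
    exact this.congr fun n => by push_cast; ring
  set t : ℕ → ℝ := fun n => gumbelLevel L s (n + 1) (b n) with ht
  obtain ⟨htt, hexp⟩ := tendsto_gumbelLevel L s hb0 hb
  rw [← ht] at htt
  obtain ⟨hr, hE⟩ := h.tendsto_partitionRatio hb0 hb
  set a : ℕ → ℝ := fun n => (n + 1) * (partitionConst n (b n) / partitionConst (n + 1) (b n)
      * (tailMeasure n (b n) (t n)).real Set.univ) with ha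
  have hat : Tendsto a atTop (𝓝 (Real.exp (-s))) := by
    -- The quantity `a n` factors into `partitionRatio`, twice the tail factor, and the exponential
    -- whose exponent tends to `-s`.
    have h1 := ((hr.mul ((tendsto_tail_factor (fun n => mul_nonneg (hb0 n) n.cast_nonneg) hb'
      htt).const_mul 2)).mul hexp.rexp)
    rw [show (1 : ℝ) * (2 * (1 / 2)) * Real.exp (-s) = Real.exp (-s) by ring] at h1
    refine h1.congr' ?_
    filter_upwards [htt.eventually_gt_atTop 0] with n hn
    have hn1 : (0 : ℝ) < (n + 1 : ℕ) := by positivity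
    simp only [ha]
    rw [tailMeasure_real, integral_tail_eq _ hn]
    set J := ∫ w in Set.Ioi (0 : ℝ),
      Real.exp (b n * n * Real.log (1 + w / t n ^ 2) - 2 * w - w ^ 2 / t n ^ 2)
    have h2 : Real.exp (Real.log (n + 1 : ℕ) - Real.log (2 * L)
        + (b n * n - 1) * Real.log (t n) - t n ^ 2) = (n + 1) / (2 * L) *
          ((t n)⁻¹ * Real.exp (b n * n * Real.log (t n) - t n ^ 2)) := by
      rw [show Real.log (n + 1 : ℕ) - Real.log (2 * L) + (b n * n - 1) * Real.log (t n) - t n ^ 2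
        = Real.log (n + 1 : ℕ) - Real.log (2 * L) + (-Real.log (t n)
          + (b n * n * Real.log (t n) - t n ^ 2)) by ring, Real.exp_add, Real.exp_sub,
        Real.exp_log hn1, Real.exp_log (by positivity), Real.exp_add, Real.exp_neg,
        Real.exp_log hn]
      push_cast
      ring
    rw [h2, partitionRatio]
    field_simp
  have hμ : Tendsto (fun n => μ.real (Set.Ioi (t n))) atTop (𝓝 0) := by
    have h1 := ((tendsto_cdf_atTop μ).comp htt).const_sub 1
    rw [sub_self] at h1
    refine h1.congr fun n => ?_
    rw [Function.comp_apply, cdf_eq_real, ← probReal_compl_eq_one_sub measurableSet_Iic,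
      Set.compl_Iic]
  set κ : ℕ → ℝ := fun n => partitionRatio L n (b n) * ∫ q : ℝ × (Fin n → ℝ),
      |Real.exp (insertionExponent γ μ (b n) q) - 1| ∂(μ.prod (gibbs n (b n)))
        + |partitionRatio L n (b n) - 1| + μ.real (Set.Ioi (t n)) with hκ
  have hκt : Tendsto κ atTop (𝓝 0) := by
    have h1 := ((hr.mul hE).add (hr.sub_const 1).abs).add hμ
    simpa using h1
  have hdiff : Tendsto (fun n => exceedGen (n + 1) (b n) (t n) 1 - Real.exp (-a n)) atTop
      (𝓝 0) := by
    rw [Metric.tendsto_atTop']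
    intro ε hε
    set A := Real.exp (-s) + 1 with hA
    have hA0 : 0 < A := by positivity
    set η := ε / (4 * A) with hη
    have hη0 : 0 < η := by positivity
    have hev : ∀ᶠ n in atTop, |exceedGen (n + 1) (b n) (t n) 1 - Real.exp (-a n)| < ε := by
      filter_upwards [h.eventually_integral_abs_exp_tailExponent_le hb0 hb htt hη0,
        hκt.eventually_le_const hη0, htt.eventually_ge_atTop 0,
        hat.eventually_le_const (show Real.exp (-s) < A by rw [hA]; linarith)] with n h1 h2 h3 h4
      refine (h.abs_exceedGen_one_sub_le (hb0 n) h3 (fun v hv => (h1 v hv).2) rfl h2).trans_lt ?_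
      have h5 : a n * (η + η) ≤ A * (η + η) := by gcongr
      refine h5.trans_lt ?_
      rw [hη]
      have : A * (ε / (4 * A) + ε / (4 * A)) = ε / 2 := by field_simp; ring
      rw [this]
      linarith
    obtain ⟨N, hN⟩ := eventually_atTop.1 hev
    exact ⟨N, fun n hn => by rw [Real.dist_eq, sub_zero]; exact hN n hn.le⟩
  have hfin := hdiff.add hat.neg.rexp
  rw [zero_add] at hfin
  refine hfin.congr' ?_
  filter_upwards [eventually_ge_atTop 1] with n hn
  rw [sub_add_cancel]
  exact exceedGen_one_eq (by omega)

end SelfConsistent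

end LogGas

end

theorem mainTheorem6 (γ : ℝ) (hγ : 0 ≤ γ) :
    ∃ (μ : Measure ℝ) (L : ℝ),
      LogGas.IsEquilibriumMeasure (fun x => x ^ 2) γ μ ∧
      LogGas.IsEquilibriumConstant (fun x => x ^ 2) γ μ L ∧
      ∀ β : ℕ → ℝ, (∀ N, 0 < β N) → Tendsto (fun N : ℕ => β N * N) atTop (𝓝 γ) →
        ∃ _ : ∀ N, IsProbabilityMeasure (LogGas.gibbsMeasure (fun x => x ^ 2) N (β N)),
          TendstoInDistribution (fun N => LogGas.rescaledMax L N (β N)) atTop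
            (id : ℝ → ℝ) (fun N => LogGas.gibbsMeasure (fun x => x ^ 2) N (β N))
            LogGas.gumbelMeasure := by
  obtain ⟨μ, L, hμ, hL, hdom⟩ := LogGas.exists_equilibrium hγ
  refine ⟨μ, L, hμ, hL, fun β hβ hlim => ?_⟩
  have h : LogGas.SelfConsistent γ μ L := ⟨hμ.isProbabilityMeasure, hdom, hL⟩
  have hP : ∀ N, IsProbabilityMeasure (LogGas.gibbsMeasure (fun x => x ^ 2) N (β N)) :=
    fun N => LogGas.isProbabilityMeasure_gibbs (hβ N).le N
  have hm := fun N => LogGas.measurable_rescaledMax L N (β N)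
  refine ⟨hP, ⟨fun N => (hm N).aemeasurable, aemeasurable_id, ?_⟩⟩
  refine LogGas.tendsto_of_tendsto_Iic fun s => ?_
  have h1 := h.tendsto_real_rescaledMax_le (b := fun n => β (n + 1)) (fun n => (hβ _).le)
    ((tendsto_add_atTop_iff_nat (f := fun N : ℕ => β N * N) 1).2 hlim) s
  -- The estimates compare `n + 1` particles with `n`, both at inverse temperature `β (n + 1)`; the
  -- shift of index does not affect the limit.
  rw [← tendsto_add_atTop_iff_nat 1]
  have h2 : (LogGas.gumbelMeasure.map id).real (Set.Iic s) = Real.exp (-Real.exp (-s)) := by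
    rw [Measure.map_id, Measure.real, LogGas.gumbelMeasure_Iic,
      ENNReal.toReal_ofReal (Real.exp_pos _).le]
  simp only [ProbabilityMeasure.coe_mk]
  rw [h2]
  refine h1.congr fun n => ?_
  rw [map_measureReal_apply (hm _) measurableSet_Iic]
  rfl
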